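/- Let $G$ be a finite group. A $G$-Tambara functor $R$ assigns to each finite $G$-set $X$ a commutative ring $R(X)$, with $R(X\sqcup Y)\cong R(X)\times R(Y)$ and $R(\emptyset)=0$, and to each map $f$ of finite $G$-sets a restriction $\mathrm{res}_f$ (a ring map), an additive transfer $\mathrm{tr}_f$ and a multiplicative norm $\mathrm{nm}_f$, functorial in $f$ and satisfying base change along pullback squares, Frobenius reciprocity, and the exponential formula for norms of transfers. A $k$-algebra is a morphism $k\to R$ of Tambara functors; a $k$-module is a module over the underlying Green functor of $k$. For $k$-modules $M,N$ let $M\boxtimes_k N$ be the relative box product. A $k$-module $M$ is flat if $M\boxtimes_k-$ is exact; a $k$-algebra $R$ is flat if it is flat as a $k$-module. For $k$-algebras $R$ and $\ell$, the box product $R\boxtimes_k\ell$ of the underlying modules carries its Tambara functor structure (levelwise products of external products, and norms with $\mathrm{nm}_f(r\otimes s)=\mathrm{nm}_f(r)\otimes \mathrm{nm}_f(s)$) and is an $\ell$-algebra via $b\mapsto 1\otimes b$. A free polynomial $k$-algebra on finitely many generators is one representing the functor $S\mapsto\prod_{i=1}^n S(X_i)$ on $k$-algebras, for finite $G$-sets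 $X_1,\dots,X_n$. A $k$-algebra is finitely presented if it is a coequalizer, in $k$-algebras, of two maps between free polynomial $k$-algebras on finitely many generators. For a Tambara ideal $I$ of $R$ let $I^{>1}$ be the Tambara ideal generated by all products of two elements of $I$ and by all norms $\mathrm{nm}_f(x)$ with $x\in I$ and $f:G/K\to G/H$ not an isomorphism. For a $k$-algebra $R$ with $I=\ker(R\boxtimes_k R\to R)$ the kernel of multiplication, set $\Omega^{1,\mathrm{Tamb}}_{R/k}=I/I^{>1}$. The morphism $k\to R$ is étale if $R$ is flat over $k$, $\Omega^{1,\mathrm{Tamb}}_{R/k}=0$, and $R$ is finitely presented over $k$. Let $k\to\ell$ and $k\to R$ be morphisms of $G$-Tambara functors. Then: 1. if $R$ is finitely presented over $k$, then $R\boxtimes_k\ell$ is finitely presented over $\ell$; 2. if $R$ is flat over $k$, then $R\boxtimes_k\ell$ is flat over $\ell$; 3. if $k\to\ell$ is flat and $\Omega^{1,\mathrm{Tamb}}_{R/k}=0$, then $\Omega^{1,\mathrm{Tamb}}_{R\boxtimes_k\ell/\ell}=0$. Hence, if $k\to\ell$ is flat and $k\to R$ is étale, then $\ell\to R\boxtimes_k\ell$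 is étale. -/

import Mathlib

universe w u

/-! ## Finite `G`-sets -/

/-- A finite `G`-set.  The underlying set is required to be `Fin n`, so that the finite `G`-sets form
a small type; every finite `G`-set is isomorphic to one of these (see `FinGSet.of`). -/
structure FinGSet (G : Type u) [Group G] : Type u where
  card : ℕ
  action : MulAction G (Fin card)

namespace FinGSet

variable {G : Type u} [Group G]

/-- The underlying set of a finite `G`-set. -/
def Carrier (X : FinGSet G) : Type := Fin X.card

instance : CoeSort (FinGSet G) Type := ⟨Carrier⟩

instance (X : FinGSet G) : MulAction G X := X.action

instance (X : FinGSet G) : Finite X := inferInstanceAs (Finite (Fin X.card))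

/-- `G`-equivariant maps. -/
@[ext]
structure Map (X Y : FinGSet G) : Type where
  toFun : X → Y
  map_smul' : ∀ (g : G) (x : X), toFun (g • x) = g • toFun x

instance (X Y : FinGSet G) : CoeFun (Map X Y) (fun _ => X → Y) := ⟨Map.toFun⟩

namespace Map

variable {X Y Z : FinGSet G}

@[simp] theorem map_smul (f : Map X Y) (g : G) (x : X) : f (g • x) = g • f x := f.map_smul' g x

/-- The identity map. -/
def id (X : FinGSet G) : Map X X := ⟨fun x => x, fun _ _ => rfl⟩

/-- Composition `g ∘ f`. -/
def comp (g : Map Y Z) (f : Map X Y) : Map X Z := ⟨fun x => g (f x), fun a x => by simp⟩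

@[simp] theorem id_apply (x : X) : Map.id X x = x := rfl
@[simp] theorem comp_apply (g : Map Y Z) (f : Map X Y) (x : X) : g.comp f x = g (f x) := rfl

theorem ext' {f g : Map X Y} (h : ∀ x, f x = g x) : f = g := Map.ext (funext h)

theorem congr {f g : Map X Y} (h : f = g) (x : X) : f x = g x := by rw [h]

theorem exists_of_rel (r : X → Y → Prop) (h : ∀ x, ∃! y, r x y)
    (hr : ∀ (g : G) x y, r x y → r (g • x) (g • y)) : ∃ f : Map X Y, ∀ x, r x (f x) := by
  choose f hf hu using h
  exact ⟨⟨f, fun g x => (hu _ _ (hr g x _ (hf x))).symm⟩, hf⟩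

theorem exists_inv (f : Map X Y) (hf : Function.Bijective f) :
    ∃ k : Map Y X, (∀ y, f (k y) = y) ∧ ∀ x, k (f x) = x := by
  obtain ⟨k, hk⟩ := exists_of_rel (X := Y) (Y := X) (fun y x => f x = y)
    (fun y => hf.existsUnique y) (fun g y x h => by simp [h])
  exact ⟨k, hk, fun x => hf.1 (hk _)⟩

end Map

/-- The finite `G`-set (with underlying set some `Fin n`) isomorphic to a given finite type with a
`G`-action. -/
noncomputable def of (G : Type u) [Group G] (α : Type) [MulAction G α] [Finite α] : FinGSet G where
  card := Nat.card α
  action := Equiv.mulAction G (Finite.equivFin α).symm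

/-- The comparison bijection between `of G α` and `α`. -/
noncomputable def ofEquiv (α : Type) [MulAction G α] [Finite α] : of G α ≃ α :=
  (Finite.equivFin α).symm

theorem ofEquiv_smul {α : Type} [MulAction G α] [Finite α] (g : G) (x : of G α) :
    ofEquiv α (g • x) = g • ofEquiv α x := by
  change (Finite.equivFin α).symm ((Finite.equivFin α) _) = _
  simp; rfl

theorem ofEquiv_symm_smul {α : Type} [MulAction G α] [Finite α] (g : G) (x : α) :
    (ofEquiv α).symm (g • x) = g • ((ofEquiv α).symm x : of G α) := by
  rw [Equiv.symm_apply_eq, ofEquiv_smul]; simp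

variable {W X Y Z : FinGSet G}

/-- The commutative square with `p : W → X`, `q : W → Y`, `f : X → Z`, `g : Y → Z` is a pullback. -/
structure IsPullback (p : Map W X) (q : Map W Y) (f : Map X Z) (g : Map Y Z) : Prop where
  comm : ∀ v, f (p v) = g (q v)
  existsUnique : ∀ x y, f x = g y → ∃! v, p v = x ∧ q v = y

/-- `i : X → Z` and `j : Y → Z` exhibit `Z` as the disjoint union of `X` and `Y`. -/
def IsCoprod (i : Map X Z) (j : Map Y Z) : Prop :=
  Function.Bijective (Sum.elim i.toFun j.toFun)

/-- The maps `h : A → X`, `f : X → Y`, `e : P → A`, `p : P → Q`, `q : Q → Y` form an exponential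
diagram: `q : Q → Y` is the dependent product of `h` along `f`, that is to say, a point of `Q` over
`y : Y` is the same as a section `s` of `h` over the fibre of `f` over `y`; and `P` is the pullback
`X ×_Y Q` with projections `h ∘ e` and `p`, with `e` the evaluation map `(x, s) ↦ s x`. -/
structure IsExponential {A X Y P Q : FinGSet G} (h : Map A X) (f : Map X Y) (e : Map P A)
    (p : Map P Q) (q : Map Q Y) : Prop where
  isPullback : IsPullback (h.comp e) p f q
  existsUnique : ∀ (y : Y) (s : {x : X // f x = y} → A), (∀ x, h (s x) = x) →
    ∃! b : Q, q b = y ∧ ∀ x, ∃ z : P, p z = b ∧ e z = s x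

namespace IsPullback

variable {p : Map W X} {q : Map W Y} {f : Map X Z} {g : Map Y Z}

theorem exi (h : IsPullback p q f g) {x : X} {y : Y} (e : f x = g y) : ∃ v, p v = x ∧ q v = y :=
  (h.existsUnique x y e).exists

theorem uniq (h : IsPullback p q f g) {v v' : W} (h1 : p v = p v') (h2 : q v = q v') : v = v' :=
  (h.existsUnique _ _ (h.comm v')).unique ⟨h1, h2⟩ ⟨rfl, rfl⟩

theorem mk' (comm : ∀ v, f (p v) = g (q v)) (hex : ∀ x y, f x = g y → ∃ v, p v = x ∧ q v = y)
    (hun : ∀ v v', p v = p v' → q v = q v' → v = v') : IsPullback p q f g :=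
  ⟨comm, fun x y e => by
    obtain ⟨v, h1, h2⟩ := hex x y e
    exact ⟨v, ⟨h1, h2⟩, fun v' ⟨h3, h4⟩ => hun _ _ (h3.trans h1.symm) (h4.trans h2.symm)⟩⟩

theorem symm (h : IsPullback p q f g) : IsPullback q p g f :=
  mk' (fun v => (h.comm v).symm)
    (fun x y e => by obtain ⟨v, h1, h2⟩ := h.exi e.symm; exact ⟨v, h2, h1⟩)
    (fun _ _ h1 h2 => h.uniq h2 h1)

theorem lift (h : IsPullback p q f g) {V : FinGSet G} (a : Map V X) (b : Map V Y)
    (e : ∀ v, f (a v) = g (b v)) : ∃ c : Map V W, (∀ v, p (c v) = a v) ∧ ∀ v, q (c v) = b v := by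
  obtain ⟨c, hc⟩ := Map.exists_of_rel (X := V) (Y := W) (fun v t => p t = a v ∧ q t = b v)
    (fun v => h.existsUnique _ _ (e v)) (fun g x y h => by simp [h.1, h.2])
  exact ⟨c, fun v => (hc v).1, fun v => (hc v).2⟩

/-- Pasting of pullback squares. -/
theorem paste (h : IsPullback p q f g) {V U : FinGSet G} {p' : Map V W} {q' : Map V U}
    {g' : Map U Y} (h' : IsPullback p' q' q g') : IsPullback (p.comp p') q' f (g.comp g') :=
  mk' (fun v => by simp [h.comm, h'.comm])
    (fun x y e => by
      obtain ⟨t, h1, h2⟩ := h.exi (x := x) (y := g' y) e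
      obtain ⟨v, h3, h4⟩ := h'.exi (x := t) (y := y) h2
      exact ⟨v, by simp [h1, h3], h4⟩)
    (fun v v' h1 h2 => h'.uniq (h.uniq h1 (by rw [h'.comm, h'.comm, h2])) h2)

/-- If the outer rectangle and the right square are pullbacks, so is the left square. -/
theorem of_paste (h : IsPullback p q f g) {V U : FinGSet G} {p' : Map V W} {q' : Map V U}
    {g' : Map U Y} {r : Map V X} (hr : ∀ v, r v = p (p' v)) (hc : ∀ v, q (p' v) = g' (q' v))
    (h' : IsPullback r q' f (g.comp g')) : IsPullback p' q' q g' :=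
  mk' hc
    (fun x y e => by
      obtain ⟨v, h1, h2⟩ := h'.exi (x := p x) (y := y) (by simp [h.comm, e])
      exact ⟨v, h.uniq (by rw [← hr, h1]) (by rw [hc, h2, e]), h2⟩)
    (fun v v' h1 h2 => h'.uniq (by rw [hr, hr, h1]) h2)

theorem refl (f : Map X Y) : IsPullback f (Map.id X) (Map.id Y) f :=
  mk' (fun _ => rfl) (fun _ y e => ⟨y, e.symm, rfl⟩) (fun _ _ _ h => h)

theorem of_bijective (f : Map X Y) (hf : Function.Bijective f) :
    IsPullback f f (Map.id Y) (Map.id Y) :=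
  mk' (fun _ => rfl) (fun x y e => by
    obtain ⟨v, hv⟩ := hf.2 x
    exact ⟨v, hv, hv.trans e⟩) (fun _ _ h _ => hf.1 h)

theorem of_injective (f : Map X Y) (hf : Function.Injective f) :
    IsPullback (Map.id X) (Map.id X) f f :=
  mk' (fun _ => rfl) (fun x _ e => ⟨x, rfl, hf e⟩) (fun _ _ h _ => h)

end IsPullback

instance pullbackAction (f : Map X Z) (g : Map Y Z) :
    MulAction G {t : X × Y // f t.1 = g t.2} where
  smul a t := ⟨a • t.1, by simp [t.2]⟩
  one_smul t := Subtype.ext (one_smul G t.1)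
  mul_smul a b t := Subtype.ext (mul_smul a b t.1)

theorem exists_isPullback (f : Map X Z) (g : Map Y Z) :
    ∃ (W : FinGSet G) (p : Map W X) (q : Map W Y), IsPullback p q f g := by
  let E := ofEquiv (G := G) {t : X × Y // f t.1 = g t.2}
  refine ⟨of G {t : X × Y // f t.1 = g t.2}, ⟨fun v => (E v).1.1, fun a x => ?_⟩,
    ⟨fun v => (E v).1.2, fun a x => ?_⟩, IsPullback.mk' ?_ ?_ ?_⟩
  · simp only [E, ofEquiv_smul]; rfl
  · simp only [E, ofEquiv_smul]; rfl
  · exact fun v => (E v).2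
  · exact fun x y e => ⟨E.symm ⟨(x, y), e⟩, by simp, by simp⟩
  · exact fun v v' h1 h2 => E.injective (Subtype.ext (Prod.ext h1 h2))

theorem exists_isCoprod (X Y : FinGSet G) :
    ∃ (Z : FinGSet G) (i : Map X Z) (j : Map Y Z), IsCoprod i j := by
  let E := ofEquiv (G := G) (X ⊕ Y)
  refine ⟨of G (X ⊕ Y), ⟨fun x => E.symm (Sum.inl x), fun a x => ?_⟩,
    ⟨fun x => E.symm (Sum.inr x), fun a x => ?_⟩, ?_⟩
  · rw [← ofEquiv_symm_smul]; rfl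
  · rw [← ofEquiv_symm_smul]; rfl
  · have : Sum.elim (fun x => E.symm (Sum.inl x)) (fun x => E.symm (Sum.inr x)) = E.symm := by
      funext t
      cases t <;> rfl
    exact (congrArg Function.Bijective this).mpr E.symm.bijective

theorem exists_empty (G : Type u) [Group G] : ∃ X : FinGSet G, IsEmpty X := by
  let act : MulAction G (Fin 0) :=
    { smul := fun _ x => x, one_smul := fun _ => rfl, mul_smul := fun _ _ _ => rfl }
  exact ⟨⟨0, act⟩, inferInstanceAs (IsEmpty (Fin 0))⟩

/-- The unique map from an empty `G`-set. -/
def ofEmpty (E X : FinGSet G) [IsEmpty E] : Map E X := ⟨isEmptyElim, fun _ x => isEmptyElim x⟩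

namespace IsCoprod

variable {i : Map X Z} {j : Map Y Z}

theorem inl_inj (h : IsCoprod i j) {x x' : X} (e : i x = i x') : x = x' :=
  Sum.inl_injective (h.1 (a₁ := Sum.inl x) (a₂ := Sum.inl x') e)

theorem inr_inj (h : IsCoprod i j) {x x' : Y} (e : j x = j x') : x = x' :=
  Sum.inr_injective (h.1 (a₁ := Sum.inr x) (a₂ := Sum.inr x') e)

theorem ne (h : IsCoprod i j) {x : X} {y : Y} (e : i x = j y) : False :=
  Sum.inl_ne_inr (h.1 (a₁ := Sum.inl x) (a₂ := Sum.inr y) e)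

theorem cases (h : IsCoprod i j) (z : Z) : (∃ x, i x = z) ∨ ∃ y, j y = z := by
  obtain ⟨x | y, h⟩ := h.2 z
  · exact .inl ⟨x, h⟩
  · exact .inr ⟨y, h⟩

theorem mk' (h1 : ∀ x x', i x = i x' → x = x') (h2 : ∀ x x', j x = j x' → x = x')
    (h3 : ∀ x y, i x ≠ j y) (h4 : ∀ z, (∃ x, i x = z) ∨ ∃ y, j y = z) : IsCoprod i j := by
  constructor
  · rintro (x | x) (y | y) e
    · exact congrArg _ (h1 _ _ e)
    · exact (h3 _ _ e).elim
    · exact (h3 _ _ e.symm).elim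
    · exact congrArg _ (h2 _ _ e)
  · intro z
    rcases h4 z with ⟨x, h⟩ | ⟨x, h⟩
    · exact ⟨.inl x, h⟩
    · exact ⟨.inr x, h⟩

theorem symm (h : IsCoprod i j) : IsCoprod j i :=
  mk' (fun _ _ => h.inr_inj) (fun _ _ => h.inl_inj) (fun _ _ e => h.ne e.symm)
    (fun z => (h.cases z).symm)

theorem desc (h : IsCoprod i j) {V : FinGSet G} (a : Map X V) (b : Map Y V) :
    ∃ c : Map Z V, (∀ x, c (i x) = a x) ∧ ∀ y, c (j y) = b y := by
  obtain ⟨c, hc⟩ := Map.exists_of_rel (X := Z) (Y := V)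
    (fun z v => (∃ x, i x = z ∧ a x = v) ∨ ∃ y, j y = z ∧ b y = v)
    (fun z => by
      rcases h.cases z with ⟨x, rfl⟩ | ⟨x, rfl⟩
      · refine ⟨a x, .inl ⟨x, rfl, rfl⟩, ?_⟩
        rintro v (⟨x', e, rfl⟩ | ⟨y, e, rfl⟩)
        · rw [h.inl_inj e]
        · exact (h.ne e.symm).elim
      · refine ⟨b x, .inr ⟨x, rfl, rfl⟩, ?_⟩
        rintro v (⟨x', e, rfl⟩ | ⟨y, e, rfl⟩)
        · exact (h.ne e).elim
        · rw [h.inr_inj e])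
    (fun g z v => by
      rintro (⟨x, rfl, rfl⟩ | ⟨x, rfl, rfl⟩)
      · exact .inl ⟨g • x, by simp⟩
      · exact .inr ⟨g • x, by simp⟩)
  refine ⟨c, fun x => ?_, fun y => ?_⟩
  · rcases hc (i x) with ⟨x', e, h'⟩ | ⟨y, e, h'⟩
    · rw [← h', h.inl_inj e]
    · exact (h.ne e.symm).elim
  · rcases hc (j y) with ⟨x', e, h'⟩ | ⟨y, e, h'⟩
    · exact (h.ne e).elim
    · rw [← h', h.inr_inj e]

/-- Disjoint unions are stable under pullback. -/
theorem pullback (h : IsCoprod i j) {V V₁ V₂ : FinGSet G} {f : Map V Z}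
    {a : Map V₁ V} {f₁ : Map V₁ X} {b : Map V₂ V} {f₂ : Map V₂ Y}
    (h1 : IsPullback a f₁ f i) (h2 : IsPullback b f₂ f j) : IsCoprod a b :=
  mk' (fun x x' e => h1.uniq e (h.inl_inj (by rw [← h1.comm, ← h1.comm, e])))
    (fun x x' e => h2.uniq e (h.inr_inj (by rw [← h2.comm, ← h2.comm, e])))
    (fun x y e => h.ne (x := f₁ x) (y := f₂ y) (by rw [← h1.comm, ← h2.comm, e]))
    (fun v => by
      rcases h.cases (f v) with ⟨x, hx⟩ | ⟨x, hx⟩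
      · obtain ⟨t, ht, -⟩ := h1.exi hx.symm
        exact .inl ⟨t, ht⟩
      · obtain ⟨t, ht, -⟩ := h2.exi hx.symm
        exact .inr ⟨t, ht⟩)

/-- In a map of disjoint unions induced by maps of the summands, the summand squares are pullbacks. -/
theorem isPullback (h : IsCoprod i j) {V V₁ V₂ : FinGSet G} {f : Map V Z}
    {a : Map V₁ V} {f₁ : Map V₁ X} {b : Map V₂ V} {f₂ : Map V₂ Y} (h' : IsCoprod a b)
    (h1 : ∀ v, f (a v) = i (f₁ v)) (h2 : ∀ v, f (b v) = j (f₂ v)) : IsPullback a f₁ f i :=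
  IsPullback.mk' h1
    (fun v x e => by
      rcases h'.cases v with ⟨v, rfl⟩ | ⟨v, rfl⟩
      · exact ⟨v, rfl, h.inl_inj (by rw [← h1, e])⟩
      · exact (h.ne (x := x) (y := f₂ v) (by rw [← h2, e])).elim)
    (fun v v' e _ => h'.inl_inj e)

theorem isPullback_empty (h : IsCoprod i j) (E : FinGSet G) [IsEmpty E] :
    IsPullback (ofEmpty E X) (ofEmpty E Y) i j :=
  IsPullback.mk' (fun v => isEmptyElim v) (fun _ _ e => (h.ne e).elim) (fun v => isEmptyElim v)

theorem id_empty (X E : FinGSet G) [IsEmpty E] : IsCoprod (Map.id X) (ofEmpty E X) :=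
  mk' (fun _ _ e => e) (fun x => isEmptyElim x) (fun _ y => isEmptyElim y)
    (fun z => .inl ⟨z, rfl⟩)

end IsCoprod

namespace IsExponential

variable {A X Y P Q : FinGSet G} {h : Map A X} {f : Map X Y} {e : Map P A} {p : Map P Q}
  {q : Map Q Y}

theorem comm (H : IsExponential h f e p q) (z : P) : f (h (e z)) = q (p z) := H.isPullback.comm z

theorem exi (H : IsExponential h f e p q) (y : Y) (s : {x : X // f x = y} → A)
    (hs : ∀ x, h (s x) = x) :
    ∃ b : Q, q b = y ∧ ∀ (z : P) (x : {x : X // f x = y}), p z = b → h (e z) = x → e z = s x := by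
  obtain ⟨b, ⟨h1, h2⟩, -⟩ := H.existsUnique y s hs
  refine ⟨b, h1, fun z x hz hz' => ?_⟩
  obtain ⟨z', h3, h4⟩ := h2 x
  rw [← h4, H.isPullback.uniq (v := z) (v' := z') (by simp [h4, hs, hz']) (by rw [hz, h3])]

theorem uniq (H : IsExponential h f e p q) {b b' : Q} (hb : q b = q b')
    (he : ∀ z z', p z = b → p z' = b' → h (e z) = h (e z') → e z = e z') : b = b' := by
  have key : ∀ x : {x : X // f x = q b}, ∃ z, p z = b ∧ h (e z) = x := fun x => by
    obtain ⟨z, h1, h2⟩ := H.isPullback.exi (x := x.1) (y := b) x.2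
    exact ⟨z, h2, h1⟩
  choose z h1 h2 using key
  refine (H.existsUnique (q b) (fun x => e (z x)) h2).unique ⟨rfl, fun x => ⟨z x, h1 x, rfl⟩⟩
    ⟨hb.symm, fun x => ?_⟩
  obtain ⟨z', h3, h4⟩ := H.isPullback.exi (x := x.1) (y := b') (x.2.trans hb)
  exact ⟨z', h4, (he _ _ (h1 x) h4 ((h2 x).trans h3.symm)).symm⟩

theorem mk' (H : IsPullback (h.comp e) p f q)
    (hex : ∀ (y : Y) (s : {x : X // f x = y} → A), (∀ x, h (s x) = x) →
      ∃ b : Q, q b = y ∧ ∀ (z : P) (x : {x : X // f x = y}), p z = b → h (e z) = x → e z = s x)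
    (hun : ∀ b b', q b = q b' →
      (∀ z z', p z = b → p z' = b' → h (e z) = h (e z') → e z = e z') → b = b') :
    IsExponential h f e p q :=
  ⟨H, fun y s hs => by
    obtain ⟨b, h1, h2⟩ := hex y s hs
    refine ⟨b, ⟨h1, fun x => ?_⟩, fun b' ⟨h1', h2'⟩ => hun _ _ (h1'.trans h1.symm) ?_⟩
    · obtain ⟨z, h3, h4⟩ := H.exi (x := x.1) (y := b) (x.2.trans h1.symm)
      exact ⟨z, h4, h2 z x h4 h3⟩
    · intro z z' hz hz' e'
      have hx : f (h (e z')) = y := by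
        have := H.comm z'; simp only [Map.comp_apply] at this; rw [this, hz', h1]
      obtain ⟨z₁, h3, h4⟩ := h2' ⟨_, hx⟩
      have : z = z₁ := H.uniq (by simp [h4, hs, e']) (by rw [hz, h3])
      rw [this, h4]
      exact (h2 z' ⟨_, hx⟩ hz' rfl).symm⟩

/-- The universal property of the dependent product. -/
theorem lift (H : IsExponential h f e p q) {P₀ Q₀ : FinGSet G} {e₀ : Map P₀ A} {p₀ : Map P₀ Q₀}
    {q₀ : Map Q₀ Y} (H₀ : IsPullback (h.comp e₀) p₀ f q₀) :
    ∃ (φ : Map Q₀ Q) (ψ : Map P₀ P), (∀ b, q (φ b) = q₀ b) ∧ (∀ z, e (ψ z) = e₀ z) ∧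
      IsPullback ψ p₀ p φ := by
  obtain ⟨φ, hφ⟩ := Map.exists_of_rel (X := Q₀) (Y := Q)
    (fun b b' => q b' = q₀ b ∧ ∀ z z', p₀ z = b → p z' = b' → h (e₀ z) = h (e z') → e₀ z = e z')
    (fun b => by
      have key : ∀ x : {x : X // f x = q₀ b}, ∃ z, p₀ z = b ∧ h (e₀ z) = x := fun x => by
        obtain ⟨z, h1, h2⟩ := H₀.exi (x := x.1) (y := b) x.2
        exact ⟨z, h2, h1⟩
      choose t h1 h2 using key
      obtain ⟨b', hb, hb'⟩ := H.exi (q₀ b) (fun x => e₀ (t x)) h2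
      refine ⟨b', ⟨hb, fun z z' hz hz' e' => ?_⟩, fun b'' ⟨h3, h4⟩ => ?_⟩
      · have hx : f (h (e z')) = q₀ b := by rw [H.comm, hz', hb]
        rw [hb' z' ⟨_, hx⟩ hz' rfl]
        congr 1
        refine H₀.uniq ?_ (by rw [hz, h1])
        simp only [Map.comp_apply]
        rw [h2, e']
      · refine H.uniq (h3.trans hb.symm) fun z z' hz hz' e' => ?_
        have hx : f (h (e z')) = q₀ b := by rw [H.comm, hz', hb]
        rw [hb' z' ⟨_, hx⟩ hz' rfl]
        exact (h4 _ _ (h1 _) hz (by rw [h2, e'])).symm)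
    (fun g b b' ⟨h1, h2⟩ => by
      refine ⟨by simp [h1], fun z z' hz hz' e' => ?_⟩
      have := h2 (g⁻¹ • z) (g⁻¹ • z') (by simp [hz]) (by simp [hz']) (by simp [e'])
      simpa using this)
  obtain ⟨ψ, h1, h2⟩ := H.isPullback.lift (h.comp e₀) (φ.comp p₀) (fun z => by
    have := H₀.comm z; simp only [Map.comp_apply] at this ⊢; rw [this, (hφ _).1])
  refine ⟨φ, ψ, fun b => (hφ b).1, fun z => ?_, IsPullback.mk' h2 (fun z b e' => ?_) ?_⟩
  · exact ((hφ (p₀ z)).2 z (ψ z) rfl (h2 z) (h1 z).symm).symm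
  · obtain ⟨t, h3, h4⟩ := H₀.exi (x := h (e z)) (y := b) (by rw [H.comm, e', (hφ _).1])
    exact ⟨t, H.isPullback.uniq ((h1 t).trans h3) (by rw [h2, e']; simp [h4]), h4⟩
  · intro v v' h3 h4
    refine H₀.uniq ?_ h4
    rw [← h1, ← h1, h3]

/-- Dependent products are unique up to isomorphism. -/
theorem unique (H : IsExponential h f e p q) {P₀ Q₀ : FinGSet G} {e₀ : Map P₀ A} {p₀ : Map P₀ Q₀}
    {q₀ : Map Q₀ Y} (H₀ : IsExponential h f e₀ p₀ q₀) :
    ∃ (φ : Map Q₀ Q) (ψ : Map P₀ P), Function.Bijective φ.toFun ∧ (∀ b, q (φ b) = q₀ b) ∧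
      (∀ z, e (ψ z) = e₀ z) ∧ IsPullback ψ p₀ p φ := by
  obtain ⟨φ, ψ, h1, h2, h3⟩ := H.lift H₀.isPullback
  obtain ⟨φ', ψ', h1', h2', h3'⟩ := H₀.lift H.isPullback
  refine ⟨φ, ψ, ?_, h1, h2, h3⟩
  refine Function.bijective_iff_has_inverse.2 ⟨φ'.toFun, fun b => ?_, fun b => ?_⟩
  · refine H₀.uniq (by rw [h1', h1]) fun z z' hz hz' e' => ?_
    have : z = ψ' (ψ z') := by
      refine H₀.isPullback.uniq (by simp [h2, h2', e']) ?_
      rw [hz, h3'.comm, h3.comm, hz']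
    rw [this, h2', h2]
  · refine H.uniq (by rw [h1, h1']) fun z z' hz hz' e' => ?_
    have : z = ψ (ψ' z') := by
      refine H.isPullback.uniq (by simp [h2, h2', e']) ?_
      rw [hz, h3.comm, h3'.comm, hz']
    rw [this, h2, h2']

/-- The dependent product along an identity map. -/
theorem id (h : Map A X) : IsExponential h (Map.id X) (Map.id A) (Map.id A) h :=
  mk' (IsPullback.mk' (fun _ => rfl) (fun x y e => ⟨y, e.symm, rfl⟩) (fun _ _ _ h => h))
    (fun y s hs => ⟨s ⟨y, rfl⟩, hs _, fun z x hz hz' => by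
      obtain ⟨x, rfl⟩ := x
      exact hz⟩)
    (fun b b' hb H => H b b' rfl rfl hb)

/-- The dependent product of an identity map. -/
theorem of_id (f : Map X Y) : IsExponential (Map.id X) f (Map.id X) f (Map.id Y) :=
  mk' (IsPullback.mk' (fun _ => rfl) (fun x _ e => ⟨x, rfl, e⟩) (fun _ _ h _ => h))
    (fun y _ hs => ⟨y, rfl, fun _ x _ hz' => hz'.trans (hs x).symm⟩) (fun _ _ hb _ => hb)

/-- The dependent product of a composite. -/
theorem vert (H : IsExponential h f e p q) {B W P₂ Q₂ : FinGSet G} {k : Map B A} {e' : Map W B}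
    {k' : Map W P} (hW : IsPullback e' k' k e) {e₂ : Map P₂ W} {p₂ : Map P₂ Q₂} {q₂ : Map Q₂ Q}
    (H₂ : IsExponential k' p e₂ p₂ q₂) :
    IsExponential (h.comp k) f (e'.comp e₂) p₂ (q.comp q₂) ∧
      IsPullback (k'.comp e₂) p₂ p q₂ := by
  refine ⟨mk' ?_ ?_ ?_, H₂.isPullback⟩
  · refine IsPullback.mk' (fun z => ?_) (fun x b e' => ?_) (fun z z' h1 h2 => ?_)
    · simp only [Map.comp_apply]
      rw [hW.comm, H.comm, H₂.comm]
    · obtain ⟨t, h1, h2⟩ := H.isPullback.exi (x := x) (y := q₂ b) e'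
      obtain ⟨z, h3, h4⟩ := H₂.isPullback.exi (x := t) (y := b) h2
      refine ⟨z, ?_, h4⟩
      simp only [Map.comp_apply] at h1 h3 ⊢
      rw [hW.comm, h3, h1]
    · refine H₂.isPullback.uniq (H.isPullback.uniq ?_ ?_) h2
      · simp only [Map.comp_apply] at h1 ⊢
        rwa [← hW.comm, ← hW.comm]
      · simp only [Map.comp_apply]
        rw [H₂.comm, H₂.comm, h2]
  · intro y s hs
    obtain ⟨b, hb, hb'⟩ := H.exi y (fun x => k (s x)) hs
    have hz : ∀ z : {z : P // p z = b}, ∃ t, e' t = s ⟨h (e z), by rw [H.comm, z.2, hb]⟩ ∧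
        k' t = z := fun z => hW.exi (hb' z _ z.2 rfl).symm
    choose t h1 h2 using hz
    obtain ⟨b₂, hb₂, hb₂'⟩ := H₂.exi b t h2
    refine ⟨b₂, by simp [hb₂, hb], fun z x hz hz' => ?_⟩
    have hp : p (k' (e₂ z)) = b := by rw [H₂.comm, hz, hb₂]
    simp only [Map.comp_apply] at hz' ⊢
    rw [hb₂' z ⟨_, hp⟩ hz rfl, h1]
    congr 1
    refine Subtype.ext ?_
    rw [← hz', hW.comm]
  · intro b b' hb he
    have h0 : q₂ b = q₂ b' := by
      refine H.uniq hb fun z z' hz hz' e' => ?_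
      obtain ⟨t, h1, h2⟩ := H₂.isPullback.exi hz
      obtain ⟨t', h1', h2'⟩ := H₂.isPullback.exi hz'
      have := he t t' h2 h2' (by
        simp only [Map.comp_apply] at h1 h1' ⊢
        rw [hW.comm, hW.comm, h1, h1', e'])
      simp only [Map.comp_apply] at h1 h1' this
      rw [← h1, ← h1', ← hW.comm, ← hW.comm, this]
    refine H₂.uniq h0 fun z z' hz hz' e₁ => ?_
    refine hW.uniq (he z z' hz hz' ?_) e₁
    simp only [Map.comp_apply]
    rw [hW.comm, hW.comm, e₁]

/-- The dependent product along a composite. -/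
theorem horiz (H : IsExponential h f e p q) {Z P₁ Q₁ R : FinGSet G} {f' : Map Y Z}
    {e₁ : Map P₁ Q} {p₁ : Map P₁ Q₁} {q₁ : Map Q₁ Z} (H₁ : IsExponential q f' e₁ p₁ q₁)
    {a : Map R P} {b : Map R P₁} (hR : IsPullback a b p e₁) :
    IsExponential h (f'.comp f) (e.comp a) (p₁.comp b) q₁ := by
  refine mk' ?_ ?_ ?_
  · refine IsPullback.mk' (fun z => ?_) (fun x c e' => ?_) (fun z z' h1 h2 => ?_)
    · simp only [Map.comp_apply]
      rw [H.comm, hR.comm, H₁.comm]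
    · obtain ⟨t, h1, h2⟩ := H₁.isPullback.exi (x := f x) (y := c) e'
      obtain ⟨r, h3, h4⟩ := H.isPullback.exi (x := x) (y := e₁ t) h1.symm
      obtain ⟨v, h5, h6⟩ := hR.exi h4
      refine ⟨v, ?_, ?_⟩
      · simp only [Map.comp_apply] at h3 ⊢
        rw [h5, h3]
      · simp [h6, h2]
    · simp only [Map.comp_apply] at h1 h2
      have h3 : b z = b z' := by
        refine H₁.isPullback.uniq ?_ h2
        simp only [Map.comp_apply]
        rw [← hR.comm, ← hR.comm, ← H.comm, ← H.comm, h1]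
      exact hR.uniq (H.isPullback.uniq h1 (by rw [hR.comm, hR.comm, h3])) h3
  · intro y s hs
    have key : ∀ x : {x : Y // f' x = y}, ∃ c : Q, q c = x ∧ ∀ z (x : {x // f'.comp f x = y}),
        p z = c → h (e z) = x → e z = s x := fun x => by
      obtain ⟨c, h1, h2⟩ := H.exi x.1 (fun v => s ⟨v.1, by simp [v.2, x.2]⟩) (fun v => hs _)
      exact ⟨c, h1, fun z v hz hz' => h2 z ⟨v.1, by rw [← hz', H.comm, hz, h1]⟩ hz hz'⟩
    choose c h1 h2 using key
    obtain ⟨d, h3, h4⟩ := H₁.exi y c h1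
    refine ⟨d, h3, fun z x hz hz' => ?_⟩
    simp only [Map.comp_apply] at hz hz' ⊢
    refine h2 ⟨f x, x.2⟩ _ x ?_ hz'
    rw [hR.comm]
    exact h4 (b z) _ hz (by rw [← hR.comm, ← H.comm, hz'])
  · intro c c' hc he
    refine H₁.uniq hc fun z z' hz hz' e' => ?_
    refine H.uniq e' fun r r' hr hr' e'' => ?_
    obtain ⟨v, h1, h2⟩ := hR.exi hr
    obtain ⟨v', h1', h2'⟩ := hR.exi hr'
    have := he v v' (by simp [h2, hz]) (by simp [h2', hz']) (by simp [h1, h1', e''])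
    simpa [h1, h1'] using this

/-- Dependent products are stable under base change. -/
theorem base (H : IsExponential h f e p q) {Y' X' A' Q' P' : FinGSet G} {k : Map Y' Y}
    {kX : Map X' X} {f' : Map X' Y'} (hX : IsPullback kX f' f k)
    {kA : Map A' A} {h' : Map A' X'} (hA : IsPullback kA h' h kX)
    {kQ : Map Q' Q} {q' : Map Q' Y'} (hQ : IsPullback kQ q' q k)
    {kP : Map P' P} {p' : Map P' Q'} (hP : IsPullback kP p' p kQ) :
    ∃ e' : Map P' A', (∀ z, kA (e' z) = e (kP z)) ∧ IsExponential h' f' e' p' q' := by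
  obtain ⟨c, hc1, hc2⟩ := hX.lift (h.comp (e.comp kP)) (q'.comp p') (fun z => by
    simp only [Map.comp_apply]
    rw [H.comm, hP.comm, hQ.comm])
  obtain ⟨e', he1, he2⟩ := hA.lift (e.comp kP) c (fun z => (hc1 z).symm)
  refine ⟨e', he1, mk' ?_ ?_ ?_⟩
  · refine IsPullback.mk' (fun z => ?_) (fun x b hx => ?_) (fun z z' h1 h2 => ?_)
    · simp [he2, hc2]
    · obtain ⟨t, h1, h2⟩ := H.isPullback.exi (x := kX x) (y := kQ b) (by
        rw [hX.comm, hQ.comm, hx])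
      obtain ⟨z, h3, h4⟩ := hP.exi h2
      refine ⟨z, ?_, h4⟩
      simp only [Map.comp_apply] at h1 ⊢
      refine hX.uniq ?_ ?_
      · rw [he2, hc1]; simp [h3, h1]
      · rw [he2, hc2]; simp [h4, hx]
    · refine hP.uniq (H.isPullback.uniq ?_ ?_) h2
      · simp only [Map.comp_apply] at h1 ⊢
        have := congrArg kX h1
        rw [← hA.comm, ← hA.comm, he1, he1] at this
        exact this
      · rw [hP.comm, hP.comm, h2]
  · intro y s hs
    have key : ∀ x : {x : X // f x = k y}, ∃ x' : {x : X' // f' x = y}, kX x' = x := fun x => by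
      obtain ⟨x', h1, h2⟩ := hX.exi x.2
      exact ⟨⟨x', h2⟩, h1⟩
    choose t ht using key
    obtain ⟨b, hb, hb'⟩ := H.exi (k y) (fun x => kA (s (t x))) (fun x => by
      rw [hA.comm, hs, ht])
    obtain ⟨b₁, h1, h2⟩ := hQ.exi hb
    refine ⟨b₁, h2, fun z x hz hz' => ?_⟩
    refine hA.uniq ?_ (hz'.trans (hs x).symm)
    have hx : f (kX x) = k y := by rw [hX.comm, x.2]
    have hx' : h (e (kP z)) = kX x := by rw [← hz', ← hA.comm, he1]; rfl
    rw [he1, Map.comp_apply, hb' (kP z) ⟨kX x, hx⟩ (by rw [hP.comm, hz, h1]) hx']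
    congr 2
    exact Subtype.ext (hX.uniq (ht _) ((t _).2.trans x.2.symm))
  · intro b b' hb he
    refine hQ.uniq (H.uniq ?_ fun z z' hz hz' e₁ => ?_) hb
    · rw [hQ.comm, hQ.comm, hb]
    · obtain ⟨v, h1, h2⟩ := hP.exi hz
      obtain ⟨v', h1', h2'⟩ := hP.exi hz'
      have := he v v' h2 h2' (by
        rw [he2, he2]
        refine hX.uniq ?_ ?_
        · rw [hc1, hc1]; simp [h1, h1', e₁]
        · rw [hc2, hc2]; simp [h2, h2', hb])
      rw [← h1, ← h1']
      exact (he1 v).symm.trans ((congrArg kA this).trans (he1 v'))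

end IsExponential

/-- `B` is (the image of) a section of `h` over the fibre of `f` over `y`. -/
def IsFibreSection {A X Y : FinGSet G} (h : Map A X) (f : Map X Y) (y : Y) (B : Set A) : Prop :=
  (∀ a ∈ B, f (h a) = y) ∧ ∀ x, f x = y → ∃! a, a ∈ B ∧ h a = x

open scoped Pointwise in
theorem IsFibreSection.smul {A X Y : FinGSet G} {h : Map A X} {f : Map X Y} {y : Y} {B : Set A}
    (H : IsFibreSection h f y B) (g : G) : IsFibreSection h f (g • y) (g • B) := by
  refine ⟨fun a ha => ?_, fun x hx => ?_⟩
  · rw [Set.mem_smul_set_iff_inv_smul_mem] at ha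
    have := H.1 _ ha
    simpa [inv_smul_eq_iff] using this
  · obtain ⟨a, ⟨h1, h2⟩, h3⟩ := H.2 (g⁻¹ • x) (by simp [hx])
    refine ⟨g • a, ⟨Set.smul_mem_smul_set h1, by simp [h2]⟩, fun a' ⟨h4, h5⟩ => ?_⟩
    rw [Set.mem_smul_set_iff_inv_smul_mem] at h4
    rw [← h3 (g⁻¹ • a') ⟨h4, by simp [h5]⟩, smul_inv_smul]

open scoped Pointwise in
instance sectionAction {A X Y : FinGSet G} (h : Map A X) (f : Map X Y) :
    MulAction G {t : Y × Set A // IsFibreSection h f t.1 t.2} where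
  smul g t := ⟨g • t.1, t.2.smul g⟩
  one_smul t := Subtype.ext (one_smul G t.1)
  mul_smul a b t := Subtype.ext (mul_smul a b t.1)

open scoped Pointwise in
theorem exists_isExponential {A X Y : FinGSet G} (h : Map A X) (f : Map X Y) :
    ∃ (P Q : FinGSet G) (e : Map P A) (p : Map P Q) (q : Map Q Y), IsExponential h f e p q := by
  let E := ofEquiv (G := G) {t : Y × Set A // IsFibreSection h f t.1 t.2}
  have hE : ∀ (g : G) x, (E (g • x)).1 = g • (E x).1 := fun g x => by
    simp only [E, ofEquiv_smul]; rfl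
  let Q := of G {t : Y × Set A // IsFibreSection h f t.1 t.2}
  let q : Map Q Y := ⟨fun b => (E b).1.1, fun g b => by rw [hE]; rfl⟩
  obtain ⟨W, a, b, hW⟩ := exists_isPullback f q
  obtain ⟨e, he⟩ := Map.exists_of_rel (X := W) (Y := A)
    (fun v t => t ∈ (E (b v)).1.2 ∧ h t = a v) (fun v => (E (b v)).2.2 _ (hW.comm v))
    (fun g v t ⟨h1, h2⟩ => by
      refine ⟨?_, by simp [h2]⟩
      rw [Map.map_smul, hE]
      exact Set.smul_mem_smul_set h1)
  have hha : h.comp e = a := Map.ext' fun v => (he v).2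
  refine ⟨W, Q, e, b, q, IsExponential.mk' (hha ▸ hW) (fun y s hs => ?_) (fun c c' hc H => ?_)⟩
  · have hB : IsFibreSection h f y (Set.range s) := by
      refine ⟨?_, fun x hx => ⟨s ⟨x, hx⟩, ⟨⟨_, rfl⟩, hs _⟩, ?_⟩⟩
      · rintro _ ⟨x, rfl⟩
        rw [hs, x.2]
      · rintro _ ⟨⟨x', rfl⟩, h2⟩
        congr 1
        exact Subtype.ext ((hs x').symm.trans h2)
    refine ⟨E.symm ⟨(y, Set.range s), hB⟩, by simp [q], fun z x' hz hz' => ?_⟩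
    have h1 := (he z).1
    rw [hz] at h1
    simp only [Equiv.apply_symm_apply] at h1
    obtain ⟨x, hx⟩ := h1
    have : x = x' := Subtype.ext (by rw [← hs x, hx, hz'])
    rw [← hx, this]
  · refine E.injective (Subtype.ext (Prod.ext hc ?_))
    have key : ∀ c c' : Q, q c = q c' →
        (∀ z z', b z = c → b z' = c' → h (e z) = h (e z') → e z = e z') →
        (E c).1.2 ⊆ (E c').1.2 := fun c c' hc H t ht => by
      have h1 := (E c).2.1 t ht
      obtain ⟨z, h2, h3⟩ := hW.exi (x := h t) (y := c) h1
      obtain ⟨z', h2', h3'⟩ := hW.exi (x := h t) (y := c') (h1.trans hc)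
      have h4 : e z = t := ((E c).2.2 (h t) h1).unique
        ⟨by rw [← h3]; exact (he z).1, by rw [(he z).2, h2]⟩ ⟨ht, rfl⟩
      have h5 := H z z' h3 h3' (by rw [(he z).2, (he z').2, h2, h2'])
      rw [← h4, h5, ← h3']
      exact (he z').1
    exact (key c c' hc H).antisymm
      (key c' c hc.symm fun z z' hz hz' e' => (H z' z hz' hz e'.symm).symm)

end FinGSet

section TambaraFunctors

open FinGSet

/-! ## Set-valued Mackey functors

An auxiliary notion: restrictions and transfers already determine a commutative monoid structure.
It is applied below with "transfer" meaning either the transfer or the norm. -/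

/-- A semi-Mackey functor, given by its sets of values, its restrictions and its transfers. -/
structure SemiMackey.{v, r} (G : Type r) [Group G] where
  obj : FinGSet G → Type v
  res {X Y : FinGSet G} (f : Map X Y) : obj Y → obj X
  tr {X Y : FinGSet G} (f : Map X Y) : obj X → obj Y
  res_id {X : FinGSet G} (a : obj X) : res (Map.id X) a = a
  res_comp {X Y Z : FinGSet G} (g : Map Y Z) (f : Map X Y) (a : obj Z) :
    res (g.comp f) a = res f (res g a)
  tr_id {X : FinGSet G} (a : obj X) : tr (Map.id X) a = a
  tr_comp {X Y Z : FinGSet G} (g : Map Y Z) (f : Map X Y) (a : obj X) :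
    tr (g.comp f) a = tr g (tr f a)
  res_tr {W X Y Z : FinGSet G} {p : Map W X} {q : Map W Y} {f : Map X Z} {g : Map Y Z}
    (h : IsPullback p q f g) (a : obj X) : res g (tr f a) = tr q (res p a)
  nonempty_of_isEmpty (X : FinGSet G) [IsEmpty X] : Nonempty (obj X)
  subsingleton_of_isEmpty (X : FinGSet G) [IsEmpty X] : Subsingleton (obj X)
  bijective_of_isCoprod {X Y Z : FinGSet G} {i : Map X Z} {j : Map Y Z} (h : IsCoprod i j) :
    Function.Bijective (fun c : obj Z => (res i c, res j c))

namespace SemiMackey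

variable {G : Type u} [Group G] (F : SemiMackey G) {X Y Z : FinGSet G}

theorem ext_coprod {i : Map X Z} {j : Map Y Z} (h : IsCoprod i j) {a b : F.obj Z}
    (h1 : F.res i a = F.res i b) (h2 : F.res j a = F.res j b) : a = b :=
  (F.bijective_of_isCoprod h).1 (Prod.ext h1 h2)

theorem exists_pair {i : Map X Z} {j : Map Y Z} (h : IsCoprod i j) (a : F.obj X) (b : F.obj Y) :
    ∃ c, F.res i c = a ∧ F.res j c = b := by
  obtain ⟨c, hc⟩ := (F.bijective_of_isCoprod h).2 (a, b)
  exact ⟨c, (Prod.ext_iff.1 hc).1, (Prod.ext_iff.1 hc).2⟩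

theorem tr_res_of_bijective (f : Map X Y) (hf : Function.Bijective f.toFun) (a : F.obj Y) :
    F.tr f (F.res f a) = a := by
  rw [← F.res_tr (IsPullback.of_bijective f hf), F.res_id, F.tr_id]

theorem exists_add (a b : F.obj X) : ∃ c : F.obj X, ∃ (Z : FinGSet G) (i j : Map X Z)
    (g : Map Z X) (z : F.obj Z), IsCoprod i j ∧ (∀ x, g (i x) = x) ∧ (∀ x, g (j x) = x) ∧
    F.res i z = a ∧ F.res j z = b ∧ F.tr g z = c := by
  obtain ⟨Z, i, j, h⟩ := exists_isCoprod X X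
  obtain ⟨g, h1, h2⟩ := h.desc (Map.id X) (Map.id X)
  obtain ⟨z, h3, h4⟩ := F.exists_pair h a b
  exact ⟨_, Z, i, j, g, z, h, h1, h2, h3, h4, rfl⟩

/-- The sum of `a` and `b`: the transfer of `(a, b)` along the fold map `X ⊔ X → X`. -/
noncomputable def add (a b : F.obj X) : F.obj X := (F.exists_add a b).choose

/-- The neutral element: the transfer of the unique element along `∅ → X`. -/
noncomputable def zero (X : FinGSet G) : F.obj X :=
  haveI := (exists_empty G).choose_spec
  F.tr (ofEmpty (exists_empty G).choose X) (F.nonempty_of_isEmpty _).some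

theorem tr_eq_add {i : Map X Z} {j : Map Y Z} (h : IsCoprod i j) {V : FinGSet G} (g : Map Z V)
    (z : F.obj Z) :
    F.tr g z = F.add (F.tr (g.comp i) (F.res i z)) (F.tr (g.comp j) (F.res j z)) := by
  obtain ⟨Z', i', j', g', z', h', h1, h2, h3, h4, h5⟩ :=
    (F.exists_add (F.tr (g.comp i) (F.res i z)) (F.tr (g.comp j) (F.res j z))).choose_spec
  obtain ⟨c, hc1, hc2⟩ := h.desc (i'.comp (g.comp i)) (j'.comp (g.comp j))
  have hg : g'.comp c = g := Map.ext' fun v => by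
    rcases h.cases v with ⟨x, rfl⟩ | ⟨x, rfl⟩
    · simp [hc1, h1]
    · simp [hc2, h2]
  have hz : z' = F.tr c z := by
    refine F.ext_coprod h' ?_ ?_
    · rw [h3, F.res_tr (h'.isPullback h hc1 hc2)]
    · rw [h4, F.res_tr (h'.symm.isPullback h.symm hc2 hc1)]
  rw [add, ← h5, hz, ← F.tr_comp, hg]

theorem add_eq {i j : Map X Z} (h : IsCoprod i j) {g : Map Z X} (h1 : ∀ x, g (i x) = x)
    (h2 : ∀ x, g (j x) = x) (z : F.obj Z) : F.add (F.res i z) (F.res j z) = F.tr g z := by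
  rw [F.tr_eq_add h, Map.ext' (f := g.comp i) (g := Map.id X) h1,
    Map.ext' (f := g.comp j) (g := Map.id X) h2, F.tr_id, F.tr_id]

theorem tr_of_isEmpty (E : FinGSet G) [IsEmpty E] (f : Map E X) (a : F.obj E) :
    F.tr f a = F.zero X := by
  have := (exists_empty G).choose_spec
  have := F.subsingleton_of_isEmpty (exists_empty G).choose
  let φ : Map E (exists_empty G).choose := ofEmpty _ _
  rw [zero, Subsingleton.elim (F.nonempty_of_isEmpty _).some (F.tr φ a), ← F.tr_comp]
  congr 1
  exact Map.ext' fun x => isEmptyElim x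

theorem add_comm (a b : F.obj X) : F.add a b = F.add b a := by
  obtain ⟨-, Z, i, j, g, z, h, h1, h2, rfl, rfl, -⟩ := F.exists_add a b
  rw [F.add_eq h h1 h2, F.add_eq h.symm h2 h1]

theorem add_zero (a : F.obj X) : F.add a (F.zero X) = a := by
  obtain ⟨E, hE⟩ := exists_empty G
  have := F.tr_eq_add (IsCoprod.id_empty X E) (Map.id X) a
  rw [F.tr_of_isEmpty E] at this
  simpa [F.tr_id, F.res_id, show (Map.id X).comp (Map.id X) = Map.id X from rfl] using this.symm

theorem add_assoc (a b c : F.obj X) : F.add (F.add a b) c = F.add a (F.add b c) := by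
  obtain ⟨-, Z, i, j, g, z, h, h1, h2, rfl, rfl, -⟩ := F.exists_add a b
  obtain ⟨W, k, l, h'⟩ := exists_isCoprod Z X
  obtain ⟨w, rfl, rfl⟩ := F.exists_pair h' z c
  obtain ⟨t, ht1, ht2⟩ := h'.desc g (Map.id X)
  obtain ⟨V, m, n, h''⟩ := exists_isCoprod X X
  obtain ⟨d, hd1, hd2⟩ := h''.desc (k.comp j) l
  have hc : IsCoprod (k.comp i) d := by
    refine IsCoprod.mk' (fun x x' e => h.inl_inj (h'.inl_inj e)) (fun x x' e => ?_)
      (fun x y e => ?_) (fun w => ?_)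
    · rcases h''.cases x with ⟨x, rfl⟩ | ⟨x, rfl⟩ <;> rcases h''.cases x' with ⟨y, rfl⟩ | ⟨y, rfl⟩
      · rw [hd1, hd1] at e; rw [h.inr_inj (h'.inl_inj e)]
      · rw [hd1, hd2] at e; exact (h'.ne e).elim
      · rw [hd1, hd2] at e; exact (h'.ne e.symm).elim
      · rw [hd2, hd2] at e; rw [h'.inr_inj e]
    · rcases h''.cases y with ⟨y, rfl⟩ | ⟨y, rfl⟩
      · rw [hd1] at e; exact h.ne (h'.inl_inj e)
      · rw [hd2] at e; exact h'.ne e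
    · rcases h'.cases w with ⟨w, rfl⟩ | ⟨w, rfl⟩
      · rcases h.cases w with ⟨w, rfl⟩ | ⟨w, rfl⟩
        · exact .inl ⟨w, rfl⟩
        · exact .inr ⟨m w, by simp [hd1]⟩
      · exact .inr ⟨n w, by simp [hd2]⟩
  rw [F.add_eq h h1 h2]
  have e1 := F.tr_eq_add h' t w
  rw [Map.ext' (f := t.comp k) (g := g) ht1, Map.ext' (f := t.comp l) (g := Map.id X) ht2,
    F.tr_id] at e1
  rw [← e1, F.tr_eq_add hc t w, F.tr_eq_add h'' (t.comp d)]
  have r1 : t.comp (k.comp i) = Map.id X := Map.ext' fun x => by simp [ht1, h1]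
  have r2 : (t.comp d).comp m = Map.id X := Map.ext' fun x => by simp [hd1, ht1, h2]
  have r3 : (t.comp d).comp n = Map.id X := Map.ext' fun x => by simp [hd2, ht2]
  rw [r1, r2, r3, F.tr_id, F.tr_id, F.tr_id, ← F.res_comp, ← F.res_comp, F.res_comp k i,
    Map.ext' (f := d.comp m) (g := k.comp j) hd1, Map.ext' (f := d.comp n) (g := l) hd2,
    F.res_comp k j]

theorem tr_add (f : Map X Y) (a b : F.obj X) : F.tr f (F.add a b) = F.add (F.tr f a) (F.tr f b) := by
  obtain ⟨-, Z, i, j, g, z, h, h1, h2, rfl, rfl, -⟩ := F.exists_add a b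
  rw [F.add_eq h h1 h2, ← F.tr_comp, F.tr_eq_add h,
    Map.ext' (f := (f.comp g).comp i) (g := f) fun x => by simp [h1],
    Map.ext' (f := (f.comp g).comp j) (g := f) fun x => by simp [h2]]

theorem tr_zero (f : Map X Y) : F.tr f (F.zero X) = F.zero Y := by
  obtain ⟨E, hE⟩ := exists_empty G
  obtain ⟨a⟩ := F.nonempty_of_isEmpty E
  rw [← F.tr_of_isEmpty E (ofEmpty E X) a, ← F.tr_comp, F.tr_of_isEmpty]

theorem res_zero (f : Map X Y) : F.res f (F.zero Y) = F.zero X := by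
  obtain ⟨E, hE⟩ := exists_empty G
  obtain ⟨a⟩ := F.nonempty_of_isEmpty E
  rw [← F.tr_of_isEmpty E (ofEmpty E Y) a, F.res_tr (p := Map.id E) (q := ofEmpty E X)
    (IsPullback.mk' (fun v => isEmptyElim v) (fun x => isEmptyElim x) (fun v => isEmptyElim v)),
    F.tr_of_isEmpty]

theorem res_add (f : Map X Y) (a b : F.obj Y) :
    F.res f (F.add a b) = F.add (F.res f a) (F.res f b) := by
  obtain ⟨-, Z, i, j, g, z, h, h1, h2, rfl, rfl, -⟩ := F.exists_add a b
  obtain ⟨W, k, l, h'⟩ := exists_isCoprod X X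
  obtain ⟨t, ht1, ht2⟩ := h'.desc (Map.id X) (Map.id X)
  obtain ⟨c, hc1, hc2⟩ := h'.desc (i.comp f) (j.comp f)
  have hp : IsPullback c t g f := by
    refine IsPullback.mk' (fun v => ?_) (fun z x e => ?_) (fun v v' e e' => ?_)
    · rcases h'.cases v with ⟨v, rfl⟩ | ⟨v, rfl⟩
      · simp [hc1, ht1, h1]
      · simp [hc2, ht2, h2]
    · rcases h.cases z with ⟨z, rfl⟩ | ⟨z, rfl⟩
      · exact ⟨k x, by simp [hc1, ← e, h1], ht1 x⟩
      · exact ⟨l x, by simp [hc2, ← e, h2], ht2 x⟩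
    · rcases h'.cases v with ⟨v, rfl⟩ | ⟨v, rfl⟩ <;> rcases h'.cases v' with ⟨v', rfl⟩ | ⟨v', rfl⟩
      · simp only [ht1, Map.id_apply] at e'; rw [e']
      · rw [hc1, hc2] at e; exact (h.ne e).elim
      · rw [hc1, hc2] at e; exact (h.ne e.symm).elim
      · simp only [ht2, Map.id_apply] at e'; rw [e']
  rw [F.add_eq h h1 h2, F.res_tr hp, ← F.add_eq h' ht1 ht2, ← F.res_comp, ← F.res_comp,
    Map.ext' (f := c.comp k) (g := i.comp f) hc1, Map.ext' (f := c.comp l) (g := j.comp f) hc2,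
    F.res_comp, F.res_comp]

/-- Maps that commute with restrictions and transfers are additive. -/
theorem map_add (F' : SemiMackey G) (η : ∀ X, F.obj X → F'.obj X)
    (hres : ∀ {X Y} (f : Map X Y) a, η X (F.res f a) = F'.res f (η Y a))
    (htr : ∀ {X Y} (f : Map X Y) a, η Y (F.tr f a) = F'.tr f (η X a)) (a b : F.obj X) :
    η X (F.add a b) = F'.add (η X a) (η X b) := by
  obtain ⟨-, Z, i, j, g, z, h, h1, h2, rfl, rfl, -⟩ := F.exists_add a b
  rw [F.add_eq h h1 h2, htr, hres, hres, F'.add_eq h h1 h2]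

theorem map_zero (F' : SemiMackey G) (η : ∀ X, F.obj X → F'.obj X)
    (htr : ∀ {X Y} (f : Map X Y) a, η Y (F.tr f a) = F'.tr f (η X a)) :
    η X (F.zero X) = F'.zero X := by
  obtain ⟨E, hE⟩ := exists_empty G
  obtain ⟨a⟩ := F.nonempty_of_isEmpty E
  rw [← F.tr_of_isEmpty E (ofEmpty E X) a, htr, F'.tr_of_isEmpty]

/-- Any unital operation that is compatible with restrictions and transfers is the sum. -/
theorem add_eq_op (op : ∀ X, F.obj X → F.obj X → F.obj X) (e : ∀ X, F.obj X)
    (h1 : ∀ X a, op X (e X) a = a) (h2 : ∀ X a, op X a (e X) = a)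
    (hres : ∀ {X Y} (f : Map X Y) a b, F.res f (op Y a b) = op X (F.res f a) (F.res f b))
    (htr : ∀ {X Y} (f : Map X Y) a b, F.tr f (op X a b) = op Y (F.tr f a) (F.tr f b))
    (he : ∀ {X Y} (f : Map X Y), F.tr f (e X) = e Y) (a b : F.obj X) :
    F.add a b = op X a b ∧ F.zero X = e X := by
  obtain ⟨E, hE⟩ := exists_empty G
  have hempty : ∀ (Y : FinGSet G) (x : F.obj E), F.tr (ofEmpty E Y) x = e Y := fun Y x => by
    have := F.subsingleton_of_isEmpty E
    rw [Subsingleton.elim x (e E), he]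
  refine ⟨?_, ?_⟩
  · obtain ⟨-, Z, i, j, g, z, h, h3, h4, rfl, rfl, -⟩ := F.exists_add a b
    have hz : z = op Z (F.tr i (F.res i z)) (F.tr j (F.res j z)) := by
      refine F.ext_coprod h ?_ ?_
      · rw [hres, F.res_tr (IsPullback.of_injective i fun _ _ => h.inl_inj), F.res_id, F.tr_id,
          F.res_tr (h.isPullback_empty E).symm, hempty, h2]
      · rw [hres, F.res_tr (IsPullback.of_injective j fun _ _ => h.inr_inj), F.res_id, F.tr_id,
          F.res_tr (h.isPullback_empty E), hempty, h1]
    rw [F.add_eq h h3 h4]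
    nth_rw 1 [hz]
    rw [htr, ← F.tr_comp, ← F.tr_comp, Map.ext' (f := g.comp i) (g := Map.id X) h3,
      Map.ext' (f := g.comp j) (g := Map.id X) h4, F.tr_id, F.tr_id]
  · obtain ⟨x⟩ := F.nonempty_of_isEmpty E
    rw [← F.tr_of_isEmpty E (ofEmpty E X) x, hempty]

end SemiMackey

/-- A set-valued functor with restrictions, transfers and norms subject to all the axioms of a Tambara
functor, except that additive inverses need not exist; the ring operations are determined by it. -/
structure SemiTambara.{v, r} (G : Type r) [Group G] extends SemiMackey.{v, r} G where
  nm {X Y : FinGSet G} (f : Map X Y) : obj X → obj Y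
  nm_id {X : FinGSet G} (a : obj X) : nm (Map.id X) a = a
  nm_comp {X Y Z : FinGSet G} (g : Map Y Z) (f : Map X Y) (a : obj X) :
    nm (g.comp f) a = nm g (nm f a)
  res_nm {W X Y Z : FinGSet G} {p : Map W X} {q : Map W Y} {f : Map X Z} {g : Map Y Z}
    (h : IsPullback p q f g) (a : obj X) : res g (nm f a) = nm q (res p a)
  nm_tr {A X Y P Q : FinGSet G} {h : Map A X} {f : Map X Y} {e : Map P A} {p : Map P Q}
    {q : Map Q Y} (H : IsExponential h f e p q) (a : obj A) :
    nm f (tr h a) = tr q (nm p (res e a))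

namespace SemiTambara

variable {G : Type u} [Group G] (F : SemiTambara G) {X Y Z : FinGSet G}

/-- The multiplicative semi-Mackey functor. -/
def mulSM : SemiMackey G where
  obj := F.obj
  res := F.res
  tr := F.nm
  res_id := F.res_id
  res_comp := F.res_comp
  tr_id := F.nm_id
  tr_comp := F.nm_comp
  res_tr := F.res_nm
  nonempty_of_isEmpty := F.nonempty_of_isEmpty
  subsingleton_of_isEmpty := F.subsingleton_of_isEmpty
  bijective_of_isCoprod := F.bijective_of_isCoprod

/-- The product of `a` and `b`: the norm of `(a, b)` along the fold map `X ⊔ X → X`. -/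
noncomputable def mul (a b : F.obj X) : F.obj X := F.mulSM.add a b

/-- The multiplicative unit. -/
noncomputable def one (X : FinGSet G) : F.obj X := F.mulSM.zero X

theorem tr_mul_res (f : Map X Y) (a : F.obj X) (b : F.obj Y) :
    F.tr f (F.mul a (F.res f b)) = F.mul (F.tr f a) b := by
  obtain ⟨Z, i, j, h⟩ := exists_isCoprod Y Y
  obtain ⟨t, ht1, ht2⟩ := h.desc (Map.id Y) (Map.id Y)
  obtain ⟨Z', i', j', h'⟩ := exists_isCoprod X X
  obtain ⟨t', ht1', ht2'⟩ := h'.desc (Map.id X) (Map.id X)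
  obtain ⟨A, k, l, hA⟩ := exists_isCoprod X Y
  obtain ⟨c, hc1, hc2⟩ := hA.desc (i.comp f) j
  obtain ⟨e, he1, he2⟩ := h'.desc k (l.comp f)
  obtain ⟨x, rfl, rfl⟩ := F.exists_pair hA a b
  have hE : IsExponential c t e t' f := by
    refine IsExponential.mk' (IsPullback.mk' (fun v => ?_) (fun z x e' => ?_)
      (fun v v' e₁ e₂ => ?_)) (fun y s hs => ?_) (fun b b' hb H => ?_)
    · rcases h'.cases v with ⟨v, rfl⟩ | ⟨v, rfl⟩
      · simp [he1, hc1, ht1, ht1']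
      · simp [he2, hc2, ht2, ht2']
    · rcases h.cases z with ⟨z, rfl⟩ | ⟨z, rfl⟩
      · exact ⟨i' x, by simp [he1, hc1, ← e', ht1], ht1' x⟩
      · exact ⟨j' x, by simp [he2, hc2, ← e', ht2], ht2' x⟩
    · rcases h'.cases v with ⟨v, rfl⟩ | ⟨v, rfl⟩ <;> rcases h'.cases v' with ⟨v', rfl⟩ | ⟨v', rfl⟩
      · simp only [ht1', Map.id_apply] at e₂; rw [e₂]
      · simp only [Map.comp_apply, he1, he2, hc1, hc2] at e₁; exact (h.ne e₁).elim
      · simp only [Map.comp_apply, he1, he2, hc1, hc2] at e₁; exact (h.ne e₁.symm).elim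
      · simp only [ht2', Map.id_apply] at e₂; rw [e₂]
    · have hi := hs ⟨i y, ht1 y⟩
      have hj := hs ⟨j y, ht2 y⟩
      rcases hA.cases (s ⟨i y, ht1 y⟩) with ⟨x, hx⟩ | ⟨x, hx⟩
      · rcases hA.cases (s ⟨j y, ht2 y⟩) with ⟨x', hx'⟩ | ⟨x', hx'⟩
        · rw [← hx', hc1] at hj; exact (h.ne hj).elim
        · rw [← hx, hc1] at hi
          rw [← hx', hc2] at hj
          refine ⟨x, h.inl_inj hi, fun z v hz hz' => ?_⟩
          rcases h'.cases z with ⟨z, rfl⟩ | ⟨z, rfl⟩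
          · rw [he1, hc1] at hz'
            rw [ht1'] at hz
            rw [he1, show v = ⟨i y, ht1 y⟩ from Subtype.ext (by
              rw [← hz', ← hi, ← hz]; rfl), ← hx, ← hz]
            rfl
          · rw [he2, Map.comp_apply, hc2] at hz'
            rw [ht2'] at hz
            rw [he2, show v = ⟨j y, ht2 y⟩ from Subtype.ext (by
              rw [← hz', ← h.inl_inj hi, ← hz]; rfl), ← hx', Map.comp_apply, h.inr_inj hj,
              ← h.inl_inj hi, ← hz]
            rfl
      · rw [← hx, hc2] at hi; exact (h.ne hi.symm).elim
    · have := H (i' b) (i' b') (ht1' b) (ht1' b') (by simp [he1, hc1, hb])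
      rw [he1, he1] at this
      exact hA.inl_inj this
  have e1 : F.res i (F.tr c x) = F.tr f (F.res k x) := 
    F.res_tr (h.isPullback (f₁ := f) (f₂ := Map.id Y) hA hc1 hc2) x
  have e2 : F.res j (F.tr c x) = F.res l x := by
    rw [F.res_tr (h.symm.isPullback (f₁ := Map.id Y) (f₂ := f) hA.symm hc2 hc1), F.tr_id]
  have e3 : F.mul (F.tr f (F.res k x)) (F.res l x) = F.nm t (F.tr c x) := by
    rw [← e1, ← e2]; exact F.mulSM.add_eq h ht1 ht2 _
  have e4 : F.mul (F.res k x) (F.res f (F.res l x)) = F.nm t' (F.res e x) := by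
    rw [← F.res_comp, ← Map.ext' (f := e.comp i') (g := k) he1,
      ← Map.ext' (f := e.comp j') (g := l.comp f) he2, F.res_comp, F.res_comp]
    exact F.mulSM.add_eq h' ht1' ht2' _
  rw [e3, e4, F.nm_tr hE]

theorem add_mul (a b c : F.obj X) : F.mul (F.add a b) c = F.add (F.mul a c) (F.mul b c) := by
  obtain ⟨-, Z, i, j, g, z, h, h1, h2, rfl, rfl, -⟩ := F.exists_add a b
  have hmul : ∀ {X Y} (f : Map X Y) (a b : F.obj Y),
    F.res f (F.mul a b) = F.mul (F.res f a) (F.res f b) := F.mulSM.res_add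
  rw [F.add_eq h h1 h2, ← F.tr_mul_res, ← F.add_eq h h1 h2, hmul, hmul, ← F.res_comp,
    ← F.res_comp, Map.ext' (f := g.comp i) (g := Map.id X) h1,
    Map.ext' (f := g.comp j) (g := Map.id X) h2, F.res_id]

theorem zero_mul (a : F.obj X) : F.mul (F.zero X) a = F.zero X := by
  obtain ⟨E, hE⟩ := exists_empty G
  obtain ⟨b⟩ := F.nonempty_of_isEmpty E
  rw [← F.tr_of_isEmpty E (ofEmpty E X) b, ← F.tr_mul_res, F.tr_of_isEmpty, F.tr_of_isEmpty]

/-- The ring structure on the values of a semi-Tambara functor in which addition has inverses. -/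
@[reducible]
noncomputable def commRing (X : FinGSet G) (S : AddCommGroup (F.obj X))
    (hadd : ∀ a b : F.obj X, a + b = F.add a b) (hzero : (0 : F.obj X) = F.zero X) :
    CommRing (F.obj X) :=
  { S with
    mul := F.mul
    one := F.one X
    mul_assoc := F.mulSM.add_assoc
    mul_comm := F.mulSM.add_comm
    mul_one := F.mulSM.add_zero
    one_mul := fun a => (F.mulSM.add_comm _ _).trans (F.mulSM.add_zero a)
    left_distrib := fun a b c => by
      change F.mul a (b + c) = F.mul a b + F.mul a c
      rw [hadd, hadd, show F.mul a (F.add b c) = _ from F.mulSM.add_comm _ _,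
        show F.mul a b = _ from F.mulSM.add_comm _ _, show F.mul a c = _ from F.mulSM.add_comm _ _]
      exact F.add_mul b c a
    right_distrib := fun a b c => by
      change F.mul (a + b) c = F.mul a c + F.mul b c
      rw [hadd, hadd, F.add_mul]
    zero_mul := fun a => by
      change F.mul 0 a = 0
      rw [hzero, F.zero_mul]
    mul_zero := fun a => by
      change F.mul a 0 = 0
      rw [show F.mul a 0 = _ from F.mulSM.add_comm _ _, hzero]
      exact F.zero_mul a }

end SemiTambara

/-! ## Tambara functors and their modules -/

/-- A `G`-Tambara functor: commutative rings `obj X` for all finite `G`-sets `X` with restrictions,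
transfers and norms along all maps of finite `G`-sets. -/
structure Tambara (G : Type u) [Group G] where
  obj : FinGSet G → Type (max u w)
  [commRing : ∀ X, CommRing (obj X)]
  res {X Y : FinGSet G} (f : Map X Y) : obj Y →+* obj X
  tr {X Y : FinGSet G} (f : Map X Y) : obj X →+ obj Y
  nm {X Y : FinGSet G} (f : Map X Y) : obj X →* obj Y
  res_id {X : FinGSet G} (a : obj X) : res (Map.id X) a = a
  res_comp {X Y Z : FinGSet G} (g : Map Y Z) (f : Map X Y) (a : obj Z) :
    res (g.comp f) a = res f (res g a)
  tr_id {X : FinGSet G} (a : obj X) : tr (Map.id X) a = a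
  tr_comp {X Y Z : FinGSet G} (g : Map Y Z) (f : Map X Y) (a : obj X) :
    tr (g.comp f) a = tr g (tr f a)
  nm_id {X : FinGSet G} (a : obj X) : nm (Map.id X) a = a
  nm_comp {X Y Z : FinGSet G} (g : Map Y Z) (f : Map X Y) (a : obj X) :
    nm (g.comp f) a = nm g (nm f a)
  /-- the double coset formula for transfers -/
  res_tr {W X Y Z : FinGSet G} {p : Map W X} {q : Map W Y} {f : Map X Z} {g : Map Y Z}
    (h : IsPullback p q f g) (a : obj X) : res g (tr f a) = tr q (res p a)
  /-- the double coset formula for norms -/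
  res_nm {W X Y Z : FinGSet G} {p : Map W X} {q : Map W Y} {f : Map X Z} {g : Map Y Z}
    (h : IsPullback p q f g) (a : obj X) : res g (nm f a) = nm q (res p a)
  /-- Frobenius reciprocity -/
  tr_mul_res {X Y : FinGSet G} (f : Map X Y) (a : obj X) (b : obj Y) :
    tr f (a * res f b) = tr f a * b
  /-- the norm of a transfer -/
  nm_tr {A X Y P Q : FinGSet G} {h : Map A X} {f : Map X Y} {e : Map P A} {p : Map P Q}
    {q : Map Q Y} (H : IsExponential h f e p q) (a : obj A) :
    nm f (tr h a) = tr q (nm p (res e a))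
  subsingleton_of_isEmpty (X : FinGSet G) [IsEmpty X] : Subsingleton (obj X)
  /-- disjoint unions are sent to products -/
  bijective_of_isCoprod {X Y Z : FinGSet G} {i : Map X Z} {j : Map Y Z} (h : IsCoprod i j) :
    Function.Bijective (fun c : obj Z => (res i c, res j c))

attribute [instance] Tambara.commRing

variable {G : Type u} [Group G]

namespace Tambara

/-- Morphisms of Tambara functors.  A morphism `k → R` is the same as a `k`-algebra `R`. -/
@[ext]
structure Hom (k R : Tambara.{w} G) where
  app (X : FinGSet G) : k.obj X →+* R.obj X
  app_res {X Y : FinGSet G} (f : Map X Y) (a : k.obj Y) :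
    app X (k.res f a) = R.res f (app Y a)
  app_tr {X Y : FinGSet G} (f : Map X Y) (a : k.obj X) :
    app Y (k.tr f a) = R.tr f (app X a)
  app_nm {X Y : FinGSet G} (f : Map X Y) (a : k.obj X) :
    app Y (k.nm f a) = R.nm f (app X a)

/-- The identity morphism. -/
def Hom.id (k : Tambara.{w} G) : Hom k k :=
  ⟨fun _ => RingHom.id _, fun _ _ => rfl, fun _ _ => rfl, fun _ _ => rfl⟩

/-- Composition `ψ ∘ φ` of morphisms. -/
def Hom.comp {k R S : Tambara.{w} G} (ψ : Hom R S) (φ : Hom k R) : Hom k S where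
  app X := (ψ.app X).comp (φ.app X)
  app_res f a := by simp [φ.app_res, ψ.app_res]
  app_tr f a := by simp [φ.app_tr, ψ.app_tr]
  app_nm f a := by simp [φ.app_nm, ψ.app_nm]

/-- The underlying semi-Tambara functor. -/
def toSemiTambara (k : Tambara.{w} G) : SemiTambara G where
  obj := k.obj
  res f := k.res f
  tr f := k.tr f
  nm f := k.nm f
  res_id := k.res_id
  res_comp := k.res_comp
  tr_id := k.tr_id
  tr_comp := k.tr_comp
  nm_id := k.nm_id
  nm_comp := k.nm_comp
  res_tr := k.res_tr
  res_nm := k.res_nm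
  nm_tr := k.nm_tr
  nonempty_of_isEmpty _ := ⟨0⟩
  subsingleton_of_isEmpty X := k.subsingleton_of_isEmpty X
  bijective_of_isCoprod := k.bijective_of_isCoprod

theorem add_eq (k : Tambara.{w} G) {X : FinGSet G} (a b : k.obj X) :
    k.toSemiTambara.add a b = a + b ∧ k.toSemiTambara.zero X = (0 : k.obj X) :=
  k.toSemiTambara.add_eq_op (fun X (a b : k.obj X) => (a + b : k.obj X)) (fun X => (0 : k.obj X))
    (fun _ (a : k.obj _) => _root_.zero_add a) (fun _ (a : k.obj _) => _root_.add_zero a)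
    (fun f (a b : k.obj _) => _root_.map_add (k.res f) a b)
    (fun f (a b : k.obj _) => _root_.map_add (k.tr f) a b) (fun f => _root_.map_zero (k.tr f)) a b

theorem mul_eq (k : Tambara.{w} G) {X : FinGSet G} (a b : k.obj X) :
    k.toSemiTambara.mul a b = a * b ∧ k.toSemiTambara.one X = (1 : k.obj X) :=
  k.toSemiTambara.mulSM.add_eq_op (fun X (a b : k.obj X) => (a * b : k.obj X))
    (fun X => (1 : k.obj X))
    (fun _ (a : k.obj _) => _root_.one_mul a) (fun _ (a : k.obj _) => _root_.mul_one a)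
    (fun f (a b : k.obj _) => _root_.map_mul (k.res f) a b)
    (fun f (a b : k.obj _) => _root_.map_mul (k.nm f) a b) (fun f => _root_.map_one (k.nm f)) a b

theorem exists_pair (k : Tambara.{w} G) {X Y Z : FinGSet G} {i : Map X Z} {j : Map Y Z}
    (h : IsCoprod i j) (a : k.obj X) (b : k.obj Y) : ∃ c, k.res i c = a ∧ k.res j c = b :=
  k.toSemiTambara.exists_pair h a b

/-- A family of maps commuting with restrictions, transfers and norms is a morphism. -/
def homMk {k R : Tambara.{w} G} (η : ∀ X, k.obj X → R.obj X)
    (hres : ∀ {X Y} (f : Map X Y) a, η X (k.res f a) = R.res f (η Y a))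
    (htr : ∀ {X Y} (f : Map X Y) a, η Y (k.tr f a) = R.tr f (η X a))
    (hnm : ∀ {X Y} (f : Map X Y) a, η Y (k.nm f a) = R.nm f (η X a)) : Hom k R where
  app X :=
    { toFun := η X
      map_one' := by
        have h1 := (k.mul_eq (X := X) 0 0).2
        have h2 := (R.mul_eq (X := X) 0 0).2
        rw [← h1, ← h2]
        exact k.toSemiTambara.mulSM.map_zero R.toSemiTambara.mulSM η hnm
      map_mul' := fun a b => by
        rw [← (k.mul_eq a b).1, ← (R.mul_eq _ _).1]
        exact k.toSemiTambara.mulSM.map_add R.toSemiTambara.mulSM η hres hnm a b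
      map_zero' := by
        have h1 := (k.add_eq (X := X) 0 0).2
        have h2 := (R.add_eq (X := X) 0 0).2
        rw [← h1, ← h2]
        exact k.toSemiTambara.map_zero R.toSemiTambara.toSemiMackey η htr
      map_add' := fun a b => by
        rw [← (k.add_eq a b).1, ← (R.add_eq _ _).1]
        exact k.toSemiTambara.map_add R.toSemiTambara.toSemiMackey η hres htr a b }
  app_res := hres
  app_tr := htr
  app_nm := hnm

theorem nm_zero (k : Tambara.{w} G) {X Y : FinGSet G} (f : Map X Y)
    (hf : Function.Surjective f.toFun) : k.nm f 0 = 0 := by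
  obtain ⟨E, hE⟩ := exists_empty G
  have H : IsExponential (ofEmpty E X) f (Map.id E) (Map.id E) (ofEmpty E Y) :=
    IsExponential.mk'
      (IsPullback.mk' (fun v => isEmptyElim v) (fun _ x => isEmptyElim x) (fun v => isEmptyElim v))
      (fun y s _ => by
        obtain ⟨x, hx⟩ := hf y
        exact isEmptyElim (s ⟨x, hx⟩))
      (fun b => isEmptyElim b)
  have := k.subsingleton_of_isEmpty E
  have h := k.nm_tr H 0
  rwa [Subsingleton.elim (k.nm (Map.id E) _) 0, _root_.map_zero (k.tr _),
    _root_.map_zero (k.tr _)] at h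

end Tambara

/-- A module over the underlying Green functor of a Tambara functor `k`: a Mackey functor with
actions of the rings `k.obj X`, compatible with restrictions and subject to Frobenius reciprocity. -/
structure TModule (k : Tambara.{w} G) where
  obj : FinGSet G → Type (max u w)
  [addCommGroup : ∀ X, AddCommGroup (obj X)]
  [module : ∀ X, Module (k.obj X) (obj X)]
  res {X Y : FinGSet G} (f : Map X Y) : obj Y →+ obj X
  tr {X Y : FinGSet G} (f : Map X Y) : obj X →+ obj Y
  res_id {X : FinGSet G} (a : obj X) : res (Map.id X) a = a
  res_comp {X Y Z : FinGSet G} (g : Map Y Z) (f : Map X Y) (a : obj Z) :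
    res (g.comp f) a = res f (res g a)
  tr_id {X : FinGSet G} (a : obj X) : tr (Map.id X) a = a
  tr_comp {X Y Z : FinGSet G} (g : Map Y Z) (f : Map X Y) (a : obj X) :
    tr (g.comp f) a = tr g (tr f a)
  res_tr {W X Y Z : FinGSet G} {p : Map W X} {q : Map W Y} {f : Map X Z} {g : Map Y Z}
    (h : IsPullback p q f g) (a : obj X) : res g (tr f a) = tr q (res p a)
  res_smul {X Y : FinGSet G} (f : Map X Y) (a : k.obj Y) (m : obj Y) :
    res f (a • m) = k.res f a • res f m
  tr_res_smul {X Y : FinGSet G} (f : Map X Y) (a : k.obj Y) (m : obj X) :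
    tr f (k.res f a • m) = a • tr f m
  tr_smul_res {X Y : FinGSet G} (f : Map X Y) (a : k.obj X) (m : obj Y) :
    tr f (a • res f m) = k.tr f a • m
  subsingleton_of_isEmpty (X : FinGSet G) [IsEmpty X] : Subsingleton (obj X)
  bijective_of_isCoprod {X Y Z : FinGSet G} {i : Map X Z} {j : Map Y Z} (h : IsCoprod i j) :
    Function.Bijective (fun c : obj Z => (res i c, res j c))

attribute [instance] TModule.addCommGroup TModule.module

namespace TModule

variable {k : Tambara.{w} G}

/-- Morphisms of modules. -/
@[ext]
structure Hom (M N : TModule k) where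
  app (X : FinGSet G) : M.obj X →ₗ[k.obj X] N.obj X
  app_res {X Y : FinGSet G} (f : Map X Y) (m : M.obj Y) :
    app X (M.res f m) = N.res f (app Y m)
  app_tr {X Y : FinGSet G} (f : Map X Y) (m : M.obj X) :
    app Y (M.tr f m) = N.tr f (app X m)

/-- The underlying semi-Mackey functor. -/
def toSemiMackey (M : TModule k) : SemiMackey G where
  obj := M.obj
  res f := M.res f
  tr f := M.tr f
  res_id := M.res_id
  res_comp := M.res_comp
  tr_id := M.tr_id
  tr_comp := M.tr_comp
  res_tr := M.res_tr
  nonempty_of_isEmpty _ := ⟨0⟩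
  subsingleton_of_isEmpty X := M.subsingleton_of_isEmpty X
  bijective_of_isCoprod := M.bijective_of_isCoprod

theorem add_eq (M : TModule k) {X : FinGSet G} (a b : M.obj X) :
    M.toSemiMackey.add a b = a + b ∧ M.toSemiMackey.zero X = (0 : M.obj X) :=
  M.toSemiMackey.add_eq_op (fun X (a b : M.obj X) => (a + b : M.obj X)) (fun X => (0 : M.obj X))
    (fun _ (a : M.obj _) => _root_.zero_add a) (fun _ (a : M.obj _) => _root_.add_zero a)
    (fun f (a b : M.obj _) => _root_.map_add (M.res f) a b)
    (fun f (a b : M.obj _) => _root_.map_add (M.tr f) a b) (fun f => _root_.map_zero (M.tr f)) a b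

theorem ext_coprod (M : TModule k) {X Y Z : FinGSet G} {i : Map X Z} {j : Map Y Z}
    (h : IsCoprod i j) {a b : M.obj Z} (h1 : M.res i a = M.res i b) (h2 : M.res j a = M.res j b) :
    a = b := M.toSemiMackey.ext_coprod h h1 h2

theorem exists_pair (M : TModule k) {X Y Z : FinGSet G} {i : Map X Z} {j : Map Y Z}
    (h : IsCoprod i j) (a : M.obj X) (b : M.obj Y) : ∃ c, M.res i c = a ∧ M.res j c = b :=
  M.toSemiMackey.exists_pair h a b

theorem exists_add (M : TModule k) {X : FinGSet G} (a b : M.obj X) : ∃ (Z : FinGSet G)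
    (i j : Map X Z) (g : Map Z X) (z : M.obj Z), IsCoprod i j ∧ (∀ x, g (i x) = x) ∧
    (∀ x, g (j x) = x) ∧ M.res i z = a ∧ M.res j z = b ∧ M.tr g z = a + b := by
  obtain ⟨-, Z, i, j, g, z, h, h1, h2, rfl, rfl, -⟩ := M.toSemiMackey.exists_add a b
  refine ⟨Z, i, j, g, z, h, h1, h2, rfl, rfl, ?_⟩
  exact (M.toSemiMackey.add_eq h h1 h2 z).symm.trans (M.add_eq (M.res i z) (M.res j z)).1

/-- Restriction of scalars along a morphism of Tambara functors. -/
def restrictScalars {R : Tambara.{w} G} (φ : Tambara.Hom k R) (M : TModule R) : TModule k where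
  obj := M.obj
  addCommGroup := M.addCommGroup
  module X := Module.compHom (M.obj X) (φ.app X)
  res := M.res
  tr := M.tr
  res_id := M.res_id
  res_comp := M.res_comp
  tr_id := M.tr_id
  tr_comp := M.tr_comp
  res_tr := M.res_tr
  res_smul f a m := by
    change M.res f (φ.app _ a • m) = φ.app _ (k.res f a) • M.res f m
    rw [M.res_smul, φ.app_res]
  tr_res_smul f a m := by
    change M.tr f (φ.app _ (k.res f a) • m) = φ.app _ a • M.tr f m
    rw [φ.app_res, M.tr_res_smul]
  tr_smul_res f a m := by
    change M.tr f (φ.app _ a • M.res f m) = φ.app _ (k.tr f a) • m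
    rw [φ.app_tr, M.tr_smul_res]
  subsingleton_of_isEmpty X := M.subsingleton_of_isEmpty X
  bijective_of_isCoprod := M.bijective_of_isCoprod

/-- A Tambara functor as a module over itself. -/
def self (R : Tambara.{w} G) : TModule R where
  obj := R.obj
  res f := (R.res f).toAddMonoidHom
  tr := R.tr
  res_id := R.res_id
  res_comp := R.res_comp
  tr_id := R.tr_id
  tr_comp := R.tr_comp
  res_tr := R.res_tr
  res_smul f a m := map_mul (R.res f) a m
  tr_res_smul f a m := by
    change R.tr f (R.res f a * m) = a * R.tr f m
    rw [mul_comm, R.tr_mul_res, mul_comm]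
  tr_smul_res f a m := R.tr_mul_res f a m
  subsingleton_of_isEmpty X := R.subsingleton_of_isEmpty X
  bijective_of_isCoprod := R.bijective_of_isCoprod

/-- The underlying `k`-module of a `k`-algebra. -/
def ofAlgebra {R : Tambara.{w} G} (φ : Tambara.Hom k R) : TModule k := (self R).restrictScalars φ

end TModule

/-! ## The box product of modules -/

section Box

variable {k : Tambara.{w} G} (M N : TModule k)

/-- Representatives `(f : Y → X, m, n)` of the elements `tr_f (m ⊗ n)` of `(M ⊠_k N)(X)`. -/
structure BoxPre (X : FinGSet G) : Type (max u w) where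
  Y : FinGSet G
  f : Map Y X
  m : M.obj Y
  n : N.obj Y

/-- The relations between the symbols `tr_f (m ⊗ n)`: for `h : W → Y` and `f : Y → X`,
`tr_f (tr_h m ⊗ n) = tr_{f ∘ h} (m ⊗ res_h n)`, `tr_f (m ⊗ tr_h n) = tr_{f ∘ h} (res_h m ⊗ n)`
and `tr_f (a m ⊗ n) = tr_f (m ⊗ a n)` for `a` in `k`. -/
inductive BoxRel (X : FinGSet G) : BoxPre M N X → BoxPre M N X → Prop
  | tr_left {Y W : FinGSet G} (f : Map Y X) (h : Map W Y) (m : M.obj W) (n : N.obj Y) :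
      BoxRel X ⟨Y, f, M.tr h m, n⟩ ⟨W, f.comp h, m, N.res h n⟩
  | tr_right {Y W : FinGSet G} (f : Map Y X) (h : Map W Y) (m : M.obj Y) (n : N.obj W) :
      BoxRel X ⟨Y, f, m, N.tr h n⟩ ⟨W, f.comp h, M.res h m, n⟩
  | smul {Y : FinGSet G} (f : Map Y X) (a : k.obj Y) (m : M.obj Y) (n : N.obj Y) :
      BoxRel X ⟨Y, f, a • m, n⟩ ⟨Y, f, m, a • n⟩

/-- The value at `X` of the box product `M ⊠_k N`: the set of all symbols `tr_f (m ⊗ n)`, where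
`f : Y → X` is a map of finite `G`-sets, `m ∈ M(Y)` and `n ∈ N(Y)`, modulo the equivalence relation
generated by Frobenius reciprocity on both sides and by `k`-bilinearity.  Sums are given by disjoint
unions, so every element is a single symbol, and biadditivity follows from Frobenius reciprocity for
fold maps (`Box.mk_add_left`). -/
def Box (X : FinGSet G) : Type (max u w) := Quot (BoxRel M N X)

namespace Box

variable {M N} {X Y Z W : FinGSet G}

/-- The symbol `tr_f (m ⊗ n)`. -/
def mk (f : Map Y X) (m : M.obj Y) (n : N.obj Y) : Box M N X := Quot.mk _ ⟨Y, f, m, n⟩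

theorem ind {P : Box M N X → Prop} (h : ∀ (Y : FinGSet G) (f : Map Y X) m n, P (mk f m n))
    (s : Box M N X) : P s := Quot.ind (fun ⟨Y, f, m, n⟩ => h Y f m n) s

theorem mk_tr_left (f : Map Y X) (h : Map W Y) (m : M.obj W) (n : N.obj Y) :
    (mk f (M.tr h m) n : Box M N X) = mk (f.comp h) m (N.res h n) := Quot.sound (.tr_left f h m n)

theorem mk_tr_right (f : Map Y X) (h : Map W Y) (m : M.obj Y) (n : N.obj W) :
    (mk f m (N.tr h n) : Box M N X) = mk (f.comp h) (M.res h m) n := Quot.sound (.tr_right f h m n)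

theorem mk_smul (f : Map Y X) (a : k.obj Y) (m : M.obj Y) (n : N.obj Y) :
    (mk f (a • m) n : Box M N X) = mk f m (a • n) := Quot.sound (.smul f a m n)

theorem mk_iso (φ : Map W Y) (hφ : Function.Bijective φ.toFun) (f : Map Y X) (m : M.obj Y)
    (n : N.obj Y) : (mk (f.comp φ) (M.res φ m) (N.res φ n) : Box M N X) = mk f m n := by
  rw [← mk_tr_left]
  congr 1
  exact M.toSemiMackey.tr_res_of_bijective φ hφ m

/-- Transfers in the box product. -/
def tr (g : Map X Z) : Box M N X → Box M N Z :=
  Quot.map (fun s => ⟨s.Y, g.comp s.f, s.m, s.n⟩) (by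
    rintro _ _ (⟨f, h, m, n⟩ | ⟨f, h, m, n⟩ | ⟨f, a, m, n⟩)
    · exact .tr_left (g.comp f) h m n
    · exact .tr_right (g.comp f) h m n
    · exact .smul (g.comp f) a m n)

theorem tr_mk (g : Map X Z) (f : Map Y X) (m : M.obj Y) (n : N.obj Y) :
    tr g (mk f m n : Box M N X) = mk (g.comp f) m n := rfl

theorem mk_pullback {V V' : FinGSet G} {f : Map Y X} {g : Map Z X} {p : Map V Y} {q : Map V Z}
    (h : IsPullback p q f g) {p' : Map V' Y} {q' : Map V' Z} (h' : IsPullback p' q' f g)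
    (m : M.obj Y) (n : N.obj Y) :
    (mk q (M.res p m) (N.res p n) : Box M N Z) = mk q' (M.res p' m) (N.res p' n) := by
  obtain ⟨c, hc1, hc2⟩ := h'.lift p q h.comm
  have hc : Function.Bijective c.toFun := by
    refine ⟨fun v v' e => h.uniq ?_ ?_, fun v => ?_⟩
    · rw [← hc1, ← hc1, e]
    · rw [← hc2, ← hc2, e]
    · obtain ⟨t, h1, h2⟩ := h.exi (h'.comm v)
      exact ⟨t, h'.uniq (by rw [hc1, h1]) (by rw [hc2, h2])⟩
  rw [← mk_iso c hc, ← M.res_comp, ← N.res_comp, Map.ext' (f := p'.comp c) (g := p) hc1,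
    Map.ext' (f := q'.comp c) (g := q) hc2]

theorem exists_res (g : Map Z X) (s : BoxPre M N X) : ∃ t : Box M N Z, ∃ (V : FinGSet G)
    (p : Map V s.Y) (q : Map V Z), IsPullback p q s.f g ∧ mk q (M.res p s.m) (N.res p s.n) = t := by
  obtain ⟨V, p, q, h⟩ := exists_isPullback s.f g
  exact ⟨_, V, p, q, h, rfl⟩

/-- Restriction of a symbol: pull back along `g`. -/
noncomputable def resPre (g : Map Z X) (s : BoxPre M N X) : Box M N Z := (exists_res g s).choose

theorem resPre_eq {V : FinGSet G} {f : Map Y X} {g : Map Z X} {p : Map V Y} {q : Map V Z}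
    (h : IsPullback p q f g) (m : M.obj Y) (n : N.obj Y) :
    resPre g (⟨Y, f, m, n⟩ : BoxPre M N X) = mk q (M.res p m) (N.res p n) := by
  obtain ⟨V', p', q', h', e⟩ := (exists_res g (⟨Y, f, m, n⟩ : BoxPre M N X)).choose_spec
  rw [resPre, ← e]
  exact mk_pullback h' h m n

/-- Restrictions in the box product. -/
noncomputable def res (g : Map Z X) : Box M N X → Box M N Z :=
  Quot.lift (resPre g) (by
    rintro _ _ (⟨f, h, m, n⟩ | ⟨f, h, m, n⟩ | ⟨f, a, m, n⟩)
    · obtain ⟨V, p, q, h1⟩ := exists_isPullback f g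
      obtain ⟨W, p', h', h2⟩ := exists_isPullback h p
      rw [resPre_eq h1, resPre_eq (h1.symm.paste h2.symm).symm, M.res_tr h2, mk_tr_left,
        ← N.res_comp, ← N.res_comp, Map.ext' (f := p.comp h') (g := h.comp p')
        fun v => (h2.comm v).symm]
    · obtain ⟨V, p, q, h1⟩ := exists_isPullback f g
      obtain ⟨W, p', h', h2⟩ := exists_isPullback h p
      rw [resPre_eq h1, resPre_eq (h1.symm.paste h2.symm).symm, N.res_tr h2, mk_tr_right,
        ← M.res_comp, ← M.res_comp, Map.ext' (f := p.comp h') (g := h.comp p')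
        fun v => (h2.comm v).symm]
    · obtain ⟨V, p, q, h1⟩ := exists_isPullback f g
      rw [resPre_eq h1, resPre_eq h1, M.res_smul, N.res_smul, mk_smul])

theorem res_mk {V : FinGSet G} {f : Map Y X} {g : Map Z X} {p : Map V Y} {q : Map V Z}
    (h : IsPullback p q f g) (m : M.obj Y) (n : N.obj Y) :
    res g (mk f m n : Box M N X) = mk q (M.res p m) (N.res p n) := resPre_eq h m n

theorem glue_unique {i : Map X Z} {j : Map Y Z} {V₁ V₂ V V' : FinGSet G}
    {f₁ : Map V₁ X} {f₂ : Map V₂ Y} {a : Map V₁ V} {b : Map V₂ V} (h : IsCoprod a b)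
    {a' : Map V₁ V'} {b' : Map V₂ V'} (h' : IsCoprod a' b') {f : Map V Z} {f' : Map V' Z}
    (hf1 : ∀ v, f (a v) = i (f₁ v)) (hf2 : ∀ v, f (b v) = j (f₂ v))
    (hf1' : ∀ v, f' (a' v) = i (f₁ v)) (hf2' : ∀ v, f' (b' v) = j (f₂ v))
    {m : M.obj V} {n : N.obj V} {m' : M.obj V'} {n' : N.obj V'}
    (hm1 : M.res a m = M.res a' m') (hm2 : M.res b m = M.res b' m')
    (hn1 : N.res a n = N.res a' n') (hn2 : N.res b n = N.res b' n') :
    (mk f m n : Box M N Z) = mk f' m' n' := by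
  obtain ⟨c, hc1, hc2⟩ := h.desc a' b'
  have hc : Function.Bijective c.toFun := by
    constructor
    · intro v v' e
      rcases h.cases v with ⟨v, rfl⟩ | ⟨v, rfl⟩ <;> rcases h.cases v' with ⟨v', rfl⟩ | ⟨v', rfl⟩
      · rw [hc1, hc1] at e; rw [h'.inl_inj e]
      · rw [hc1, hc2] at e; exact (h'.ne e).elim
      · rw [hc1, hc2] at e; exact (h'.ne e.symm).elim
      · rw [hc2, hc2] at e; rw [h'.inr_inj e]
    · intro v
      rcases h'.cases v with ⟨v, rfl⟩ | ⟨v, rfl⟩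
      · exact ⟨a v, hc1 v⟩
      · exact ⟨b v, hc2 v⟩
  rw [← mk_iso c hc]
  have h1 : f = f'.comp c := Map.ext' fun v => by
    rcases h.cases v with ⟨v, rfl⟩ | ⟨v, rfl⟩
    · simp [hc1, hf1, hf1']
    · simp [hc2, hf2, hf2']
  have h2 : m = M.res c m' := by
    refine M.ext_coprod h ?_ ?_
    · rw [← M.res_comp, Map.ext' (f := c.comp a) (g := a') hc1, hm1]
    · rw [← M.res_comp, Map.ext' (f := c.comp b) (g := b') hc2, hm2]
  have h3 : n = N.res c n' := by
    refine N.ext_coprod h ?_ ?_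
    · rw [← N.res_comp, Map.ext' (f := c.comp a) (g := a') hc1, hn1]
    · rw [← N.res_comp, Map.ext' (f := c.comp b) (g := b') hc2, hn2]
  rw [h1, h2, h3]

theorem exists_glue {i : Map X Z} {j : Map Y Z} (s : BoxPre M N X) (t : BoxPre M N Y) :
    ∃ r : Box M N Z, ∃ (V : FinGSet G) (a : Map s.Y V) (b : Map t.Y V) (f : Map V Z)
      (m : M.obj V) (n : N.obj V), IsCoprod a b ∧ (∀ v, f (a v) = i (s.f v)) ∧
      (∀ v, f (b v) = j (t.f v)) ∧ M.res a m = s.m ∧ M.res b m = t.m ∧ N.res a n = s.n ∧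
      N.res b n = t.n ∧ mk f m n = r := by
  obtain ⟨V, a, b, h⟩ := exists_isCoprod s.Y t.Y
  obtain ⟨f, h1, h2⟩ := h.desc (i.comp s.f) (j.comp t.f)
  obtain ⟨m, h3, h4⟩ := M.exists_pair h s.m t.m
  obtain ⟨n, h5, h6⟩ := N.exists_pair h s.n t.n
  exact ⟨_, V, a, b, f, m, n, h, h1, h2, h3, h4, h5, h6, rfl⟩

/-- The element over `X ⊔ Y` with given components, for symbols. -/
noncomputable def gluePre (i : Map X Z) (j : Map Y Z) (s : BoxPre M N X) (t : BoxPre M N Y) :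
    Box M N Z := (exists_glue (i := i) (j := j) s t).choose

theorem gluePre_eq {i : Map X Z} {j : Map Y Z} {V₁ V₂ V : FinGSet G}
    {f₁ : Map V₁ X} {f₂ : Map V₂ Y} {a : Map V₁ V} {b : Map V₂ V} (h : IsCoprod a b)
    {f : Map V Z} (hf1 : ∀ v, f (a v) = i (f₁ v)) (hf2 : ∀ v, f (b v) = j (f₂ v))
    {m : M.obj V} {n : N.obj V} {m₁ n₁ m₂ n₂} (hm1 : M.res a m = m₁) (hm2 : M.res b m = m₂)
    (hn1 : N.res a n = n₁) (hn2 : N.res b n = n₂) :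
    gluePre i j (⟨V₁, f₁, m₁, n₁⟩ : BoxPre M N X) ⟨V₂, f₂, m₂, n₂⟩ = mk f m n := by
  obtain ⟨V', a', b', f', m', n', h', h1, h2, h3, h4, h5, h6, e⟩ :=
    (exists_glue (i := i) (j := j) (⟨V₁, f₁, m₁, n₁⟩ : BoxPre M N X) ⟨V₂, f₂, m₂, n₂⟩).choose_spec
  rw [gluePre, ← e]
  exact glue_unique h' h h1 h2 hf1 hf2 (h3.trans hm1.symm) (h4.trans hm2.symm)
    (h5.trans hn1.symm) (h6.trans hn2.symm)

theorem gluePre_comm (i : Map X Z) (j : Map Y Z) (s : BoxPre M N X)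
    (t : BoxPre M N Y) : gluePre i j s t = gluePre j i t s := by
  obtain ⟨V', a', b', f', m', n', h', h1, h2, h3, h4, h5, h6, e⟩ :=
    (exists_glue (i := i) (j := j) s t).choose_spec
  rw [gluePre, ← e]
  exact (gluePre_eq h'.symm h2 h1 h4 h3 h6 h5).symm

theorem gluePre_rel (i : Map X Z) (j : Map Y Z) {s s' : BoxPre M N X}
    (t : BoxPre M N Y) (hs : BoxRel M N X s s') : gluePre i j s t = gluePre i j s' t := by
  obtain ⟨V₂, f₂, m₂, n₂⟩ := t
  have key : ∀ {A B : FinGSet G} (f : Map A X) (h : Map B A), ∃ (V V' : FinGSet G) (a : Map A V)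
      (b : Map V₂ V) (a' : Map B V') (b' : Map V₂ V') (c : Map V' V) (g : Map V Z),
      IsCoprod a b ∧ IsCoprod a' b' ∧ (∀ v, g (a v) = i (f v)) ∧ (∀ v, g (b v) = j (f₂ v)) ∧
      (∀ v, c (a' v) = a (h v)) ∧ (∀ v, c (b' v) = b v) := fun {A B} f h => by
    obtain ⟨V, a, b, h1⟩ := exists_isCoprod A V₂
    obtain ⟨V', a', b', h2⟩ := exists_isCoprod B V₂
    obtain ⟨g, h3, h4⟩ := h1.desc (i.comp f) (j.comp f₂)
    obtain ⟨c, h5, h6⟩ := h2.desc (a.comp h) b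
    exact ⟨V, V', a, b, a', b', c, g, h1, h2, h3, h4, h5, h6⟩
  rcases hs with ⟨f, h, m, n⟩ | ⟨f, h, m, n⟩ | ⟨f, x, m, n⟩
  · obtain ⟨V, V', a, b, a', b', c, g, h1, h2, h3, h4, h5, h6⟩ := key f h
    obtain ⟨μ, hμ, rfl⟩ := M.exists_pair h2 m m₂
    obtain ⟨ν, rfl, rfl⟩ := N.exists_pair h1 n n₂
    subst hμ
    have e1 : M.res a (M.tr c μ) = M.tr h (M.res a' μ) :=
      M.res_tr (h1.isPullback (f₁ := h) (f₂ := Map.id V₂) h2 h5 h6) μ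
    have e2 : M.res b (M.tr c μ) = M.res b' μ := by
      rw [M.res_tr (h1.symm.isPullback (f₁ := Map.id V₂) (f₂ := h) h2.symm h6 h5), M.tr_id]
    refine (gluePre_eq h1 (f := g) h3 h4 (m := M.tr c μ) (n := ν) e1 e2 rfl rfl).trans ?_
    rw [mk_tr_left]
    refine (gluePre_eq h2 (fun v => ?_) (fun v => ?_) rfl rfl ?_ ?_).symm
    · simp [h5, h3]
    · simp [h6, h4]
    · rw [← N.res_comp, Map.ext' (f := c.comp a') (g := a.comp h) h5, N.res_comp]
    · rw [← N.res_comp, Map.ext' (f := c.comp b') (g := b) h6]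
  · obtain ⟨V, V', a, b, a', b', c, g, h1, h2, h3, h4, h5, h6⟩ := key f h
    obtain ⟨μ, rfl, rfl⟩ := M.exists_pair h1 m m₂
    obtain ⟨ν, hν, rfl⟩ := N.exists_pair h2 n n₂
    subst hν
    have e1 : N.res a (N.tr c ν) = N.tr h (N.res a' ν) :=
      N.res_tr (h1.isPullback (f₁ := h) (f₂ := Map.id V₂) h2 h5 h6) ν
    have e2 : N.res b (N.tr c ν) = N.res b' ν := by
      rw [N.res_tr (h1.symm.isPullback (f₁ := Map.id V₂) (f₂ := h) h2.symm h6 h5), N.tr_id]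
    refine (gluePre_eq h1 (f := g) h3 h4 (m := μ) (n := N.tr c ν) rfl rfl e1 e2).trans ?_
    rw [mk_tr_right]
    refine (gluePre_eq h2 (fun v => ?_) (fun v => ?_) ?_ ?_ rfl rfl).symm
    · simp [h5, h3]
    · simp [h6, h4]
    · rw [← M.res_comp, Map.ext' (f := c.comp a') (g := a.comp h) h5, M.res_comp]
    · rw [← M.res_comp, Map.ext' (f := c.comp b') (g := b) h6]
  · obtain ⟨V, a, b, h1⟩ := exists_isCoprod _ V₂
    obtain ⟨g, h3, h4⟩ := h1.desc (i.comp f) (j.comp f₂)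
    obtain ⟨y, rfl, hy⟩ := k.exists_pair h1 x (1 : k.obj V₂)
    obtain ⟨μ, rfl, rfl⟩ := M.exists_pair h1 m m₂
    obtain ⟨ν, rfl, rfl⟩ := N.exists_pair h1 n n₂
    refine (gluePre_eq h1 (f := g) h3 h4 (m := y • μ) (n := ν) (M.res_smul a y μ) ?_
      rfl rfl).trans ?_
    · rw [M.res_smul, hy, one_smul]
    · rw [mk_smul]
      refine (gluePre_eq h1 (f := g) h3 h4 rfl rfl (N.res_smul a y ν) ?_).symm
      rw [N.res_smul, hy, one_smul]

/-- The semi-Mackey functor underlying the box product. -/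
noncomputable def toSemiMackey (M N : TModule k) : SemiMackey G where
  obj := Box M N
  res := res
  tr := tr
  res_id {X} a := by
    induction a using ind with | h Y f m n => _
    rw [res_mk (p := Map.id Y) (q := f)
      (IsPullback.mk' (fun _ => rfl) (fun y _ e => ⟨y, rfl, e⟩) (fun _ _ e _ => e)),
      M.res_id, N.res_id]
  res_comp {X Y Z} g f a := by
    induction a using ind with | h V c m n => _
    obtain ⟨W, p, q, h⟩ := exists_isPullback c g
    obtain ⟨W', p', q', h'⟩ := exists_isPullback q f
    rw [res_mk h, res_mk h', res_mk (h.paste h'), M.res_comp, N.res_comp]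
  tr_id a := by
    induction a using ind with | h Y f m n => _
    rfl
  tr_comp g f a := by
    induction a using ind with | h Y f m n => _
    rfl
  res_tr {W X Y Z p q f g} h a := by
    induction a using ind with | h V c m n => _
    obtain ⟨V', p', q', h'⟩ := exists_isPullback c p
    rw [tr_mk, res_mk h', tr_mk, res_mk (p := p') (q := q.comp q')]
    exact (h.symm.paste h'.symm).symm
  nonempty_of_isEmpty X _ := ⟨mk (Map.id X) 0 0⟩
  subsingleton_of_isEmpty X _ := ⟨fun a b => by
    induction a using ind with | h Y f m n => _
    induction b using ind with | h Y' f' m' n' => _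
    have hY : IsEmpty Y := ⟨fun y => isEmptyElim (f y)⟩
    have hY' : IsEmpty Y' := ⟨fun y => isEmptyElim (f' y)⟩
    have := M.subsingleton_of_isEmpty Y
    have := N.subsingleton_of_isEmpty Y
    rw [← mk_iso (ofEmpty Y Y') ⟨fun y => isEmptyElim y, fun y => isEmptyElim y⟩ f' m' n',
      Subsingleton.elim m (M.res (ofEmpty Y Y') m'), Subsingleton.elim n (N.res (ofEmpty Y Y') n'),
      show f = f'.comp (ofEmpty Y Y') from Map.ext' fun y => isEmptyElim y]⟩
  bijective_of_isCoprod {X Y Z i j} h := by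
    let glue : Box M N X → Box M N Y → Box M N Z := Quot.lift₂ (gluePre i j)
      (fun s t t' ht => by
        rw [gluePre_comm, gluePre_comm i j]
        exact gluePre_rel j i s ht)
      (fun s s' t hs => gluePre_rel i j t hs)
    refine Function.bijective_iff_has_inverse.2 ⟨fun c => glue c.1 c.2, fun a => ?_, fun ⟨a, b⟩ => ?_⟩
    · induction a using ind with | h V f m n => _
      obtain ⟨V₁, p₁, q₁, h₁⟩ := exists_isPullback f i
      obtain ⟨V₂, p₂, q₂, h₂⟩ := exists_isPullback f j
      simp only [res_mk h₁, res_mk h₂]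
      exact gluePre_eq (h.pullback h₁ h₂) h₁.comm h₂.comm rfl rfl rfl rfl
    · induction a using ind with | h V₁ f₁ m₁ n₁ => _
      induction b using ind with | h V₂ f₂ m₂ n₂ => _
      obtain ⟨V, a, b, h'⟩ := exists_isCoprod V₁ V₂
      obtain ⟨f, h1, h2⟩ := h'.desc (i.comp f₁) (j.comp f₂)
      obtain ⟨m, rfl, rfl⟩ := M.exists_pair h' m₁ m₂
      obtain ⟨n, rfl, rfl⟩ := N.exists_pair h' n₁ n₂
      have e : glue (mk f₁ (M.res a m) (N.res a n)) (mk f₂ (M.res b m) (N.res b n)) = mk f m n :=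
        gluePre_eq h' h1 h2 rfl rfl rfl rfl
      refine Prod.ext ?_ ?_
      · exact (congrArg (res i) e).trans (res_mk (h.isPullback h' h1 h2) m n)
      · exact (congrArg (res j) e).trans (res_mk (h.symm.isPullback h'.symm h2 h1) m n)

/-- Multiplication by scalars on symbols. -/
def smul (a : k.obj X) : Box M N X → Box M N X :=
  Quot.map (fun s => ⟨s.Y, s.f, k.res s.f a • s.m, s.n⟩) (by
    rintro _ _ (⟨f, h, m, n⟩ | ⟨f, h, m, n⟩ | ⟨f, b, m, n⟩)
    · have := BoxRel.tr_left (N := N) f h (k.res (f.comp h) a • m) n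
      rw [k.res_comp, M.tr_res_smul] at this
      simpa only [k.res_comp] using this
    · have := BoxRel.tr_right (M := M) f h (k.res f a • m) n
      rwa [M.res_smul, ← k.res_comp] at this
    · have := BoxRel.smul (N := N) f b (k.res f a • m) n
      rwa [smul_comm] at this)

theorem smul_mk (a : k.obj X) (f : Map Y X) (m : M.obj Y) (n : N.obj Y) :
    smul a (mk f m n : Box M N X) = mk f (k.res f a • m) n := rfl

theorem tr_smul_tr (g : Map X Z) (a : k.obj Z) (s : Box M N X) :
    tr g (smul (k.res g a) s) = smul a (tr g s) := by
  induction s using ind with | h Y f m n => _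
  rw [smul_mk, tr_mk, tr_mk, smul_mk, k.res_comp]

theorem res_smul (g : Map Z X) (a : k.obj X) (s : Box M N X) :
    res g (smul a s) = smul (k.res g a) (res g s) := by
  induction s using ind with | h Y f m n => _
  obtain ⟨V, p, q, h⟩ := exists_isPullback f g
  rw [smul_mk, res_mk h, res_mk h, smul_mk, M.res_smul, ← k.res_comp, ← k.res_comp,
    Map.ext' (f := f.comp p) (g := g.comp q) h.comm]

theorem tr_smul_res (g : Map Z X) (a : k.obj Z) (s : Box M N X) :
    tr g (smul a (res g s)) = smul (k.tr g a) s := by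
  induction s using ind with | h Y f m n => _
  obtain ⟨V, p, q, h⟩ := exists_isPullback f g
  rw [res_mk h, smul_mk, tr_mk, smul_mk, k.res_tr h.symm, ← M.tr_smul_res, mk_tr_left,
    Map.ext' (f := f.comp p) (g := g.comp q) h.comm]

theorem exists_add (s t : Box M N X) : ∃ (Z : FinGSet G) (i j : Map X Z) (g : Map Z X)
    (z : Box M N Z), IsCoprod i j ∧ (∀ x, g (i x) = x) ∧ (∀ x, g (j x) = x) ∧
    res i z = s ∧ res j z = t ∧ (toSemiMackey M N).add s t = tr g z := by
  obtain ⟨-, Z, i, j, g, z, h, h1, h2, rfl, rfl, -⟩ := (toSemiMackey M N).exists_add s t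
  exact ⟨Z, i, j, g, z, h, h1, h2, rfl, rfl, (toSemiMackey M N).add_eq h h1 h2 z⟩

theorem tr_eq_add {i : Map X Z} {j : Map Y Z} (h : IsCoprod i j) (g : Map Z W) (z : Box M N Z) :
    tr g z = (toSemiMackey M N).add (tr (g.comp i) (res i z)) (tr (g.comp j) (res j z)) :=
  (toSemiMackey M N).tr_eq_add h g z

theorem tr_ofEmpty (E : FinGSet G) [IsEmpty E] (f : Map E X) (a : Box M N E) :
    tr f a = (toSemiMackey M N).zero X := (toSemiMackey M N).tr_of_isEmpty E f a

theorem smul_add' (a : k.obj X) (s t : Box M N X) : smul a ((toSemiMackey M N).add s t) =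
    (toSemiMackey M N).add (smul a s) (smul a t) := by
  obtain ⟨Z, i, j, g, z, h, h1, h2, rfl, rfl, e⟩ := exists_add s t
  have e1 : smul a (res i z) = res i (smul (k.res g a) z) := by
    rw [res_smul, ← k.res_comp, Map.ext' (f := g.comp i) (g := Map.id X) h1, k.res_id]
  have e2 : smul a (res j z) = res j (smul (k.res g a) z) := by
    rw [res_smul, ← k.res_comp, Map.ext' (f := g.comp j) (g := Map.id X) h2, k.res_id]
  rw [e, ← tr_smul_tr, e1, e2]
  exact ((toSemiMackey M N).add_eq h h1 h2 _).symm

/-- Additivity in the first variable. -/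
theorem mk_add_left (f : Map Y X) (m m' : M.obj Y) (n : N.obj Y) :
    (mk f (m + m') n : Box M N X) = (toSemiMackey M N).add (mk f m n) (mk f m' n) := by
  obtain ⟨Z, i, j, g, μ, h, h1, h2, rfl, rfl, e⟩ := M.exists_add m m'
  have e' : ∀ (i : Map Y Z), (∀ y, g (i y) = y) → res i
      (mk (Map.id Z) μ (N.res g n) : Box M N Z) = mk (Map.id Y) (M.res i μ) n := fun i hi => by
    rw [res_mk (p := i) (q := Map.id Y)
      (IsPullback.mk' (fun _ => rfl) (fun z y e => ⟨y, e.symm, rfl⟩) (fun _ _ _ e => e)),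
      ← N.res_comp, Map.ext' (f := g.comp i) (g := Map.id Y) hi, N.res_id]
  rw [← e, mk_tr_left, show (mk (f.comp g) μ (N.res g n) : Box M N X) =
    tr (f.comp g) (mk (Map.id Z) μ (N.res g n)) from rfl, tr_eq_add h, e' i h1, e' j h2, tr_mk,
    tr_mk, Map.ext' (f := ((f.comp g).comp i).comp (Map.id Y)) (g := f) fun x => by simp [h1],
    Map.ext' (f := ((f.comp g).comp j).comp (Map.id Y)) (g := f) fun x => by simp [h2]]

theorem mk_zero_left (f : Map Y X) (n : N.obj Y) :
    (mk f 0 n : Box M N X) = (toSemiMackey M N).zero X := by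
  obtain ⟨E, hE⟩ := exists_empty G
  rw [← _root_.map_zero (M.tr (ofEmpty E Y)), mk_tr_left]
  exact tr_ofEmpty E (f.comp (ofEmpty E Y)) (mk (Map.id E) 0 (N.res (ofEmpty E Y) n))

noncomputable instance : Zero (Box M N X) := ⟨(toSemiMackey M N).zero X⟩

noncomputable instance : Add (Box M N X) := ⟨(toSemiMackey M N).add⟩

noncomputable instance : Neg (Box M N X) := ⟨smul (-1)⟩

noncomputable instance : AddCommGroup (Box M N X) where
  nsmul := nsmulRec
  zsmul := zsmulRec
  add_assoc := (toSemiMackey M N).add_assoc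
  add_comm := (toSemiMackey M N).add_comm
  add_zero := (toSemiMackey M N).add_zero
  zero_add a := ((toSemiMackey M N).add_comm _ _).trans ((toSemiMackey M N).add_zero a)
  neg_add_cancel a := by
    change (toSemiMackey M N).add (smul (-1) a) a = (toSemiMackey M N).zero X
    induction a using ind with | h Y f m n => _
    rw [smul_mk, ← mk_add_left, _root_.map_neg, map_one, neg_smul, one_smul, neg_add_cancel,
      mk_zero_left]

noncomputable instance : Module (k.obj X) (Box M N X) where
  smul := smul
  one_smul a := by
    change smul 1 a = a
    induction a using ind with | h Y f m n => _
    rw [smul_mk, map_one, one_smul]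
  mul_smul a b s := by
    change smul (a * b) s = smul a (smul b s)
    induction s using ind with | h Y f m n => _
    rw [smul_mk, smul_mk, smul_mk, map_mul, mul_smul]
  smul_add a s t := smul_add' a s t
  smul_zero a := by
    change smul a ((toSemiMackey M N).zero X) = (toSemiMackey M N).zero X
    obtain ⟨E, hE⟩ := exists_empty G
    rw [← mk_zero_left (Map.id X) (0 : N.obj X), smul_mk, _root_.smul_zero]
  add_smul a b s := by
    change smul (a + b) s = (toSemiMackey M N).add (smul a s) (smul b s)
    induction s using ind with | h Y f m n => _
    rw [smul_mk, smul_mk, smul_mk, map_add, add_smul, mk_add_left]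
  zero_smul s := by
    change smul 0 s = (toSemiMackey M N).zero X
    induction s using ind with | h Y f m n => _
    rw [smul_mk, map_zero, zero_smul, mk_zero_left]

end Box

/-- The box product `M ⊠_k N` of two `k`-modules. -/
noncomputable def TModule.box : TModule k where
  obj := Box M N
  res f := ⟨⟨Box.res f, (Box.toSemiMackey M N).res_zero f⟩, (Box.toSemiMackey M N).res_add f⟩
  tr f := ⟨⟨Box.tr f, (Box.toSemiMackey M N).tr_zero f⟩, (Box.toSemiMackey M N).tr_add f⟩
  res_id := (Box.toSemiMackey M N).res_id
  res_comp := (Box.toSemiMackey M N).res_comp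
  tr_id := (Box.toSemiMackey M N).tr_id
  tr_comp := (Box.toSemiMackey M N).tr_comp
  res_tr := (Box.toSemiMackey M N).res_tr
  res_smul := Box.res_smul
  tr_res_smul := Box.tr_smul_tr
  tr_smul_res := Box.tr_smul_res
  subsingleton_of_isEmpty X := (Box.toSemiMackey M N).subsingleton_of_isEmpty X
  bijective_of_isCoprod := (Box.toSemiMackey M N).bijective_of_isCoprod

/-- The functor `M ⊠_k -` on morphisms. -/
noncomputable def TModule.boxMap {N N' : TModule k} (η : TModule.Hom N N') :
    TModule.Hom (M.box N) (M.box N') :=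
  let F : ∀ X, Box M N X → Box M N' X := fun X =>
    Quot.map (fun s => ⟨s.Y, s.f, s.m, η.app _ s.n⟩) (by
      rintro _ _ (⟨f, h, m, n⟩ | ⟨f, h, m, n⟩ | ⟨f, b, m, n⟩)
      · have := BoxRel.tr_left f h m (η.app _ n)
        rwa [← η.app_res] at this
      · have := BoxRel.tr_right f h m (η.app _ n)
        rwa [← η.app_tr] at this
      · have := BoxRel.smul f b m (η.app _ n)
        rwa [← map_smul] at this)
  have hres : ∀ {X Y : FinGSet G} (g : Map X Y) (s : Box M N Y),
      F X (Box.res g s) = Box.res g (F Y s) := fun {X Y} g s => by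
    induction s using Box.ind with | h V f m n => _
    obtain ⟨V, p, q, h⟩ := exists_isPullback f g
    rw [Box.res_mk h]
    refine Eq.trans ?_ (Box.res_mk h m (η.app _ n)).symm
    rw [← η.app_res]
    rfl
  have htr : ∀ {X Y : FinGSet G} (g : Map X Y) (s : Box M N X),
      F Y (Box.tr g s) = Box.tr g (F X s) := fun g s => by
    induction s using Box.ind with | h V f m n => _
    rfl
  { app := fun X =>
      { toFun := F X
        map_add' := (Box.toSemiMackey M N).map_add (Box.toSemiMackey M N') F hres htr
        map_smul' := fun a s => by
          induction s using Box.ind with | h V f m n => _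
          rfl }
    app_res := hres
    app_tr := htr }

end Box

/-- A `k`-module `M` is flat if the functor `M ⊠_k -` is exact, that is to say, if it preserves all
exact sequences `A → B → C`.  (Exactness of sequences of modules is tested levelwise.) -/
def TModule.IsFlat {k : Tambara.{w} G} (M : TModule k) : Prop :=
  ∀ (A B C : TModule k) (α : TModule.Hom A B) (β : TModule.Hom B C),
    (∀ X, Function.Exact (α.app X) (β.app X)) →
    ∀ X, Function.Exact ((M.boxMap α).app X) ((M.boxMap β).app X)

/-! ## The box product of algebras -/

namespace Tambara

section BoxAlgebra

variable {k R L : Tambara.{w} G} (φ : Hom k R) (ψ : Hom k L)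

/-- The values of the box product `R ⊠_k L`: those of the box product of the underlying modules. -/
abbrev BoxAlg (X : FinGSet G) : Type (max u w) := Box (TModule.ofAlgebra φ) (TModule.ofAlgebra ψ) X

variable {φ ψ} {X Y Z W : FinGSet G}

/-- The symbol `tr_f (r ⊗ l)`. -/
def tmk (f : Map Y X) (r : R.obj Y) (l : L.obj Y) : BoxAlg φ ψ X :=
  Box.mk (M := TModule.ofAlgebra φ) (N := TModule.ofAlgebra ψ) f r l

theorem tmk_ind {P : BoxAlg φ ψ X → Prop}
    (h : ∀ (Y : FinGSet G) (f : Map Y X) r l, P (tmk f r l)) (s : BoxAlg φ ψ X) : P s := Box.ind h s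

theorem tmk_tr_left (f : Map Y X) (h : Map W Y) (r : R.obj W) (l : L.obj Y) :
    (tmk f (R.tr h r) l : BoxAlg φ ψ X) = tmk (f.comp h) r (L.res h l) :=
  Box.mk_tr_left (M := TModule.ofAlgebra φ) (N := TModule.ofAlgebra ψ) f h r l

theorem tmk_tr_right (f : Map Y X) (h : Map W Y) (r : R.obj Y) (l : L.obj W) :
    (tmk f r (L.tr h l) : BoxAlg φ ψ X) = tmk (f.comp h) (R.res h r) l :=
  Box.mk_tr_right (M := TModule.ofAlgebra φ) (N := TModule.ofAlgebra ψ) f h r l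

theorem tmk_smul (f : Map Y X) (a : k.obj Y) (r : R.obj Y) (l : L.obj Y) :
    (tmk f (φ.app Y a * r) l : BoxAlg φ ψ X) = tmk f r (ψ.app Y a * l) :=
  Box.mk_smul (M := TModule.ofAlgebra φ) (N := TModule.ofAlgebra ψ) f a r l

theorem tmk_iso (c : Map W Y) (hc : Function.Bijective c.toFun) (f : Map Y X) (r : R.obj Y)
    (l : L.obj Y) : (tmk (f.comp c) (R.res c r) (L.res c l) : BoxAlg φ ψ X) = tmk f r l :=
  Box.mk_iso (M := TModule.ofAlgebra φ) (N := TModule.ofAlgebra ψ) c hc f r l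

theorem tr_tmk (g : Map X Z) (f : Map Y X) (r : R.obj Y) (l : L.obj Y) :
    Box.tr g (tmk f r l : BoxAlg φ ψ X) = tmk (g.comp f) r l := rfl

theorem res_tmk {V : FinGSet G} {f : Map Y X} {g : Map Z X} {p : Map V Y} {q : Map V Z}
    (h : IsPullback p q f g) (r : R.obj Y) (l : L.obj Y) :
    Box.res g (tmk f r l : BoxAlg φ ψ X) = tmk q (R.res p r) (L.res p l) :=
  Box.res_mk (M := TModule.ofAlgebra φ) (N := TModule.ofAlgebra ψ) h r l

theorem tmk_unique {f : Map Y X} {g : Map X Z} {P Q P' Q' : FinGSet G} {e : Map P Y} {p : Map P Q}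
    {q : Map Q Z} (H : IsExponential f g e p q) {e' : Map P' Y} {p' : Map P' Q'} {q' : Map Q' Z}
    (H' : IsExponential f g e' p' q') (r : R.obj Y) (l : L.obj Y) :
    (tmk q (R.nm p (R.res e r)) (L.nm p (L.res e l)) : BoxAlg φ ψ Z) =
      tmk q' (R.nm p' (R.res e' r)) (L.nm p' (L.res e' l)) := by
  obtain ⟨c, d, hc, h1, h2, h3⟩ := H.unique H'
  rw [← tmk_iso c hc, R.res_nm h3, L.res_nm h3, ← R.res_comp, ← L.res_comp,
    Map.ext' (f := e.comp d) (g := e') h2, Map.ext' (f := q.comp c) (g := q') h1]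

theorem exists_nm (g : Map X Z) (Y : FinGSet G) (f : Map Y X) (r : R.obj Y) (l : L.obj Y) :
    ∃ t : BoxAlg φ ψ Z, ∃ (P Q : FinGSet G) (e : Map P Y) (p : Map P Q) (q : Map Q Z),
      IsExponential f g e p q ∧ tmk q (R.nm p (R.res e r)) (L.nm p (L.res e l)) = t := by
  obtain ⟨P, Q, e, p, q, h⟩ := exists_isExponential f g
  exact ⟨_, P, Q, e, p, q, h, rfl⟩

/-- The norm of a symbol: `nm_g (tr_f (r ⊗ l)) = tr_q (nm_p res_e r ⊗ nm_p res_e l)` for an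
exponential diagram. -/
noncomputable def nmPre (g : Map X Z) (Y : FinGSet G) (f : Map Y X) (r : R.obj Y) (l : L.obj Y) :
    BoxAlg φ ψ Z := (exists_nm g Y f r l).choose

theorem nmPre_eq {f : Map Y X} {g : Map X Z} {P Q : FinGSet G} {e : Map P Y} {p : Map P Q}
    {q : Map Q Z} (H : IsExponential f g e p q) (r : R.obj Y) (l : L.obj Y) :
    (nmPre g Y f r l : BoxAlg φ ψ Z) = tmk q (R.nm p (R.res e r)) (L.nm p (L.res e l)) := by
  obtain ⟨P', Q', e', p', q', H', h⟩ := (exists_nm (φ := φ) (ψ := ψ) g Y f r l).choose_spec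
  rw [nmPre, ← h]
  exact tmk_unique H' H r l

theorem nmPre_tr_left (g : Map X Z) (f : Map Y X) (h : Map W Y) (r : R.obj W) (l : L.obj Y) :
    (nmPre g Y f (R.tr h r) l : BoxAlg φ ψ Z) = nmPre g W (f.comp h) r (L.res h l) := by
  obtain ⟨P, Q, e, p, q, H⟩ := exists_isExponential f g
  obtain ⟨V, e', h', hV⟩ := exists_isPullback h e
  obtain ⟨P₂, Q₂, e₂, p₂, q₂, H₂⟩ := exists_isExponential h' p
  obtain ⟨H₃, h₃⟩ := H.vert hV H₂
  rw [nmPre_eq H, nmPre_eq H₃, R.res_tr hV, R.nm_tr H₂, tmk_tr_left, L.res_nm h₃, ← R.res_comp,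
    ← L.res_comp, ← L.res_comp,
    Map.ext' (f := e.comp (h'.comp e₂)) (g := h.comp (e'.comp e₂)) fun v => (hV.comm _).symm]

theorem nmPre_tr_right (g : Map X Z) (f : Map Y X) (h : Map W Y) (r : R.obj Y) (l : L.obj W) :
    (nmPre g Y f r (L.tr h l) : BoxAlg φ ψ Z) = nmPre g W (f.comp h) (R.res h r) l := by
  obtain ⟨P, Q, e, p, q, H⟩ := exists_isExponential f g
  obtain ⟨V, e', h', hV⟩ := exists_isPullback h e
  obtain ⟨P₂, Q₂, e₂, p₂, q₂, H₂⟩ := exists_isExponential h' p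
  obtain ⟨H₃, h₃⟩ := H.vert hV H₂
  rw [nmPre_eq H, nmPre_eq H₃, L.res_tr hV, L.nm_tr H₂, tmk_tr_right, R.res_nm h₃, ← L.res_comp,
    ← R.res_comp, ← R.res_comp,
    Map.ext' (f := e.comp (h'.comp e₂)) (g := h.comp (e'.comp e₂)) fun v => (hV.comm _).symm]

theorem nmPre_smul (g : Map X Z) (f : Map Y X) (a : k.obj Y) (r : R.obj Y) (l : L.obj Y) :
    (nmPre g Y f (φ.app Y a * r) l : BoxAlg φ ψ Z) = nmPre g Y f r (ψ.app Y a * l) := by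
  obtain ⟨P, Q, e, p, q, H⟩ := exists_isExponential f g
  rw [nmPre_eq H, nmPre_eq H, map_mul, map_mul, map_mul, map_mul, ← φ.app_res, ← φ.app_nm,
    ← ψ.app_res, ← ψ.app_nm, tmk_smul]

/-- Norms in the box product of algebras. -/
noncomputable def boxNm (g : Map X Z) : BoxAlg φ ψ X → BoxAlg φ ψ Z :=
  Quot.lift (fun s => nmPre g s.Y s.f s.m s.n) (by
    rintro _ _ (⟨f, h, m, n⟩ | ⟨f, h, m, n⟩ | ⟨f, a, m, n⟩)
    · exact nmPre_tr_left g f h m n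
    · exact nmPre_tr_right g f h m n
    · exact nmPre_smul g f a m n)

theorem boxNm_tmk {f : Map Y X} {g : Map X Z} {P Q : FinGSet G} {e : Map P Y} {p : Map P Q}
    {q : Map Q Z} (H : IsExponential f g e p q) (r : R.obj Y) (l : L.obj Y) :
    boxNm g (tmk f r l : BoxAlg φ ψ X) = tmk q (R.nm p (R.res e r)) (L.nm p (L.res e l)) :=
  nmPre_eq H r l

variable (φ ψ)

/-- The semi-Tambara functor underlying the box product of algebras. -/
noncomputable def boxSemi : SemiTambara G where
  toSemiMackey := Box.toSemiMackey (TModule.ofAlgebra φ) (TModule.ofAlgebra ψ)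
  nm := boxNm
  nm_id {X} a := by
    induction a using tmk_ind with | h Y f r l => _
    rw [boxNm_tmk (IsExponential.id f), R.res_id, R.nm_id, L.res_id, L.nm_id]
  nm_comp {X Y Z} g f a := by
    induction a using tmk_ind with | h V c r l => _
    obtain ⟨P, Q, e, p, q, H⟩ := exists_isExponential c f
    obtain ⟨P₁, Q₁, e₁, p₁, q₁, H₁⟩ := exists_isExponential q g
    obtain ⟨V, a, b, hV⟩ := exists_isPullback p e₁
    rw [boxNm_tmk (H.horiz H₁ hV), boxNm_tmk H, boxNm_tmk H₁, R.res_nm hV, L.res_nm hV, R.nm_comp,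
      L.nm_comp, R.res_comp, L.res_comp]
  res_nm {W X Y Z p q f g} h a := by
    induction a using tmk_ind with | h V c r l => _
    obtain ⟨P, Q, e, p₁, q₁, H⟩ := exists_isExponential c f
    obtain ⟨V', kV, c', hV⟩ := exists_isPullback c p
    obtain ⟨Q', kQ, q', hQ⟩ := exists_isPullback q₁ g
    obtain ⟨P', kP, p', hP⟩ := exists_isPullback p₁ kQ
    obtain ⟨e', he, H'⟩ := H.base h hV hQ hP
    have h1 : Box.res g (boxNm f (tmk c r l : BoxAlg φ ψ X)) =
        boxNm q (Box.res p (tmk c r l : BoxAlg φ ψ X)) := by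
      rw [boxNm_tmk H, res_tmk hQ, res_tmk hV, boxNm_tmk H', R.res_nm hP, L.res_nm hP,
        ← R.res_comp, ← L.res_comp, ← R.res_comp, ← L.res_comp,
        Map.ext' (f := kV.comp e') (g := e.comp kP) he]
    exact h1
  nm_tr {A X Y P Q h f e p q} H a := by
    induction a using tmk_ind with | h B c r l => _
    obtain ⟨W, e', k', hW⟩ := exists_isPullback c e
    obtain ⟨P₂, Q₂, e₂, p₂, q₂, H₂⟩ := exists_isExponential k' p
    have h1 : boxNm f (Box.tr h (tmk c r l : BoxAlg φ ψ A)) =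
        Box.tr q (boxNm p (Box.res e (tmk c r l : BoxAlg φ ψ A))) := by
      rw [tr_tmk, boxNm_tmk (H.vert hW H₂).1, res_tmk hW, boxNm_tmk H₂, tr_tmk, R.res_comp,
        L.res_comp]
    exact h1

noncomputable instance (X : FinGSet G) : CommRing (BoxAlg φ ψ X) :=
  (boxSemi φ ψ).commRing X (inferInstanceAs (AddCommGroup (BoxAlg φ ψ X))) (fun _ _ => rfl) rfl

/-- The box product `R ⊠_k L` of two `k`-algebras.  Its underlying `k`-module is the box product of
the underlying modules, and its multiplication and norms are characterized by
`nm_g (tr_f (r ⊗ l)) = tr_q (nm_p res_e r ⊗ nm_p res_e l)` for exponential diagrams, where the product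
of two elements is the norm along a fold map of the corresponding element over `X ⊔ X`. -/
noncomputable def box : Tambara.{w} G where
  obj := BoxAlg φ ψ
  res f :=
    { toFun := Box.res f
      map_one' := (boxSemi φ ψ).mulSM.res_zero f
      map_mul' := (boxSemi φ ψ).mulSM.res_add f
      map_zero' := (boxSemi φ ψ).res_zero f
      map_add' := (boxSemi φ ψ).res_add f }
  tr f :=
    { toFun := Box.tr f
      map_zero' := (boxSemi φ ψ).tr_zero f
      map_add' := (boxSemi φ ψ).tr_add f }
  nm f :=
    { toFun := boxNm f
      map_one' := (boxSemi φ ψ).mulSM.tr_zero f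
      map_mul' := (boxSemi φ ψ).mulSM.tr_add f }
  res_id := (boxSemi φ ψ).res_id
  res_comp := (boxSemi φ ψ).res_comp
  tr_id := (boxSemi φ ψ).tr_id
  tr_comp := (boxSemi φ ψ).tr_comp
  nm_id := (boxSemi φ ψ).nm_id
  nm_comp := (boxSemi φ ψ).nm_comp
  res_tr := (boxSemi φ ψ).res_tr
  res_nm := (boxSemi φ ψ).res_nm
  tr_mul_res := (boxSemi φ ψ).tr_mul_res
  nm_tr := (boxSemi φ ψ).nm_tr
  subsingleton_of_isEmpty X := (boxSemi φ ψ).subsingleton_of_isEmpty X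
  bijective_of_isCoprod := (boxSemi φ ψ).bijective_of_isCoprod

/-- The morphism `R → R ⊠_k L`, `r ↦ r ⊗ 1`. -/
noncomputable def inl : Hom R (box φ ψ) :=
  homMk (fun X (r : R.obj X) => (tmk (Map.id X) r 1 : BoxAlg φ ψ X))
    (fun {X Y} f r => by
      refine Eq.trans ?_ (res_tmk (p := f) (q := Map.id X) (IsPullback.symm (IsPullback.mk'
        (fun _ => rfl) (fun x y e => ⟨x, rfl, e⟩) (fun _ _ e _ => e))) r 1).symm
      rw [map_one])
    (fun {X Y} f r => by
      rw [tmk_tr_left, map_one]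
      rfl)
    (fun {X Y} f r => by
      refine Eq.trans ?_ (boxNm_tmk (IsExponential.of_id f) r 1).symm
      rw [map_one, map_one, R.res_id])

/-- The morphism `L → R ⊠_k L`, `l ↦ 1 ⊗ l`. -/
noncomputable def inr : Hom L (box φ ψ) :=
  homMk (fun X (l : L.obj X) => (tmk (Map.id X) 1 l : BoxAlg φ ψ X))
    (fun {X Y} f r => by
      refine Eq.trans ?_ (res_tmk (p := f) (q := Map.id X) (IsPullback.symm (IsPullback.mk'
        (fun _ => rfl) (fun x y e => ⟨x, rfl, e⟩) (fun _ _ e _ => e))) 1 r).symm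
      rw [map_one])
    (fun {X Y} f r => by
      rw [tmk_tr_right, map_one]
      rfl)
    (fun {X Y} f r => by
      refine Eq.trans ?_ (boxNm_tmk (IsExponential.of_id f) 1 r).symm
      rw [map_one, map_one, L.res_id])

variable {φ ψ}

theorem desc_aux {T : Tambara.{w} G} (α : Hom R T) (β : Hom L T) (h : α.comp φ = β.comp ψ) :
    (∀ {X Y W : FinGSet G} (f : Map Y X) (g : Map W Y) (r : R.obj W) (l : L.obj Y),
      T.tr f (α.app _ (R.tr g r) * β.app _ l) =
        T.tr (f.comp g) (α.app _ r * β.app _ (L.res g l))) ∧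
    (∀ {X Y W : FinGSet G} (f : Map Y X) (g : Map W Y) (r : R.obj Y) (l : L.obj W),
      T.tr f (α.app _ r * β.app _ (L.tr g l)) =
        T.tr (f.comp g) (α.app _ (R.res g r) * β.app _ l)) ∧
    ∀ {X Y : FinGSet G} (f : Map Y X) (a : k.obj Y) (r : R.obj Y) (l : L.obj Y),
      T.tr f (α.app _ (φ.app _ a * r) * β.app _ l) =
        T.tr f (α.app _ r * β.app _ (ψ.app _ a * l)) := by
  refine ⟨fun f g r l => ?_, fun f g r l => ?_, fun {X Y} f a r l => ?_⟩
  · rw [α.app_tr, β.app_res, T.tr_comp, T.tr_mul_res]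
  · rw [β.app_tr, α.app_res, T.tr_comp, mul_comm, mul_comm (T.res g _), T.tr_mul_res]
  · have key : α.app Y (φ.app Y a) = β.app Y (ψ.app Y a) :=
      congrArg (fun η : Hom k T => η.app Y a) h
    rw [map_mul (α.app Y), map_mul (β.app Y), key]
    congr 1
    ring

/-- The morphism `R ⊠_k L → T`, `r ⊗ l ↦ α r * β l`, induced by morphisms of `k`-algebras. -/
noncomputable def desc {T : Tambara.{w} G} (α : Hom R T) (β : Hom L T) (h : α.comp φ = β.comp ψ) :
    Hom (box φ ψ) T :=
  let F : ∀ X, BoxAlg φ ψ X → T.obj X := fun X =>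
    Quot.lift (fun s => T.tr s.f (α.app s.Y s.m * β.app s.Y s.n)) (by
      rintro _ _ (⟨f, g, m, n⟩ | ⟨f, g, m, n⟩ | ⟨f, a, m, n⟩)
      · exact (desc_aux α β h).1 f g m n
      · exact (desc_aux α β h).2.1 f g m n
      · exact (desc_aux α β h).2.2 f a m n)
  have hF : ∀ {X Y : FinGSet G} (f : Map Y X) (r : R.obj Y) (l : L.obj Y),
    F X (tmk f r l) = T.tr f (α.app Y r * β.app Y l) := fun _ _ _ => rfl
  homMk F
    (fun {X Y} g a => by
      induction a using tmk_ind with | h V f r l => _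
      obtain ⟨V, p, q, hp⟩ := exists_isPullback f g
      refine (congrArg (F X) (res_tmk hp r l)).trans ?_
      rw [hF, hF, T.res_tr hp, map_mul (T.res p), α.app_res, β.app_res])
    (fun {X Y} g a => by
      induction a using tmk_ind with | h V f r l => _
      refine (hF (g.comp f) r l).trans ?_
      rw [hF, T.tr_comp])
    (fun {X Y} g a => by
      induction a using tmk_ind with | h V f r l => _
      obtain ⟨P, Q, e, p, q, H⟩ := exists_isExponential f g
      refine (congrArg (F Y) (boxNm_tmk H r l)).trans ?_
      rw [hF, hF, T.nm_tr H, map_mul (T.res e), map_mul (T.nm p), α.app_nm, β.app_nm, α.app_res, β.app_res])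

variable (φ ψ)

/-- The base change along `ψ : k → L` of the `k`-algebra `φ : k → R`: the `L`-algebra `R ⊠_k L`. -/
noncomputable def baseChange : Hom L (box φ ψ) := inr φ ψ

/-- The multiplication `R ⊠_k R → R`. -/
noncomputable def multiplication : Hom (box φ φ) R := desc (Hom.id R) (Hom.id R) rfl

end BoxAlgebra

/-! ## Tambara ideals and genuine Kähler differentials -/

/-- A Tambara ideal: ideals of the rings `R.obj X` closed under restrictions, transfers, and norms
along surjective maps. -/
@[ext]
structure TIdeal (R : Tambara.{w} G) where
  carrier (X : FinGSet G) : Ideal (R.obj X)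
  res_mem {X Y : FinGSet G} (f : Map X Y) {a : R.obj Y} (ha : a ∈ carrier Y) :
    R.res f a ∈ carrier X
  tr_mem {X Y : FinGSet G} (f : Map X Y) {a : R.obj X} (ha : a ∈ carrier X) : R.tr f a ∈ carrier Y
  nm_mem {X Y : FinGSet G} (f : Map X Y) (hf : Function.Surjective f.toFun) {a : R.obj X}
    (ha : a ∈ carrier X) : R.nm f a ∈ carrier Y

/-- The kernel of a morphism. -/
def Hom.ker {R S : Tambara.{w} G} (φ : Hom R S) : TIdeal R where
  carrier X := RingHom.ker (φ.app X)
  res_mem f a ha := by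
    rw [RingHom.mem_ker] at ha ⊢
    rw [φ.app_res, ha, map_zero]
  tr_mem f a ha := by
    rw [RingHom.mem_ker] at ha ⊢
    rw [φ.app_tr, ha, map_zero]
  nm_mem f hf a ha := by
    rw [RingHom.mem_ker] at ha ⊢
    rw [φ.app_nm, ha, S.nm_zero f hf]

/-- A finite `G`-set is an orbit if it is isomorphic to some `G/H`, i.e. nonempty and transitive. -/
def IsOrbit (X : FinGSet G) : Prop := Nonempty X ∧ MulAction.IsPretransitive G X

/-- `J` contains all nontrivial norms of elements of `I`: all products of two elements of `I`, and all
norms of elements of `I` along noninvertible maps of orbits, that is to say, along maps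
`G/K → G/H` with `K` conjugate to a proper subgroup of `H`. -/
structure TIdeal.ContainsNorms {R : Tambara.{w} G} (I J : TIdeal R) : Prop where
  mul_mem {X : FinGSet G} {a b : R.obj X} (ha : a ∈ I.carrier X) (hb : b ∈ I.carrier X) :
    a * b ∈ J.carrier X
  nm_mem {X Y : FinGSet G} (hX : IsOrbit X) (hY : IsOrbit Y) (f : Map X Y)
    (hf : ¬ Function.Bijective f.toFun) {a : R.obj X} (ha : a ∈ I.carrier X) : R.nm f a ∈ J.carrier Y

/-- The ideal `I^{>1}` generated by all nontrivial norms of elements of `I`. -/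
def TIdeal.gtOne {R : Tambara.{w} G} (I : TIdeal R) : TIdeal R where
  carrier X := ⨅ J : {J : TIdeal R // I.ContainsNorms J}, J.1.carrier X
  res_mem f a ha := by
    rw [Submodule.mem_iInf] at ha ⊢
    exact fun J => J.1.res_mem f (ha J)
  tr_mem f a ha := by
    rw [Submodule.mem_iInf] at ha ⊢
    exact fun J => J.1.tr_mem f (ha J)
  nm_mem f hf a ha := by
    rw [Submodule.mem_iInf] at ha ⊢
    exact fun J => J.1.nm_mem f hf (ha J)

namespace TIdeal

variable {R : Tambara.{w} G} (I J : TIdeal R)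

/-- The elements of `J` among those of `I`. -/
def sub (X : FinGSet G) : Submodule (R.obj X) (I.carrier X) :=
  Submodule.comap (I.carrier X).subtype (J.carrier X)

theorem eq_tr_add {X Y Z : FinGSet G} {i : Map X Z} {j : Map Y Z} (h : IsCoprod i j)
    (a : R.obj X) (b : R.obj Y) : R.res i (R.tr i a + R.tr j b) = a ∧
      R.res j (R.tr i a + R.tr j b) = b := by
  obtain ⟨E, hE⟩ := exists_empty G
  have := R.subsingleton_of_isEmpty E
  constructor
  · rw [map_add, R.res_tr (IsPullback.of_injective i fun _ _ => h.inl_inj), R.res_id, R.tr_id,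
      R.res_tr (h.isPullback_empty E).symm, Subsingleton.elim (R.res _ b) 0, map_zero, add_zero]
  · rw [map_add, R.res_tr (IsPullback.of_injective j fun _ _ => h.inr_inj), R.res_id, R.tr_id,
      R.res_tr (h.isPullback_empty E), Subsingleton.elim (R.res _ a) 0, map_zero, zero_add]

/-- The quotient `R`-module `I / (I ∩ J)` of two ideals; this is `I / J` if `J` is contained in `I`. -/
def quot : TModule R where
  obj X := I.carrier X ⧸ sub I J X
  res {X Y} f := QuotientAddGroup.map (sub I J Y).toAddSubgroup (sub I J X).toAddSubgroup
    (((R.res f).toAddMonoidHom.comp (I.carrier Y).subtype.toAddMonoidHom).codRestrict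
      (I.carrier X).toAddSubgroup fun a => I.res_mem f a.2) (fun _ ha => J.res_mem f ha)
  tr {X Y} f := QuotientAddGroup.map (sub I J X).toAddSubgroup (sub I J Y).toAddSubgroup
    (((R.tr f).comp (I.carrier X).subtype.toAddMonoidHom).codRestrict
      (I.carrier Y).toAddSubgroup fun a => I.tr_mem f a.2) (fun _ ha => J.tr_mem f ha)
  res_id a := by
    obtain ⟨a, rfl⟩ := Submodule.Quotient.mk_surjective _ a
    exact congrArg Submodule.Quotient.mk (Subtype.ext (R.res_id a.1))
  res_comp g f a := by
    obtain ⟨a, rfl⟩ := Submodule.Quotient.mk_surjective _ a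
    exact congrArg Submodule.Quotient.mk (Subtype.ext (R.res_comp g f a.1))
  tr_id a := by
    obtain ⟨a, rfl⟩ := Submodule.Quotient.mk_surjective _ a
    exact congrArg Submodule.Quotient.mk (Subtype.ext (R.tr_id a.1))
  tr_comp g f a := by
    obtain ⟨a, rfl⟩ := Submodule.Quotient.mk_surjective _ a
    exact congrArg Submodule.Quotient.mk (Subtype.ext (R.tr_comp g f a.1))
  res_tr h a := by
    obtain ⟨a, rfl⟩ := Submodule.Quotient.mk_surjective _ a
    exact congrArg Submodule.Quotient.mk (Subtype.ext (R.res_tr h a.1))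
  res_smul f a m := by
    obtain ⟨m, rfl⟩ := Submodule.Quotient.mk_surjective _ m
    exact congrArg Submodule.Quotient.mk (Subtype.ext (map_mul (R.res f) a m.1))
  tr_res_smul f a m := by
    obtain ⟨m, rfl⟩ := Submodule.Quotient.mk_surjective _ m
    exact congrArg Submodule.Quotient.mk (Subtype.ext ((TModule.self R).tr_res_smul f a m.1))
  tr_smul_res f a m := by
    obtain ⟨m, rfl⟩ := Submodule.Quotient.mk_surjective _ m
    exact congrArg Submodule.Quotient.mk (Subtype.ext ((TModule.self R).tr_smul_res f a m.1))
  subsingleton_of_isEmpty X _ := by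
    have := R.subsingleton_of_isEmpty X
    exact ⟨fun a b => by
      obtain ⟨a, rfl⟩ := Submodule.Quotient.mk_surjective _ a
      obtain ⟨b, rfl⟩ := Submodule.Quotient.mk_surjective _ b
      exact congrArg _ (Subtype.ext (Subsingleton.elim _ _))⟩
  bijective_of_isCoprod {X Y Z i j} h := by
    constructor
    · intro a b hab
      obtain ⟨a, rfl⟩ := Submodule.Quotient.mk_surjective _ a
      obtain ⟨b, rfl⟩ := Submodule.Quotient.mk_surjective _ b
      obtain ⟨h1, h2⟩ := Prod.ext_iff.1 hab
      have h1 : R.res i a.1 - R.res i b.1 ∈ J.carrier X :=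
        (Submodule.Quotient.eq (sub I J X)).1 h1
      have h2 : R.res j a.1 - R.res j b.1 ∈ J.carrier Y :=
        (Submodule.Quotient.eq (sub I J Y)).1 h2
      rw [← map_sub] at h1 h2
      refine (Submodule.Quotient.eq _).2 ?_
      change a.1 - b.1 ∈ J.carrier Z
      have e := eq_tr_add h (R.res i (a.1 - b.1)) (R.res j (a.1 - b.1))
      rw [← (R.bijective_of_isCoprod h).1 (Prod.ext e.1 e.2)]
      exact add_mem (J.tr_mem i h1) (J.tr_mem j h2)
    · rintro ⟨a, b⟩
      obtain ⟨a, rfl⟩ := Submodule.Quotient.mk_surjective _ a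
      obtain ⟨b, rfl⟩ := Submodule.Quotient.mk_surjective _ b
      have e := eq_tr_add h a.1 b.1
      exact ⟨Submodule.Quotient.mk ⟨R.tr i a.1 + R.tr j b.1,
        add_mem (I.tr_mem i a.2) (I.tr_mem j b.2)⟩, Prod.ext
        (congrArg Submodule.Quotient.mk (Subtype.ext e.1))
        (congrArg Submodule.Quotient.mk (Subtype.ext e.2))⟩

end TIdeal

variable {k R : Tambara.{w} G}

/-- The genuine Kähler differentials `Ω_{R/k} = I / I^{>1}`, where `I` is the kernel of the
multiplication `R ⊠_k R → R`; the `R`-module structure is through the left factor of `R ⊠_k R`. -/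
noncomputable def kaehler (φ : Hom k R) : TModule R :=
  ((multiplication φ).ker.quot (multiplication φ).ker.gtOne).restrictScalars (inl φ φ)

/-- A module is zero if all its values are zero. -/
def _root_.TModule.IsZero (M : TModule k) : Prop := ∀ X, Subsingleton (M.obj X)

/-! ## Flat, finitely presented and étale morphisms -/

/-- `R` is flat over `k`: the underlying `k`-module of `R` is flat. -/
def IsFlat (φ : Hom k R) : Prop := (TModule.ofAlgebra φ).IsFlat

/-- `A`, with the elements `x i` of `A.obj (X i)`, is the free polynomial `k`-algebra on generators
`x i` in levels `X i`: a morphism of `k`-algebras from `A` to any `k`-algebra `S` is the same as a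
family of elements of `S.obj (X i)`. -/
def IsFreeAlgebra {ι : Type} {A : Tambara.{w} G} (α : Hom k A) (X : ι → FinGSet G)
    (x : ∀ i, A.obj (X i)) : Prop :=
  ∀ (S : Tambara.{w} G) (σ : Hom k S) (s : ∀ i, S.obj (X i)),
    ∃! η : Hom A S, η.comp α = σ ∧ ∀ i, η.app (X i) (x i) = s i

/-- `α` is a free polynomial `k`-algebra on finitely many generators. -/
def IsFinitelyGeneratedFree {A : Tambara.{w} G} (α : Hom k A) : Prop :=
  ∃ (n : ℕ) (X : Fin n → FinGSet G) (x : ∀ i, A.obj (X i)), IsFreeAlgebra α X x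

/-- The morphism `c : B → R` of `k`-algebras is a coequalizer of `a, b : A → B` in the category of
`k`-algebras, where the algebra structures are `β : k → B` and `φ : k → R`. -/
def IsAlgebraCoequalizer {A B : Tambara.{w} G} (β : Hom k B) (φ : Hom k R) (a b : Hom A B)
    (c : Hom B R) : Prop :=
  c.comp a = c.comp b ∧ c.comp β = φ ∧
    ∀ (S : Tambara.{w} G) (σ : Hom k S) (d : Hom B S), d.comp β = σ → d.comp a = d.comp b →
      ∃! η : Hom R S, η.comp φ = σ ∧ η.comp c = d

/-- The `k`-algebra `R` is finitely presented: it is a coequalizer of two morphisms between free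
polynomial `k`-algebras on finitely many generators. -/
def IsFinitelyPresented (φ : Hom k R) : Prop :=
  ∃ (A B : Tambara.{w} G) (α : Hom k A) (β : Hom k B) (a b : Hom A B) (c : Hom B R),
    IsFinitelyGeneratedFree α ∧ IsFinitelyGeneratedFree β ∧ a.comp α = β ∧ b.comp α = β ∧
      IsAlgebraCoequalizer β φ a b c

/-- A morphism `k → R` is formally étale if `R` is flat over `k` and `Ω_{R/k} = 0`. -/
def IsFormallyEtale (φ : Hom k R) : Prop := (kaehler φ).IsZero ∧ IsFlat φ

/-- A morphism `k → R` is étale if it is formally étale and finitely presented. -/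
def IsEtale (φ : Hom k R) : Prop := IsFormallyEtale φ ∧ IsFinitelyPresented φ

end Tambara

end TambaraFunctors

section BaseChange

open FinGSet

variable {G : Type u} [Group G]

namespace Tambara

variable {k R L : Tambara.{w} G}

/-! For algebras, base change along `k → L` is a pushout of Tambara functors; for modules, it
cancels in an iterated box product as it does for tensor products over rings. Everything rests on a
normal form. The product in `R ⊠_k L` is defined as a norm along a fold map, and computing that norm
shows that `(r ⊗ 1) (1 ⊗ l)` is the symbol `r ⊗ l` (`inl_mul_inr`). So every element is a transfer
`tr_f ((r ⊗ 1) (1 ⊗ l))` (`box_ind`), and a morphism out of `R ⊠_k L` is determined by its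
restrictions to `R` and `L` (`box_hom_ext`). Together with `desc` and `inl_comp` this is the
universal property of the pushout.

Finite presentation: by that property, an `L`-algebra morphism `R ⊠_k L → S` is the same as a
`k`-algebra morphism `R → S`. Thus base change behaves as a left adjoint. It carries free algebras
to free algebras on generators in the same levels, and coequalizers to coequalizers.

Differentials: with `I` the kernel of multiplication, `Ω = 0` means `I ≤ I^{>1}`. A Tambara ideal
containing all `r ⊗ 1 - 1 ⊗ r` contains `I` (`ker_multiplication_le`), so only these differences
need testing. For `y = tr_f (r ⊗ b)` in the base change, the difference attached to `y` is the
transfer of a multiple of the image of `r ⊗ 1 - 1 ⊗ r` under `R ⊠_k R → (R ⊠_k L) ⊠_L (R ⊠_k L)`: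
the factor `b` comes from `L` and is the same on both sides. This morphism respects the kernels of
multiplication, hence also the ideals of nontrivial norms (`TIdeal.map_gtOne`).

Flatness: there is a bijection `(R ⊠_k L) ⊠_L N ≃ R ⊠_k N`, natural in the `L`-module `N`
(`cancelBaseChange`). So tensoring over `L` with the base change amounts to restricting scalars to
`k`, which does not affect levelwise exactness, and then tensoring with `R`. -/

theorem Hom.comp_app_apply {T : Tambara.{w} G} (η : Hom R T) (φ : Hom k R) {X : FinGSet G}
    (a : k.obj X) : (η.comp φ).app X a = η.app X (φ.app X a) := rfl

/-- The sum in the multiplicative semi-Mackey functor is a norm along a fold map by construction,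
and `mul_eq` identifies it with the ring product. This holds in every Tambara functor, so it can be
used in `R`, `L` and `R ⊠_k L` alike. -/
theorem nm_fold (k : Tambara.{w} G) {X Z : FinGSet G} {i j : Map X Z} (h : IsCoprod i j)
    {t : Map Z X} (h1 : ∀ x, t (i x) = x) (h2 : ∀ x, t (j x) = x) (a : k.obj Z) :
    k.nm t a = k.res i a * k.res j a :=
  (k.toSemiTambara.mulSM.add_eq h h1 h2 a).symm.trans (k.mul_eq (k.res i a) (k.res j a)).1

variable (φ : Hom k R) (ψ : Hom k L)

/-- The pair `(r ⊗ 1, 1 ⊗ l)` over `X ⊔ X` is a single symbol `a ⊗ b`, with `a = (r, 1)` and `b =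
(1, l)`. Its norm along the fold map is taken factor by factor, which gives `(r * 1) ⊗ (1 * l)`. -/
theorem inl_mul_inr {X : FinGSet G} (r : R.obj X) (l : L.obj X) :
    (inl φ ψ).app X r * (inr φ ψ).app X l = (tmk (Map.id X) r l : BoxAlg φ ψ X) := by
  obtain ⟨Z, i, j, h⟩ := exists_isCoprod X X
  obtain ⟨t, h1, h2⟩ := h.desc (Map.id X) (Map.id X)
  obtain ⟨a, ha1, ha2⟩ := R.exists_pair h r 1
  obtain ⟨b, hb1, hb2⟩ := L.exists_pair h 1 l
  have e := (box φ ψ).nm_fold h h1 h2 (tmk (Map.id Z) a b : BoxAlg φ ψ Z)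
  have e1 : (box φ ψ).res i (tmk (Map.id Z) a b : BoxAlg φ ψ Z) = (inl φ ψ).app X r := by
    refine (res_tmk (IsPullback.refl i) a b).trans ?_
    rw [ha1, hb1]; rfl
  have e2 : (box φ ψ).res j (tmk (Map.id Z) a b : BoxAlg φ ψ Z) = (inr φ ψ).app X l := by
    refine (res_tmk (IsPullback.refl j) a b).trans ?_
    rw [ha2, hb2]; rfl
  rw [e1, e2] at e
  rw [← e]
  -- The symbol `a ⊗ b` is carried by an identity map, whose dependent product along `t` is again an
  -- identity map. Hence no transfer appears, and the norm is `nm_t a ⊗ nm_t b`.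
  refine (boxNm_tmk (IsExponential.of_id t) a b).trans ?_
  rw [R.res_id, L.res_id, R.nm_fold h h1 h2, L.nm_fold h h1 h2, ha1, ha2, hb1, hb2, mul_one,
    one_mul]

/-- This trades symbols for expressions in the ring structure, the transfer and the two structure
morphisms, so that later arguments can use ring homomorphisms and Frobenius reciprocity instead of
representatives. -/
theorem tmk_eq_tr {X Y : FinGSet G} (f : Map Y X) (r : R.obj Y) (l : L.obj Y) :
    (tmk f r l : BoxAlg φ ψ X) =
      (box φ ψ).tr f ((inl φ ψ).app Y r * (inr φ ψ).app Y l) := by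
  rw [inl_mul_inr]
  rfl

/-- Every element of `R ⊠_k L` is of the form `tr_f ((r ⊗ 1) (1 ⊗ l))`. -/
theorem box_ind {X : FinGSet G} {P : (box φ ψ).obj X → Prop}
    (h : ∀ (Y : FinGSet G) (f : Map Y X) (r : R.obj Y) (l : L.obj Y),
      P ((box φ ψ).tr f ((inl φ ψ).app Y r * (inr φ ψ).app Y l)))
    (s : (box φ ψ).obj X) : P s := by
  refine tmk_ind (P := P) (fun Y f r l => ?_) s
  rw [tmk_eq_tr]
  exact h Y f r l

/-- Frobenius reciprocity brings `1 ⊗ a` inside the transfer, where it multiplies the `L`-factor.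
This describes the `L`-module structure of the base change on the normal form. -/
theorem inr_mul_tr {X Y : FinGSet G} (a : L.obj X) (f : Map Y X) (r : R.obj Y) (l : L.obj Y) :
    (inr φ ψ).app X a * (box φ ψ).tr f ((inl φ ψ).app Y r * (inr φ ψ).app Y l) =
      (box φ ψ).tr f ((inl φ ψ).app Y r * (inr φ ψ).app Y (L.res f a * l)) := by
  rw [mul_comm, ← (box φ ψ).tr_mul_res, map_mul ((inr φ ψ).app Y), ← (inr φ ψ).app_res, mul_assoc,
    mul_comm ((inr φ ψ).app Y l)]

/-- Morphisms commute with transfers and products, and by `box_ind` every element is a transfer of a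
product of an element from `R` and one from `L`. This is the uniqueness half of the universal
property. -/
theorem box_hom_ext {T : Tambara.{w} G} {η η' : Hom (box φ ψ) T}
    (hl : η.comp (inl φ ψ) = η'.comp (inl φ ψ)) (hr : η.comp (inr φ ψ) = η'.comp (inr φ ψ)) :
    η = η' := by
  refine Hom.ext (funext fun X => RingHom.ext fun s => ?_)
  induction s using box_ind with | h Y f r l => _
  have h1 : η.app Y ((inl φ ψ).app Y r) = η'.app Y ((inl φ ψ).app Y r) :=
    congrArg (fun ζ : Hom R T => ζ.app Y r) hl
  have h2 : η.app Y ((inr φ ψ).app Y l) = η'.app Y ((inr φ ψ).app Y l) :=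
    congrArg (fun ζ : Hom L T => ζ.app Y l) hr
  rw [η.app_tr, η'.app_tr, map_mul (η.app Y), map_mul (η'.app Y), h1, h2]

variable {φ ψ}

theorem desc_tmk {T : Tambara.{w} G} (α : Hom R T) (β : Hom L T) (h : α.comp φ = β.comp ψ)
    {X Y : FinGSet G} (f : Map Y X) (r : R.obj Y) (l : L.obj Y) :
    (desc α β h).app X (tmk f r l : BoxAlg φ ψ X) = T.tr f (α.app Y r * β.app Y l) := rfl

/-- Since `desc` sends `tr_f (r ⊗ l)` to `tr_f (α r * β l)`, the value at `r ⊗ 1` over an identity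
map is `α r`. With `desc_comp_inr` this is the existence half of the universal property. -/
theorem desc_comp_inl {T : Tambara.{w} G} (α : Hom R T) (β : Hom L T)
    (h : α.comp φ = β.comp ψ) : (desc α β h).comp (inl φ ψ) = α := by
  refine Hom.ext (funext fun X => RingHom.ext fun r => ?_)
  refine (desc_tmk α β h (Map.id X) r 1).trans ?_
  rw [map_one, mul_one, T.tr_id]

theorem desc_comp_inr {T : Tambara.{w} G} (α : Hom R T) (β : Hom L T)
    (h : α.comp φ = β.comp ψ) : (desc α β h).comp (inr φ ψ) = β := by
  refine Hom.ext (funext fun X => RingHom.ext fun l => ?_)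
  refine (desc_tmk α β h (Map.id X) 1 l).trans ?_
  rw [map_one, one_mul, T.tr_id]

variable (φ ψ)

/-- The two morphisms `k → R ⊠_k L` agree. -/
theorem inl_comp : (inl φ ψ).comp φ = (inr φ ψ).comp ψ := by
  refine Hom.ext (funext fun X => RingHom.ext fun a => ?_)
  -- With both entries equal to `1`, `k`-bilinearity reads `φ a ⊗ 1 = 1 ⊗ ψ a`.
  have h := tmk_smul (φ := φ) (ψ := ψ) (Map.id X) a 1 1
  rw [mul_one, mul_one] at h
  exact h

/-! ### Finite presentation -/

variable {φ}

/-- The morphism `A ⊠_k L → B ⊠_k L` induced by a morphism `A → B` of `k`-algebras. -/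
noncomputable def baseChangeMap {A B : Tambara.{w} G} {α : Hom k A} {β : Hom k B} (a : Hom A B)
    (h : a.comp α = β) : Hom (box α ψ) (box β ψ) :=
  desc ((inl β ψ).comp a) (inr β ψ) (by subst h; exact inl_comp (a.comp α) ψ)

theorem baseChangeMap_comp_inl {A B : Tambara.{w} G} {α : Hom k A} {β : Hom k B} (a : Hom A B)
    (h : a.comp α = β) :
    (baseChangeMap ψ a h).comp (inl α ψ) = (inl β ψ).comp a := desc_comp_inl _ _ _

theorem baseChangeMap_comp_inr {A B : Tambara.{w} G} {α : Hom k A} {β : Hom k B} (a : Hom A B)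
    (h : a.comp α = β) :
    (baseChangeMap ψ a h).comp (inr α ψ) = inr β ψ := desc_comp_inr _ _ _

/-- An `L`-algebra morphism `R ⊠_k L → S` corresponds to a `k`-algebra morphism `R → S`, where `S`
is a `k`-algebra through `σ ∘ ψ`. By freeness of `R` the latter is a family of elements of `S`,
namely the values at the generators `x i ⊗ 1`. -/
theorem IsFreeAlgebra.baseChange {ι : Type} {X : ι → FinGSet G} {x : ∀ i, R.obj (X i)}
    (h : IsFreeAlgebra φ X x) :
    IsFreeAlgebra (baseChange φ ψ) X (fun i => (inl φ ψ).app (X i) (x i)) := by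
  intro S σ s
  obtain ⟨η, ⟨h1, h2⟩, hu⟩ := h S (σ.comp ψ) s
  refine ⟨desc η σ h1, ⟨desc_comp_inr _ _ _, fun i => ?_⟩, fun ζ ⟨h3, h4⟩ => ?_⟩
  · exact (congrArg (fun ζ : Hom R S => ζ.app (X i) (x i)) (desc_comp_inl η σ h1)).trans (h2 i)
  · refine box_hom_ext φ ψ ?_ (h3.trans (desc_comp_inr _ _ _).symm)
    rw [desc_comp_inl]
    refine hu _ ⟨?_, h4⟩
    -- The restriction of `ζ` to `R` is a `k`-algebra morphism because `ζ ∘ inl ∘ φ = ζ ∘ inr ∘ ψ =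
    -- σ ∘ ψ`.
    exact (congrArg ζ.comp (inl_comp φ ψ)).trans (congrArg (fun τ : Hom L S => τ.comp ψ) h3)

theorem IsFinitelyGeneratedFree.baseChange (h : IsFinitelyGeneratedFree φ) :
    IsFinitelyGeneratedFree (baseChange φ ψ) := by
  obtain ⟨n, X, x, h⟩ := h
  exact ⟨n, X, _, h.baseChange ψ⟩

/-- This is preservation of colimits by a left adjoint, written out. A cocone `d` under the
base-changed pair restricts along `B → B ⊠_k L` to a cocone under `a, b`. The factorization through
`R` obtained there is then extended to `R ⊠_k L` by `σ` on `L`. -/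
theorem IsAlgebraCoequalizer.baseChange {A B : Tambara.{w} G} {α : Hom k A} {β : Hom k B}
    {a b : Hom A B} {c : Hom B R} (ha : a.comp α = β) (hb : b.comp α = β) (hc : c.comp β = φ)
    (h : IsAlgebraCoequalizer β φ a b c) :
    IsAlgebraCoequalizer (baseChange β ψ) (baseChange φ ψ) (baseChangeMap ψ a ha)
      (baseChangeMap ψ b hb) (baseChangeMap ψ c hc) := by
  obtain ⟨h1, -, h3⟩ := h
  -- The two legs of `d ∘ (a ⊠ L)`: on `A` it is the restriction of `d` to `B` composed with `a`,
  -- while on `L` it does not depend on `a`. Hence the equation for the base-changed pair carries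
  -- the same information as the equation for `a` and `b`.
  have key : ∀ {S : Tambara.{w} G} (d : Hom (box β ψ) S) (a : Hom A B) (ha : a.comp α = β),
      (d.comp (baseChangeMap ψ a ha)).comp (inl α ψ) = (d.comp (inl β ψ)).comp a ∧
      (d.comp (baseChangeMap ψ a ha)).comp (inr α ψ) = d.comp (inr β ψ) := fun d a ha =>
    ⟨congrArg d.comp (baseChangeMap_comp_inl ψ a ha),
      congrArg d.comp (baseChangeMap_comp_inr ψ a ha)⟩
  refine ⟨box_hom_ext α ψ ?_ ?_, baseChangeMap_comp_inr ψ c hc, fun S σ d hd hab => ?_⟩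
  · rw [(key _ a ha).1, (key _ b hb).1, baseChangeMap_comp_inl]
    exact congrArg (inl φ ψ).comp h1
  · rw [(key _ a ha).2, (key _ b hb).2]
  · have hd' : d.comp (inr β ψ) = σ := hd
    obtain ⟨η, ⟨h4, h5⟩, hu⟩ := h3 S (σ.comp ψ) (d.comp (inl β ψ))
      ((congrArg d.comp (inl_comp β ψ)).trans (congrArg (fun τ : Hom L S => τ.comp ψ) hd'))
      (by rw [← (key d a ha).1, ← (key d b hb).1, hab])
    -- The equation `h4 : η ∘ φ = σ ∘ ψ` is exactly the compatibility that `desc` requires to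
    -- combine `η` and `σ`.
    refine ⟨desc η σ h4, ⟨desc_comp_inr _ _ _, box_hom_ext β ψ ?_ ?_⟩, fun ζ ⟨h6, h7⟩ => ?_⟩
    · have e := congrArg (desc η σ h4).comp (baseChangeMap_comp_inl ψ c hc)
      refine e.trans ?_
      exact (congrArg (fun τ : Hom R S => τ.comp c) (desc_comp_inl η σ h4)).trans h5
    · have e := congrArg (desc η σ h4).comp (baseChangeMap_comp_inr ψ c hc)
      exact (e.trans (desc_comp_inr η σ h4)).trans hd'.symm
    · refine box_hom_ext φ ψ ?_ (h6.trans (desc_comp_inr _ _ _).symm)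
      rw [desc_comp_inl]
      refine hu _ ⟨?_, ?_⟩
      · exact (congrArg ζ.comp (inl_comp φ ψ)).trans (congrArg (fun τ : Hom L S => τ.comp ψ) h6)
      · rw [← h7]
        exact (congrArg ζ.comp (baseChangeMap_comp_inl ψ c hc)).symm

theorem IsFinitelyPresented.baseChange (h : IsFinitelyPresented φ) :
    IsFinitelyPresented (baseChange φ ψ) := by
  obtain ⟨A, B, α, β, a, b, c, hα, hβ, ha, hb, hc⟩ := h
  exact ⟨_, _, _, _, _, _, _, hα.baseChange ψ, hβ.baseChange ψ, baseChangeMap_comp_inr ψ a ha,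
    baseChangeMap_comp_inr ψ b hb, hc.baseChange ψ ha hb hc.2.1⟩

/-! ### Kähler differentials -/

/-- The preimage of a Tambara ideal. -/
def TIdeal.comap (θ : Hom R L) (J : TIdeal L) : TIdeal R where
  carrier X := (J.carrier X).comap (θ.app X)
  res_mem f a ha := by
    rw [Ideal.mem_comap] at ha ⊢
    rw [θ.app_res]
    exact J.res_mem f ha
  tr_mem f a ha := by
    rw [Ideal.mem_comap] at ha ⊢
    rw [θ.app_tr]
    exact J.tr_mem f ha
  nm_mem f hf a ha := by
    rw [Ideal.mem_comap] at ha ⊢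
    rw [θ.app_nm]
    exact J.nm_mem f hf ha

theorem TIdeal.containsNorms_gtOne (I : TIdeal R) : I.ContainsNorms I.gtOne where
  mul_mem ha hb := (Submodule.mem_iInf _).2 fun J => J.2.mul_mem ha hb
  nm_mem hX hY f hf _ ha := (Submodule.mem_iInf _).2 fun J => J.2.nm_mem hX hY f hf ha

/-- `θ` maps `I^{>1}` to `J^{>1}` if it maps `I` to `J`. -/
theorem TIdeal.map_gtOne {θ : Hom R L} {I : TIdeal R} {J : TIdeal L}
    (h : ∀ X, ∀ a ∈ I.carrier X, θ.app X a ∈ J.carrier X) {X : FinGSet G} {a : R.obj X}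
    (ha : a ∈ I.gtOne.carrier X) : θ.app X a ∈ J.gtOne.carrier X := by
  -- The ideal `I^{>1}` is the intersection of all Tambara ideals containing the nontrivial norms of
  -- `I`, and the preimage of `J^{>1}` is one of these.
  refine (Submodule.mem_iInf _).1 ha ⟨J.gtOne.comap θ, ?_, ?_⟩
  · intro X a b ha hb
    rw [comap, Ideal.mem_comap, map_mul]
    exact J.containsNorms_gtOne.mul_mem (h X a ha) (h X b hb)
  · intro X Y hX hY f hf a ha
    rw [comap, Ideal.mem_comap, θ.app_nm]
    exact J.containsNorms_gtOne.nm_mem hX hY f hf (h X a ha)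

/-- Restriction of scalars leaves the underlying quotient unchanged, and that quotient is formed as
`I / (I ∩ I^{>1})`. It vanishes exactly when `I ≤ I^{>1}`. -/
theorem kaehler_isZero_iff (φ : Hom k R) : (kaehler φ).IsZero ↔
    ∀ X, (multiplication φ).ker.carrier X ≤ (multiplication φ).ker.gtOne.carrier X := by
  refine forall_congr' fun X => ?_
  change Subsingleton (_ ⧸ TIdeal.sub (multiplication φ).ker (multiplication φ).ker.gtOne X) ↔ _
  rw [Submodule.Quotient.subsingleton_iff, TIdeal.sub, Submodule.comap_subtype_eq_top]

theorem multiplication_inl (φ : Hom k R) {X : FinGSet G} (r : R.obj X) :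
    (multiplication φ).app X ((inl φ φ).app X r) = r :=
  congrArg (fun η : Hom R R => η.app X r) (desc_comp_inl (Hom.id R) (Hom.id R) rfl)

theorem multiplication_inr (φ : Hom k R) {X : FinGSet G} (r : R.obj X) :
    (multiplication φ).app X ((inr φ φ).app X r) = r :=
  congrArg (fun η : Hom R R => η.app X r) (desc_comp_inr (Hom.id R) (Hom.id R) rfl)

/-- A Tambara ideal containing all differences `r ⊗ 1 - 1 ⊗ r` contains the kernel of the
multiplication. -/
theorem ker_multiplication_le (φ : Hom k R) (J : TIdeal (box φ φ))
    (h : ∀ (X : FinGSet G) (r : R.obj X), (inl φ φ).app X r - (inr φ φ).app X r ∈ J.carrier X)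
    (X : FinGSet G) : (multiplication φ).ker.carrier X ≤ J.carrier X := by
  intro x hx
  -- Modulo `J`, every `x` is congruent to `μ(x) ⊗ 1`, where `μ` is the multiplication. For `x =
  -- tr_f (y ⊗ z)` the difference is `tr_f ((y ⊗ 1) (z ⊗ 1 - 1 ⊗ z))`. If `μ(x) = 0`, then `-x`, and
  -- so `x`, lies in `J`.
  have key : ∀ x : (box φ φ).obj X,
      (inl φ φ).app X ((multiplication φ).app X x) - x ∈ J.carrier X := fun x => by
    induction x using box_ind with | h Y f y z => _
    rw [(multiplication φ).app_tr, map_mul, multiplication_inl, multiplication_inr,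
      (inl φ φ).app_tr, ← map_sub, map_mul, ← mul_sub]
    exact J.tr_mem f (Ideal.mul_mem_left _ _ (h Y z))
  have hx' : (multiplication φ).app X x = 0 := hx
  have := key x
  rw [hx', map_zero, zero_sub] at this
  exact neg_mem_iff.1 this

/-- Base change preserves vanishing of the differentials, for arbitrary `k → L`: being a quotient of
the kernel of the multiplication, which is generated by the differences `r ⊗ 1 - 1 ⊗ r`, the
differentials are right exact, so no flatness is needed. -/
theorem kaehler_baseChange_isZero (h : (kaehler φ).IsZero) :
    (kaehler (baseChange φ ψ)).IsZero := by
  rw [kaehler_isZero_iff] at h ⊢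
  let χ : Hom L (box φ ψ) := baseChange φ ψ
  -- On `k` both composites factor through `L`, whose two maps into `(R ⊠_k L) ⊠_L (R ⊠_k L)`
  -- coincide. This allows the definition of `θ`, which sends `r ⊗ r'` to `(r ⊗ 1) ⊗ (r' ⊗ 1)`.
  have hφ : ((inl χ χ).comp (inl φ ψ)).comp φ = ((inr χ χ).comp (inl φ ψ)).comp φ :=
    (congrArg (inl χ χ).comp (inl_comp φ ψ)).trans ((congrArg (fun η : Hom L (box χ χ) => η.comp ψ)
      (inl_comp χ χ)).trans (congrArg (inr χ χ).comp (inl_comp φ ψ)).symm)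
  let θ : Hom (box φ φ) (box χ χ) := desc ((inl χ χ).comp (inl φ ψ)) ((inr χ χ).comp (inl φ ψ)) hφ
  have hθl : ∀ (X : FinGSet G) (r : R.obj X), θ.app X ((inl φ φ).app X r) =
      (inl χ χ).app X ((inl φ ψ).app X r) := fun X r =>
    congrArg (fun η : Hom R (box χ χ) => η.app X r) (desc_comp_inl _ _ hφ)
  have hθr : ∀ (X : FinGSet G) (r : R.obj X), θ.app X ((inr φ φ).app X r) =
      (inr χ χ).app X ((inl φ ψ).app X r) := fun X r =>
    congrArg (fun η : Hom R (box χ χ) => η.app X r) (desc_comp_inr _ _ hφ)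
  have hχ : ∀ (X : FinGSet G) (b : L.obj X), (inl χ χ).app X ((inr φ ψ).app X b) =
      (inr χ χ).app X ((inr φ ψ).app X b) := fun X b =>
    congrArg (fun η : Hom L (box χ χ) => η.app X b) (inl_comp χ χ)
  -- The morphism `θ` lies over `R → R ⊠_k L` with respect to the two multiplications, so it carries
  -- the kernel of one into the kernel of the other.
  have hm : (multiplication χ).comp θ = (inl φ ψ).comp (multiplication φ) := by
    refine box_hom_ext φ φ ?_ ?_ <;> refine Hom.ext (funext fun X => RingHom.ext fun r => ?_)
    · simp only [Hom.comp_app_apply, hθl, multiplication_inl]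
    · simp only [Hom.comp_app_apply, hθr, multiplication_inr]
  have hker : ∀ X, ∀ a ∈ (multiplication φ).ker.carrier X,
      θ.app X a ∈ (multiplication χ).ker.carrier X := fun X a ha => by
    have e : (multiplication χ).app X (θ.app X a) =
      (inl φ ψ).app X ((multiplication φ).app X a) :=
      congrArg (fun η : Hom (box φ φ) (box φ ψ) => η.app X a) hm
    have ha' : (multiplication φ).app X a = 0 := ha
    change (multiplication χ).app X (θ.app X a) = 0
    rw [e, ha', map_zero]
  -- It remains to treat `y ⊗ 1 - 1 ⊗ y` for `y = tr_f ((r ⊗ 1) (1 ⊗ b))`. By `hχ` the factor from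
  -- `b` is common to both terms, so the difference is `tr_f (θ (r ⊗ 1 - 1 ⊗ r) * b)`.
  refine ker_multiplication_le χ _ fun X y => ?_
  induction y using box_ind with | h Y f r b => _
  rw [(inl χ χ).app_tr, (inr χ χ).app_tr, ← map_sub, map_mul, map_mul, hχ, ← sub_mul, ← hθl,
    ← hθr, ← map_sub]
  -- The transfer and the factor `b` are absorbed by the ideal. The element `r ⊗ 1 - 1 ⊗ r` lies in
  -- the kernel of the multiplication of `R`, hence in its `I^{>1}` by `h`, and `θ` carries it to
  -- the corresponding ideal upstairs.
  refine TIdeal.tr_mem _ f (Ideal.mul_mem_right _ _ (TIdeal.map_gtOne hker (h Y ?_)))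
  change (multiplication φ).app Y _ = 0
  rw [map_sub, multiplication_inl, multiplication_inr, sub_self]

/-! ### Flatness -/

section Flat

/-- Restriction of scalars on morphisms of modules. -/
def _root_.TModule.Hom.restrictScalars {M N : TModule L} (η : TModule.Hom M N) :
    TModule.Hom (M.restrictScalars ψ) (N.restrictScalars ψ) where
  app X :=
    { toFun := η.app X
      map_add' := map_add (η.app X)
      map_smul' := fun a (m : M.obj X) => map_smul (η.app X) (ψ.app X a) m }
  app_res := η.app_res
  app_tr := η.app_tr

/-! ### Symbols of `R ⊠_k N` for an `L`-module `N` -/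

variable {ψ} {N : TModule L} {X Y Z W : FinGSet G}

/-- The symbol `tr_f (r ⊗ n)` of `R ⊠_k N`, for an `L`-module `N`. -/
def symb (f : Map Y X) (r : R.obj Y) (n : N.obj Y) :
    Box (TModule.ofAlgebra φ) (N.restrictScalars ψ) X :=
  Box.mk (M := TModule.ofAlgebra φ) (N := N.restrictScalars ψ) f r n

/-- This lemma and the next two are the defining relations of the box product, with the `k`-actions
on the restricted modules displayed as `φ a * r` and `ψ a • n`, so that rewriting can use the
structures of `R`, `L` and `N` directly. -/
theorem symb_tr_left (f : Map Y X) (h : Map W Y) (r : R.obj W) (n : N.obj Y) :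
    (symb f (R.tr h r) n : Box (TModule.ofAlgebra φ) (N.restrictScalars ψ) X) =
      symb (f.comp h) r (N.res h n) :=
  Box.mk_tr_left (M := TModule.ofAlgebra φ) (N := N.restrictScalars ψ) f h r n

theorem symb_tr_right (f : Map Y X) (h : Map W Y) (r : R.obj Y) (n : N.obj W) :
    (symb f r (N.tr h n) : Box (TModule.ofAlgebra φ) (N.restrictScalars ψ) X) =
      symb (f.comp h) (R.res h r) n :=
  Box.mk_tr_right (M := TModule.ofAlgebra φ) (N := N.restrictScalars ψ) f h r n

theorem symb_smul (f : Map Y X) (a : k.obj Y) (r : R.obj Y) (n : N.obj Y) :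
    (symb f (φ.app Y a * r) n : Box (TModule.ofAlgebra φ) (N.restrictScalars ψ) X) =
      symb f r (ψ.app Y a • n) :=
  Box.mk_smul (M := TModule.ofAlgebra φ) (N := N.restrictScalars ψ) f a r n

theorem tr_symb (g : Map X Z) (f : Map Y X) (r : R.obj Y) (n : N.obj Y) :
    Box.tr g (symb f r n : Box (TModule.ofAlgebra φ) (N.restrictScalars ψ) X) =
      symb (g.comp f) r n := rfl

/-! ### The action map and the cancellation of base change -/

variable (φ ψ)

/-- These are the three relations defining `R ⊠_k L`, applied to `r ⊗ l ↦ r ⊗ l • res_f n`. In the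
second one, the projection formula `tr_h l • res_f n = tr_h (l • res_h res_f n)` in `N` turns a
transfer in `L` into a transfer in `N`. -/
theorem symb_rel (n : N.obj X) :
    (∀ {Y W : FinGSet G} (f : Map Y X) (h : Map W Y) (r : R.obj W) (l : L.obj Y),
      (symb f (R.tr h r) (l • N.res f n) : Box (TModule.ofAlgebra φ) (N.restrictScalars ψ) X) =
        symb (f.comp h) r (L.res h l • N.res (f.comp h) n)) ∧
    (∀ {Y W : FinGSet G} (f : Map Y X) (h : Map W Y) (r : R.obj Y) (l : L.obj W),
      (symb f r (L.tr h l • N.res f n) : Box (TModule.ofAlgebra φ) (N.restrictScalars ψ) X) =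
        symb (f.comp h) (R.res h r) (l • N.res (f.comp h) n)) ∧
    ∀ {Y : FinGSet G} (f : Map Y X) (a : k.obj Y) (r : R.obj Y) (l : L.obj Y),
      (symb f (φ.app Y a * r) (l • N.res f n) :
        Box (TModule.ofAlgebra φ) (N.restrictScalars ψ) X) =
        symb f r ((ψ.app Y a * l) • N.res f n) := by
  refine ⟨fun f h r l => ?_, fun f h r l => ?_, fun f a r l => ?_⟩
  · rw [symb_tr_left, N.res_smul, ← N.res_comp]
  · rw [N.res_comp, ← symb_tr_right, N.tr_smul_res]
  · rw [symb_smul, ← mul_smul]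

/-- The map `R ⊠_k L → R ⊠_k N`, `tr_f (r ⊗ l) ↦ tr_f (r ⊗ l • res_f n)`, for an element `n`
of an `L`-module `N`. -/
def actOn (n : N.obj X) : BoxAlg φ ψ X → Box (TModule.ofAlgebra φ) (N.restrictScalars ψ) X :=
  -- The entry `s.n` is typed as an element of the underlying `k`-module of `L`; fixing `α` selects
  -- the action of the ring `L.obj s.Y` on `N`.
  Quot.lift (fun s => symb s.f s.m (HSMul.hSMul (α := L.obj s.Y) s.n (N.res s.f n))) (by
    rintro _ _ (⟨f, h, r, l⟩ | ⟨f, h, r, l⟩ | ⟨f, a, r, l⟩)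
    · exact (symb_rel φ ψ n).1 f h r l
    · exact (symb_rel φ ψ n).2.1 f h r l
    · exact (symb_rel φ ψ n).2.2 f a r l)

variable {φ ψ}

theorem actOn_tmk (n : N.obj X) (f : Map Y X) (r : R.obj Y) (l : L.obj Y) :
    actOn φ ψ n (tmk f r l) = symb f r (l • N.res f n) := rfl

theorem actOn_tr_mul (n : N.obj X) (f : Map Y X) (r : R.obj Y) (l : L.obj Y) :
    actOn φ ψ n ((box φ ψ).tr f ((inl φ ψ).app Y r * (inr φ ψ).app Y l)) =
      symb f r (l • N.res f n) := by
  rw [← tmk_eq_tr, actOn_tmk]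

/-- Together with `actOn_tr_right` and `actOn_smul`, this says that the pairing `(s, n) ↦ actOn φ ψ
n s` satisfies Frobenius reciprocity in each variable and is balanced over `L`. These are the
conditions for it to factor through `(R ⊠_k L) ⊠_L N`. -/
theorem actOn_tr_left (h : Map Y X) (n : N.obj X) (s : BoxAlg φ ψ Y) :
    actOn φ ψ n (Box.tr h s) = Box.tr h (actOn φ ψ (N.res h n) s) := by
  induction s using tmk_ind with | h V f r l => _
  rw [tr_tmk, actOn_tmk, actOn_tmk, tr_symb, N.res_comp]

theorem actOn_tr_right (h : Map Y X) (n : N.obj Y) (s : BoxAlg φ ψ X) :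
    actOn φ ψ (N.tr h n) s = Box.tr h (actOn φ ψ n (Box.res h s)) := by
  induction s using tmk_ind with | h V f r l => _
  obtain ⟨W, p, q, hp⟩ := exists_isPullback f h
  -- The double coset formula rewrites `res_f (tr_h n)` as `tr_p (res_q n)`. The scalar `l` then
  -- passes inside `tr_p`, and Frobenius reciprocity moves that transfer out of the symbol.
  rw [res_tmk hp, actOn_tmk, actOn_tmk, tr_symb, N.res_tr hp.symm, ← N.tr_res_smul,
    symb_tr_right, Map.ext' (f := f.comp p) (g := h.comp q) hp.comm]

theorem actOn_smul (a : L.obj X) (n : N.obj X) (s : (box φ ψ).obj X) :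
    actOn φ ψ n ((inr φ ψ).app X a * s) = actOn φ ψ (a • n) s := by
  induction s using box_ind with | h V f r l => _
  rw [inr_mul_tr, actOn_tr_mul, actOn_tr_mul, N.res_smul, mul_comm, mul_smul]

theorem tr_actOn_rel (f : Map Y X) :
    (∀ {W : FinGSet G} (h : Map W Y) (s : BoxAlg φ ψ W) (n : N.obj Y),
      Box.tr f (actOn φ ψ n (Box.tr h s)) = Box.tr (f.comp h) (actOn φ ψ (N.res h n) s)) ∧
    (∀ {W : FinGSet G} (h : Map W Y) (s : BoxAlg φ ψ Y) (n : N.obj W),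
      Box.tr f (actOn φ ψ (N.tr h n) s) = Box.tr (f.comp h) (actOn φ ψ n (Box.res h s))) ∧
    ∀ (a : L.obj Y) (s : (box φ ψ).obj Y) (n : N.obj Y),
      Box.tr f (actOn φ ψ n ((inr φ ψ).app Y a * s)) = Box.tr f (actOn φ ψ (a • n) s) := by
  refine ⟨fun h s n => ?_, fun h s n => ?_, fun a s n => ?_⟩
  · rw [actOn_tr_left]
    exact ((Box.toSemiMackey _ _).tr_comp f h _).symm
  · rw [actOn_tr_right]
    exact ((Box.toSemiMackey _ _).tr_comp f h _).symm
  · rw [actOn_smul]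

/-- Compatibility of `r ⊗ n ↦ (r ⊗ 1) ⊗ n` with the relations of `R ⊠_k N`, as needed for the
inverse map. Balancing over `k` holds because `φ a ⊗ 1 = 1 ⊗ ψ a` in `R ⊠_k L`, and `1 ⊗ ψ a` moves
across the box product over `L`. -/
theorem mk_inl_rel (f : Map Y X) :
    (∀ {W : FinGSet G} (h : Map W Y) (r : R.obj W) (n : N.obj Y),
      (Box.mk (M := TModule.ofAlgebra (baseChange φ ψ)) (N := N) f
        ((inl φ ψ).app Y (R.tr h r)) n : Box _ _ X) =
        Box.mk (M := TModule.ofAlgebra (baseChange φ ψ)) (f.comp h) ((inl φ ψ).app W r)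
          (N.res h n)) ∧
    (∀ {W : FinGSet G} (h : Map W Y) (r : R.obj Y) (n : N.obj W),
      (Box.mk (M := TModule.ofAlgebra (baseChange φ ψ)) f ((inl φ ψ).app Y r)
        (N.tr h n) : Box _ _ X) =
        Box.mk (M := TModule.ofAlgebra (baseChange φ ψ)) (f.comp h)
          ((inl φ ψ).app W (R.res h r)) n) ∧
    ∀ (a : k.obj Y) (r : R.obj Y) (n : N.obj Y),
      (Box.mk (M := TModule.ofAlgebra (baseChange φ ψ)) f
        ((inl φ ψ).app Y (φ.app Y a * r)) n : Box _ _ X) =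
        Box.mk (M := TModule.ofAlgebra (baseChange φ ψ)) f ((inl φ ψ).app Y r)
          (ψ.app Y a • n) := by
  refine ⟨fun h r n => ?_, fun h r n => ?_, fun a r n => ?_⟩
  · rw [(inl φ ψ).app_tr]
    exact Box.mk_tr_left (M := TModule.ofAlgebra (baseChange φ ψ)) f h _ n
  · rw [(inl φ ψ).app_res]
    exact Box.mk_tr_right (M := TModule.ofAlgebra (baseChange φ ψ)) f h _ n
  · have e : (inl φ ψ).app Y (φ.app Y a) = (inr φ ψ).app Y (ψ.app Y a) :=
      congrArg (fun η : Hom k (box φ ψ) => η.app Y a) (inl_comp φ ψ)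
    rw [map_mul, e]
    exact Box.mk_smul (M := TModule.ofAlgebra (baseChange φ ψ)) f _ _ n

/-- The transfer leaves the left entry by Frobenius reciprocity, and the factor `1 ⊗ l` crosses to
`N`. So every symbol of `(R ⊠_k L) ⊠_L N` can be written with a left entry of the form `r ⊗ 1`, that
is, it lies in the image of the inverse map below. -/
theorem mk_tr_mul (g : Map Y X) (f : Map W Y) (r : R.obj W) (l : L.obj W) (n : N.obj Y) :
    (Box.mk (M := TModule.ofAlgebra (baseChange φ ψ)) g
      ((box φ ψ).tr f ((inl φ ψ).app W r * (inr φ ψ).app W l)) n : Box _ _ X) =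
      Box.mk (M := TModule.ofAlgebra (baseChange φ ψ)) (g.comp f) ((inl φ ψ).app W r)
        (l • N.res f n) := by
  rw [mul_comm]
  exact (Box.mk_tr_left (M := TModule.ofAlgebra (baseChange φ ψ)) g f _ n).trans
    (Box.mk_smul (M := TModule.ofAlgebra (baseChange φ ψ)) (g.comp f) l _ _)

variable (φ ψ N X)

/-- The isomorphism `(R ⊠_k L) ⊠_L N ≅ R ⊠_k N`, `r ⊗ n ↦ (r ⊗ 1) ⊗ n` in the inverse direction. -/
noncomputable def cancelBaseChange :
    Box (TModule.ofAlgebra (baseChange φ ψ)) N X ≃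
      Box (TModule.ofAlgebra φ) (N.restrictScalars ψ) X where
  toFun := Quot.lift (fun s => Box.tr s.f (actOn φ ψ s.n s.m)) (by
    rintro _ _ (⟨f, h, s, n⟩ | ⟨f, h, s, n⟩ | ⟨f, a, s, n⟩)
    · exact (tr_actOn_rel f).1 h s n
    · exact (tr_actOn_rel f).2.1 h s n
    · exact (tr_actOn_rel f).2.2 a s n)
  invFun := Quot.lift (fun s => Box.mk (M := TModule.ofAlgebra (baseChange φ ψ)) (N := N) s.f
      ((inl φ ψ).app s.Y s.m) s.n) (by
    rintro _ _ (⟨f, h, r, n⟩ | ⟨f, h, r, n⟩ | ⟨f, a, r, n⟩)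
    · exact (mk_inl_rel (φ := φ) (ψ := ψ) (N := N) f).1 h r n
    · exact (mk_inl_rel (φ := φ) (ψ := ψ) (N := N) f).2.1 h r n
    · exact (mk_inl_rel (φ := φ) (ψ := ψ) (N := N) f).2.2 a r n)
  left_inv t := by
    induction t using Box.ind with | h Y g s n => _
    induction s using box_ind with | h W f r l => _
    refine Eq.trans ?_ (mk_tr_mul g f r l n).symm
    rw [← tmk_eq_tr]
    rfl
  right_inv t := by
    induction t using Box.ind with | h Y f r n => _
    -- Since `r ⊗ 1` is the symbol with `l = 1` over an identity map, the composite returns `tr_f (r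
    -- ⊗ 1 • res_id n)`.
    refine congrArg (Box.mk (M := TModule.ofAlgebra φ) (N := N.restrictScalars ψ) f r) ?_
    exact (one_smul (L.obj Y) (N.res (Map.id Y) n)).trans (N.res_id n)

/-! ### Naturality of the cancellation and transport of exactness -/

variable {N X}

/-- Zero is the symbol `0 ⊗ 0` on either side, and the inverse bijection carries one to the other
because `r ↦ r ⊗ 1` preserves zero. Nothing more about the additive structure enters the transport
of exactness. -/
theorem cancelBaseChange_zero : cancelBaseChange φ ψ N X 0 = 0 := by
  rw [← Equiv.eq_symm_apply]
  have e1 := Box.mk_zero_left (M := TModule.ofAlgebra φ) (N := N.restrictScalars ψ) (Map.id X) 0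
  have e2 := Box.mk_zero_left (M := TModule.ofAlgebra (baseChange φ ψ)) (N := N) (Map.id X) 0
  refine e2.symm.trans (Eq.trans ?_ (congrArg (cancelBaseChange φ ψ N X).symm e1))
  exact congrArg (fun s => Box.mk (M := TModule.ofAlgebra (baseChange φ ψ)) (Map.id X) s 0)
    (map_zero ((inl φ ψ).app X)).symm

/-- Naturality is first checked for the inverse, whose value on a symbol is again a symbol with the
same `N`-entry, so that both sides agree by definition. The forward direction then follows formally.
-/
theorem cancelBaseChange_symm_boxMap {N' : TModule L} (η : TModule.Hom N N')
    (t : Box (TModule.ofAlgebra φ) (N.restrictScalars ψ) X) :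
    (cancelBaseChange φ ψ N' X).symm
        (((TModule.ofAlgebra φ).boxMap (η.restrictScalars ψ)).app X t) =
      ((TModule.ofAlgebra (baseChange φ ψ)).boxMap η).app X
        ((cancelBaseChange φ ψ N X).symm t) := by
  induction t using Box.ind with | h Y f r n => _
  rfl

theorem cancelBaseChange_boxMap {N' : TModule L} (η : TModule.Hom N N')
    (t : Box (TModule.ofAlgebra (baseChange φ ψ)) N X) :
    cancelBaseChange φ ψ N' X (((TModule.ofAlgebra (baseChange φ ψ)).boxMap η).app X t) =
      ((TModule.ofAlgebra φ).boxMap (η.restrictScalars ψ)).app X (cancelBaseChange φ ψ N X t) := by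
  refine ((cancelBaseChange φ ψ N' X).symm_apply_eq.1 ?_).symm
  refine (cancelBaseChange_symm_boxMap φ ψ η (cancelBaseChange φ ψ N X t)).trans ?_
  exact congrArg (((TModule.ofAlgebra (baseChange φ ψ)).boxMap η).app X)
    ((cancelBaseChange φ ψ N X).symm_apply_apply t)

/-- Exactness compares the preimage of zero with a range, so compatible bijections suffice as long
as the last one preserves zero. -/
theorem exact_of_equiv {A B C A' B' C' : Type*} [Zero C] [Zero C'] {a : A → B} {b : B → C}
    {a' : A' → B'} {b' : B' → C'} (eA : A ≃ A') (eB : B ≃ B') (eC : C ≃ C') (h0 : eC 0 = 0)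
    (ha : ∀ x, eB (a x) = a' (eA x)) (hb : ∀ x, eC (b x) = b' (eB x))
    (h : Function.Exact a' b') : Function.Exact a b := by
  intro t
  rw [← eC.injective.eq_iff, h0, hb, h (eB t)]
  constructor
  · rintro ⟨s, hs⟩
    exact ⟨eA.symm s, eB.injective (by rw [ha, eA.apply_symm_apply, hs])⟩
  · rintro ⟨s, rfl⟩
    exact ⟨eA s, (ha s).symm⟩

variable {φ}

/-- An exact sequence of `L`-modules stays exact over `k`, since restriction of scalars does not
change the underlying maps. Flatness of `R` preserves it under `R ⊠_k -`, and the cancellation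
bijections return the result to the box product over `L`. -/
theorem IsFlat.baseChange (h : IsFlat φ) : IsFlat (baseChange φ ψ) := fun A B C α β hαβ X =>
  exact_of_equiv (cancelBaseChange φ ψ A X) (cancelBaseChange φ ψ B X)
    (cancelBaseChange φ ψ C X) (cancelBaseChange_zero φ ψ) (cancelBaseChange_boxMap φ ψ α)
    (cancelBaseChange_boxMap φ ψ β)
    (h _ _ _ (α.restrictScalars ψ) (β.restrictScalars ψ) (fun X => hαβ X) X)

end Flat

end Tambara

end BaseChange

theorem mainTheorem8 {G : Type u} [Group G] [Finite G] {k l R : Tambara.{w} G}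
    (f : Tambara.Hom k l) (φ : Tambara.Hom k R) :
    (Tambara.IsFinitelyPresented φ → Tambara.IsFinitelyPresented (Tambara.baseChange φ f)) ∧
    (Tambara.IsFlat φ → Tambara.IsFlat (Tambara.baseChange φ f)) ∧
    (Tambara.IsFlat f → (Tambara.kaehler φ).IsZero →
      (Tambara.kaehler (Tambara.baseChange φ f)).IsZero) ∧
    (Tambara.IsFlat f → Tambara.IsEtale φ → Tambara.IsEtale (Tambara.baseChange φ f)) := by
  exact ⟨fun h => h.baseChange f, fun h => h.baseChange f,
    fun _ h => Tambara.kaehler_baseChange_isZero f h,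
    fun _ h => ⟨⟨Tambara.kaehler_baseChange_isZero f h.1.1, h.1.2.baseChange f⟩,
      h.2.baseChange f⟩⟩
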